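/- Let $d\ge 1$ be an integer and $\Theta>0$. Let $A_1,\dots,A_d$ be real $3\times 3$ matrices with $A_d$ invertible, and put $L(\tau,\xi):=\tau I+\sum_{j=1}^d \xi_j A_j$ for $\tau\in\mathbb R$, $\xi\in\mathbb R^d$. Let $(\underline\tau,\underline\eta)\in\mathbb R\times\mathbb R^{d-1}$ and let $\underline\omega_1,\underline\omega_2,\underline\omega_3$ be pairwise distinct real numbers with $\det L(\underline\tau,\underline\eta,\underline\omega_m)=0$ for $m=1,2,3$. Assume the small divisor condition: there exist $c_0>0$ and $\gamma\in\mathbb R$ such that for all $k_1,k_3\in\mathbb Z\setminus\{0\}$ $$\big|\det L\big((k_1+k_3)\underline\tau,\,(k_1+k_3)\underline\eta,\,k_1\underline\omega_1+k_3\underline\omega_3\big)\big|\ \ge\ c_0\,|(k_1,k_3)|^{-\gamma}.$$ Set $\delta_1:=\frac{\underline\omega_1-\underline\omega_2}{\underline\omega_3-\underline\omega_1}$, $\delta_3:=\frac{\underline\omega_3-\underline\omega_2}{\underline\omega_3-\underline\omega_1}$. For functions $u,v$ on $\mathbb R^{d-1}_y\times(\mathbb R/\Theta\mathbb Z)_\theta$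 with Fourier coefficients $u_k(y),v_k(y)$ in the variable $\theta$, let $$\mathbb F_{\rm per}(u,v):=\sum_{k\in\mathbb Z}\Big(\sum_{k_1+k_3=k,\ k_1k_3\ne 0}\frac{i\,u_{k_1}v_{k_3}}{k_1\delta_1+k_3\delta_3}\Big)e^{2i\pi k\theta/\Theta}.$$ Let $H^\nu$, $\nu\in\mathbb N$, be the Sobolev space of real-valued functions on $\mathbb R^{d-1}\times(\mathbb R/\Theta\mathbb Z)$, and $H^{+\infty}:=\bigcap_\nu H^\nu$. Then there exists an integer $\nu_0>1+d/2$ with the following two properties. (i) For every integer $\nu\ge\nu_0$ there is a constant $C_\nu$ such that for all $u,v\in H^\nu$ $$\|\mathbb F_{\rm per}(\partial_\theta u,\partial_\theta v)\|_{H^\nu}\le C_\nu\big(\|u\|_{H^{\nu_0}}\|v\|_{H^\nu}+\|u\|_{H^\nu}\|v\|_{H^{\nu_0}}\big).$$ (ii) For all ${\bf w}\in\mathbb R^{d-1}$, $c,\mu\in\mathbb R$ and all $R>0$ there exists $T>0$ such that for every integer $\nu\ge\nu_0$ and every $a_0\in H^\nu$ with $\|a_0\|_{H^{\nu_0}}\le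 R$, there exists a unique solution $a\in\mathcal C([0,T];H^\nu)$ of the Cauchy problem $$\partial_t a+{\bf w}\cdot\nabla_y a+c\,a\,\partial_\theta a+\mu\,\mathbb F_{\rm per}(\partial_\theta a,\partial_\theta a)=0,\qquad a|_{t=0}=a_0 .$$ In particular, with the same $T$, which depends on $a_0$ only through the bound $R$ on $\|a_0\|_{H^{\nu_0}}$, if $a_0\in H^{+\infty}$ and $\|a_0\|_{H^{\nu_0}}\le R$, then this solution satisfies $a\in\mathcal C([0,T];H^{+\infty})$, i.e. $a\in\mathcal C([0,T];H^{\nu})$ for all $\nu\in\mathbb N$. -/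

import Mathlib

open MeasureTheory Filter Topology Set FourierTransform
open scoped ENNReal NNReal

noncomputable section

namespace MachStem

/-! ### Function spaces on `ℝ^(d-1) × (ℝ/Θℤ)` -/

/-- The space `ℝ^(d-1)` of the tangential variable `y`. -/
abbrev Tan (d : ℕ) : Type := EuclideanSpace ℝ (Fin (d - 1))

/-- Real-valued square integrable functions on `ℝ^(d-1) × (ℝ/Θℤ)`. -/
abbrev L2 (d : ℕ) (Θ : ℝ) [Fact (0 < Θ)] : Type :=
  Lp ℝ 2 (volume : Measure (Tan d × AddCircle Θ))

variable {d : ℕ} {Θ : ℝ} [Fact (0 < Θ)]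

/-- The `k`-th Fourier coefficient in `θ`, as a function of `y`:
`u_k(y) = Θ⁻¹ ∫_0^Θ u(y,θ) exp(-2πikθ/Θ) dθ`. -/
def modeFun (u : L2 d Θ) (k : ℤ) (y : Tan d) : ℂ :=
  fourierCoeff (fun θ : AddCircle Θ => ((u (y, θ) : ℝ) : ℂ)) k

theorem memLp_modeFun (u : L2 d Θ) (k : ℤ) :
    MemLp (modeFun u k) 2 (volume : Measure (Tan d)) := by
  have hu : StronglyMeasurable (u : Tan d × AddCircle Θ → ℝ) := Lp.stronglyMeasurable u
  have hmeas : StronglyMeasurable (modeFun u k) := by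
    have h : StronglyMeasurable (fun p : Tan d × AddCircle Θ =>
        fourier (-k) p.2 • ((u p : ℝ) : ℂ)) := by
      have h1 : StronglyMeasurable
          (fun p : Tan d × AddCircle Θ => (fourier (-k) p.2 : ℂ)) :=
        ((fourier (-k)).continuous.comp continuous_snd).stronglyMeasurable
      have h2 : StronglyMeasurable (fun p : Tan d × AddCircle Θ => ((u p : ℝ) : ℂ)) :=
        Complex.continuous_ofReal.comp_stronglyMeasurable hu
      exact h1.mul h2
    exact h.integral_prod_right
  refine ⟨hmeas.aestronglyMeasurable, ?_⟩
  have hpt : ∀ y : Tan d, ‖modeFun u k y‖ₑ ^ 2 ≤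
      ∫⁻ θ : AddCircle Θ, ‖u (y, θ)‖ₑ ^ 2 ∂AddCircle.haarAddCircle := by
    intro y
    have hy : StronglyMeasurable (fun θ : AddCircle Θ => u (y, θ)) :=
      hu.comp_measurable measurable_prodMk_left
    have h1 : ‖modeFun u k y‖ₑ ≤
        ∫⁻ θ : AddCircle Θ, ‖u (y, θ)‖ₑ ∂AddCircle.haarAddCircle := by
      refine (enorm_integral_le_lintegral_enorm _).trans (le_of_eq ?_)
      refine lintegral_congr fun θ => ?_
      rw [enorm_smul]
      have : ‖(fourier (-k) θ : ℂ)‖ₑ = 1 := by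
        rw [← ofReal_norm, fourier_apply, Circle.norm_coe, ENNReal.ofReal_one]
      rw [this, one_mul, ← ofReal_norm, ← ofReal_norm, Complex.norm_real]
    have h2 := eLpNorm_le_eLpNorm_of_exponent_le (μ := (AddCircle.haarAddCircle (T := Θ)))
      (p := 1) (q := 2) (by norm_num) hy.aestronglyMeasurable
    rw [eLpNorm_one_eq_lintegral_enorm] at h2
    have h3 := pow_le_pow_left' (h1.trans h2) 2
    refine h3.trans (le_of_eq ?_)
    rw [eLpNorm_eq_lintegral_rpow_enorm_toReal (by norm_num) (by norm_num), ← ENNReal.rpow_natCast,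
      ← ENNReal.rpow_mul]
    simp
  have hfin : ∫⁻ p : Tan d × AddCircle Θ, ‖u p‖ₑ ^ 2 < ∞ := by
    have := (eLpNorm_lt_top_iff_lintegral_rpow_enorm_lt_top (p := 2) (by norm_num) (by norm_num)).1
      (Lp.memLp u).2
    simpa using this
  rw [eLpNorm_lt_top_iff_lintegral_rpow_enorm_lt_top (by norm_num) (by norm_num)]
  have hc : ∀ y : Tan d, ∫⁻ θ : AddCircle Θ, ‖u (y, θ)‖ₑ ^ 2 =
      ENNReal.ofReal Θ * ∫⁻ θ : AddCircle Θ, ‖u (y, θ)‖ₑ ^ 2 ∂AddCircle.haarAddCircle := by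
    intro y
    rw [AddCircle.volume_eq_smul_haarAddCircle, lintegral_smul_measure, smul_eq_mul]
  have hme : Measurable (fun p : Tan d × AddCircle Θ => ‖u p‖ₑ ^ 2) :=
    hu.measurable.enorm.pow_const 2
  replace hfin : ∫⁻ y : Tan d, ∫⁻ θ : AddCircle Θ, ‖u (y, θ)‖ₑ ^ 2 < ∞ :=
    (lintegral_prod (μ := (volume : Measure (Tan d)))
      (ν := (volume : Measure (AddCircle Θ))) _ hme.aemeasurable).symm.trans_lt hfin
  simp_rw [hc] at hfin
  have hΘ : ENNReal.ofReal Θ ≠ 0 := by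
    simpa using (Fact.out : 0 < Θ)
  rw [lintegral_const_mul' _ _ ENNReal.ofReal_ne_top] at hfin
  have hfin' : ∫⁻ y : Tan d, ∫⁻ θ : AddCircle Θ, ‖u (y, θ)‖ₑ ^ 2 ∂AddCircle.haarAddCircle < ∞ := by
    by_contra hcon
    rw [not_lt, top_le_iff] at hcon
    rw [hcon, ENNReal.mul_top hΘ] at hfin
    exact lt_irrefl _ hfin
  refine lt_of_le_of_lt (lintegral_mono fun y => ?_) hfin'
  simpa using hpt y

/-- The `k`-th Fourier coefficient in `θ`, as an element of `L²(ℝ^(d-1); ℂ)`. -/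
def mode (u : L2 d Θ) (k : ℤ) : Lp ℂ 2 (volume : Measure (Tan d)) :=
  (memLp_modeFun u k).toLp (modeFun u k)

/-- The Fourier transform in `y` (with kernel `exp(-2πi y·ξ)`) of the `k`-th Fourier coefficient
in `θ`. -/
def transform (u : L2 d Θ) (k : ℤ) : Lp ℂ 2 (volume : Measure (Tan d)) :=
  𝓕 (mode u k)

/-- The Sobolev norm of index `ν` on `ℝ^(d-1) × (ℝ/Θℤ)`, with value `∞` outside `H^ν`:
`‖u‖² = Θ ∑_k ∫ (1 + |2πξ|² + (2πk/Θ)²)^ν |û_k(ξ)|² dξ`. -/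
def sobolevNorm (ν : ℕ) (u : L2 d Θ) : ℝ≥0∞ :=
  (ENNReal.ofReal Θ * ∑' k : ℤ, ∫⁻ ξ : Tan d,
    ENNReal.ofReal ((1 + (2 * Real.pi * ‖ξ‖) ^ 2 + (2 * Real.pi * k / Θ) ^ 2) ^ ν)
      * ‖transform u k ξ‖ₑ ^ 2) ^ (1 / 2 : ℝ)

/-- `u ∈ H^ν(ℝ^(d-1) × (ℝ/Θℤ))`. -/
def MemH (ν : ℕ) (u : L2 d Θ) : Prop := sobolevNorm ν u < ∞

/-- `a ∈ C([0,T]; H^ν)`. -/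
def ContinuousInH (ν : ℕ) (T : ℝ) (a : ℝ → L2 d Θ) : Prop :=
  (∀ t ∈ Icc 0 T, MemH ν (a t)) ∧
  ∀ t₀ ∈ Icc 0 T, Tendsto (fun t => sobolevNorm ν (a t - a t₀)) (𝓝[Icc 0 T] t₀) (𝓝 0)

/-! ### The terms of the equation

Each relation below determines its last argument uniquely, as an element of `L²`. -/

/-- `v = ∂_θ u`. -/
def IsThetaDeriv (u v : L2 d Θ) : Prop :=
  ∀ k : ℤ, mode v k = (2 * Real.pi * k / Θ * Complex.I : ℂ) • mode u k

/-- `v = w · ∇_y u`. -/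
def IsTransport (w : Tan d) (u v : L2 d Θ) : Prop :=
  ∀ k : ℤ, transform v k =ᵐ[volume]
    fun ξ => (2 * Real.pi * (inner ℝ w ξ : ℝ) * Complex.I : ℂ) * transform u k ξ

/-- `q = u v`. -/
def IsProduct (u v q : L2 d Θ) : Prop :=
  q =ᵐ[volume] fun x => u x * v x

/-- `F = 𝔽_per(u,v)`, the bilinear Fourier multiplier in `θ` whose `k`-th Fourier coefficient is
`∑ i u_{k₁} v_{k₃} / (k₁ δ₁ + k₃ δ₃)`, summed over `k₁ + k₃ = k` with `k₁ k₃ ≠ 0`. -/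
def IsFper (δ₁ δ₃ : ℝ) (u v F : L2 d Θ) : Prop :=
  ∀ k : ℤ, ∀ᵐ y : Tan d, HasSum
    (fun k₁ : ℤ => if k₁ * (k - k₁) ≠ 0 then
        Complex.I * mode u k₁ y * mode v (k - k₁) y / ((k₁ * δ₁ + (k - k₁ : ℤ) * δ₃ : ℝ) : ℂ)
      else 0)
    (mode F k y)

/-- `a` solves, for all `t ∈ [0,T]`,
`∂_t a + w·∇_y a + c a ∂_θ a + μ 𝔽_per(∂_θ a, ∂_θ a) = 0`, with `a(0) = a₀`;
the time derivative is taken in `L²` (one-sided at the end points). -/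
def Solves (δ₁ δ₃ : ℝ) (w : Tan d) (c μ T : ℝ) (a₀ : L2 d Θ) (a : ℝ → L2 d Θ) : Prop :=
  a 0 = a₀ ∧
  ∀ t ∈ Icc 0 T, ∃ aθ p q F : L2 d Θ,
    IsThetaDeriv (a t) aθ ∧ IsTransport w (a t) p ∧ IsProduct (a t) aθ q ∧
    IsFper δ₁ δ₃ aθ aθ F ∧
    HasDerivWithinAt a (-(p + c • q + μ • F)) (Icc 0 T) t

/-- `a ∈ C([0,T]; H^ν)` solves the Cauchy problem with initial value `a₀`. -/
def IsSolution (ν : ℕ) (δ₁ δ₃ : ℝ) (w : Tan d) (c μ T : ℝ) (a₀ : L2 d Θ) (a : ℝ → L2 d Θ) :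
    Prop :=
  ContinuousInH ν T a ∧ Solves δ₁ δ₃ w c μ T a₀ a

/-- The tame estimate for `𝔽_per(∂_θ u, ∂_θ v)` with base index `ν₀`. -/
def TameEstimate (d : ℕ) (Θ : ℝ) [Fact (0 < Θ)] (δ₁ δ₃ : ℝ) (ν₀ : ℕ) : Prop :=
  ∀ ν ≥ ν₀, ∃ C : ℝ≥0, ∀ u v : L2 d Θ, MemH ν u → MemH ν v →
    ∃ uθ vθ F : L2 d Θ, IsThetaDeriv u uθ ∧ IsThetaDeriv v vθ ∧ IsFper δ₁ δ₃ uθ vθ F ∧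
      sobolevNorm ν F ≤
        C * (sobolevNorm ν₀ u * sobolevNorm ν v + sobolevNorm ν u * sobolevNorm ν₀ v)

/-! ### The phases -/

/-- The symbol `L(τ,η,ξ_d) = τ I + ∑_{j<d} η_j A_j + ξ_d A_d` of a `3 × 3` first order system in
`d` space variables; `A` holds the matrices `A_1, …, A_{d-1}`. -/
def symbol (A : Fin (d - 1) → Matrix (Fin 3) (Fin 3) ℝ) (Ad : Matrix (Fin 3) (Fin 3) ℝ)
    (τ : ℝ) (η : Fin (d - 1) → ℝ) (ξd : ℝ) : Matrix (Fin 3) (Fin 3) ℝ :=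
  τ • (1 : Matrix (Fin 3) (Fin 3) ℝ) + ∑ j, η j • A j + ξd • Ad

/-- The small divisor condition
`|det L(d(k₁ φ₁ + k₃ φ₃))| ≥ c |(k₁,k₃)|^(-γ)` for nonzero integers `k₁, k₃`, where
`φ_m = τ t + η·y + ω_m x_d`. The phases `φ₁, φ₂, φ₃` have the indices `0, 1, 2`. -/
def SmallDivisor (A : Fin (d - 1) → Matrix (Fin 3) (Fin 3) ℝ) (Ad : Matrix (Fin 3) (Fin 3) ℝ)
    (τ : ℝ) (η : Fin (d - 1) → ℝ) (ω : Fin 3 → ℝ) : Prop :=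
  ∃ c > (0 : ℝ), ∃ γ : ℝ, ∀ k₁ k₃ : ℤ, k₁ ≠ 0 → k₃ ≠ 0 →
    c * Real.sqrt ((k₁ : ℝ) ^ 2 + (k₃ : ℝ) ^ 2) ^ (-γ) ≤
      |(symbol A Ad ((k₁ + k₃) * τ) (fun j => (k₁ + k₃) * η j) (k₁ * ω 0 + k₃ * ω 2)).det|

/-- `δ₁ = (ω₁ - ω₂)/(ω₃ - ω₁)`. -/
def delta₁ (ω : Fin 3 → ℝ) : ℝ := (ω 0 - ω 1) / (ω 2 - ω 0)

/-- `δ₃ = (ω₃ - ω₂)/(ω₃ - ω₁)`. -/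
def delta₃ (ω : Fin 3 → ℝ) : ℝ := (ω 2 - ω 1) / (ω 2 - ω 0)

end MachStem

end

open MachStem

noncomputable section

set_option linter.unusedSectionVars false

namespace MachStem

/-! ### Convolution inequalities -/

section Convolution

/-! The multiplier of `𝔽_per(∂_θ u, ∂_θ v)` is a constant times `k₁k₃/(k₁δ₁ + k₃δ₃)`, and everything
rests on bounding it by a power of `min(|k₁|, |k₃|)`. The determinant of the symbol is a binary
cubic form in the phase variables whose three roots are known, so at the sum of two phases it equals
a nonzero constant times `k₁k₃(k₁δ₁ + k₃δ₃)` (`det_symbol_eq`). If one index dominates, the divisor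
is comparable with that index and cancels it; otherwise the indices are comparable and the small
divisor condition costs a power of either one (`mul_le_of_divisor_bound`, `exists_fperBound`). Thus
`𝔽_per(∂_θ·, ∂_θ·)` loses derivatives only on the factor of lower frequency, and Young's inequality
gives the tame estimate (`tameEstimate`).

The equation is therefore a Burgers equation with a skew transport term and a perturbation that is
harmless at high frequency. On the Fourier side, with `b` the Japanese bracket, the unknown is `h =
b^s â` in `L²`, and the quadratic term has a symbol `iκ(y) + O(min(b x, b y)^M)` with `κ` real and
additive. In the energy estimate for a weight `φ(b)`, reality of the solution and additivity of `κ`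
move the derivative onto the low frequency factor (`ofReal_abs_re_leading_le`), and the commutator
with the weight is controlled by `IsWeight.abs_sub_mul_le`. The outcome,
`abs_re_inner_radL_bilL_le`, bounds the growth of the squared weighted norm by a constant, depending
on the weight only through its growth exponent, times the base norm times that same squared weighted
norm. Being linear in the squared weighted norm, it holds for as long as the base norm is
controlled: this is why one time `T` serves every `ν`.

Existence follows from Galerkin truncation to `b ≤ n` (`exists_galerkin_uniform`). The
approximations are Cauchy in `L²` (`norm_sub_sq_le_of_galerkin`). The weights `q^s min(1, q/ρ)` are
admissible uniformly in `ρ`, so the energy estimate keeps the high frequency tails as small as those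
of the data, uniformly in `n`; together with the `L²` convergence this yields uniform convergence in
the base norm (`exists_fourier_solution`). The same device gives continuity in time with values in
`H^ν` (`continuousInH_of_wnorm_le`). Uniqueness is the `L²` stability estimate
`abs_re_inner_sub_le`.

The return to physical space is elementary because at base regularity all terms have integrable
transforms: the inversion formula holds almost everywhere, products become convolutions by Fubini,
and each relation defining a term of the equation becomes an identity of transforms
(`isProduct_iff_tr_eq`, `isFper_iff_tr_eq`). -/

theorem eLpNorm_two_eq {α ε : Type*} [MeasurableSpace α] {μ : Measure α} [ENorm ε] (f : α → ε) :
    eLpNorm f 2 μ = (∫⁻ x, ‖f x‖ₑ ^ 2 ∂μ) ^ (1 / 2 : ℝ) := by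
  rw [eLpNorm_eq_lintegral_rpow_enorm_toReal (by norm_num) (by norm_num)]
  simp

variable {G : Type*} [AddCommGroup G] [MeasurableSpace G] [MeasurableAdd₂ G] [MeasurableNeg G]
  {μ : Measure G} [SFinite μ] [μ.IsAddLeftInvariant] [μ.IsNegInvariant]

/-- The bilinear operator with symbol `m`, in Fourier variables. -/
def pseudo (μ : Measure G) (m : G → G → ℂ) (f g : G → ℂ) (x : G) : ℂ :=
  ∫ y, m (x - y) y * (f (x - y) * g y) ∂μ

theorem measurable_lconv {F H : G → ℝ≥0∞} (hF : Measurable F) (hH : Measurable H) :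
    Measurable fun x => ∫⁻ y, F (x - y) * H y ∂μ := by
  refine Measurable.lintegral_prod_right' (f := fun p : G × G => F (p.1 - p.2) * H p.2) ?_
  exact (hF.comp (measurable_fst.sub measurable_snd)).mul (hH.comp measurable_snd)

theorem lconv_swap {F H : G → ℝ≥0∞} (x : G) :
    ∫⁻ y, F (x - y) * H y ∂μ = ∫⁻ y, H (x - y) * F y ∂μ := by
  rw [← lintegral_sub_left_eq_self (μ := μ) (fun y => F (x - y) * H y) x]
  simp [mul_comm]

/-- Young's inequality. Cauchy–Schwarz for the measure with density `F (x - y)` bounds the squared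
convolution pointwise; Tonelli and invariance of the measure then integrate the bound. -/
theorem lintegral_lconv_sq_le {F H : G → ℝ≥0∞} (hF : Measurable F) (hH : Measurable H) :
    ∫⁻ x, (∫⁻ y, F (x - y) * H y ∂μ) ^ 2 ∂μ ≤ (∫⁻ x, F x ∂μ) ^ 2 * ∫⁻ x, H x ^ 2 ∂μ := by
  have hpt : ∀ x, (∫⁻ y, F (x - y) * H y ∂μ) ^ 2 ≤
      (∫⁻ y, F y ∂μ) * ∫⁻ y, F (x - y) * H y ^ 2 ∂μ := by
    intro x
    have hFx : Measurable fun y => F (x - y) := hF.comp (measurable_const.sub measurable_id)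
    have h := ENNReal.lintegral_mul_norm_pow_le (μ := μ) (p := 1 / 2) (q := 1 / 2)
      hFx.aemeasurable (hFx.mul (hH.pow_const 2)).aemeasurable (by norm_num) (by norm_num)
      (by norm_num)
    have e : ∀ y, F (x - y) ^ (1 / 2 : ℝ) * ((fun y => F (x - y)) * fun y => H y ^ 2) y ^ (1 / 2 : ℝ)
        = F (x - y) * H y := by
      intro y
      simp only [Pi.mul_apply]
      rw [ENNReal.mul_rpow_of_nonneg _ _ (by norm_num), ← mul_assoc,
        ← ENNReal.rpow_add_of_nonneg _ _ (by norm_num) (by norm_num), ← ENNReal.rpow_natCast,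
        ← ENNReal.rpow_mul]
      norm_num
    simp_rw [e] at h
    have h2 := pow_le_pow_left' h 2
    refine h2.trans (le_of_eq ?_)
    rw [mul_pow, ← ENNReal.rpow_natCast, ← ENNReal.rpow_natCast, ← ENNReal.rpow_mul,
      ← ENNReal.rpow_mul]
    norm_num
    rw [lintegral_sub_left_eq_self]
  calc ∫⁻ x, (∫⁻ y, F (x - y) * H y ∂μ) ^ 2 ∂μ
      ≤ ∫⁻ x, (∫⁻ y, F y ∂μ) * ∫⁻ y, F (x - y) * H y ^ 2 ∂μ ∂μ := lintegral_mono hpt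
    _ = (∫⁻ y, F y ∂μ) * ∫⁻ x, ∫⁻ y, F (x - y) * H y ^ 2 ∂μ ∂μ :=
        lintegral_const_mul _ (measurable_lconv hF (hH.pow_const 2))
    _ = (∫⁻ y, F y ∂μ) * ∫⁻ y, ∫⁻ x, F (x - y) * H y ^ 2 ∂μ ∂μ := by
        rw [lintegral_lintegral_swap]
        exact ((hF.comp (measurable_fst.sub measurable_snd)).mul
          ((hH.comp measurable_snd).pow_const 2)).aemeasurable
    _ = (∫⁻ y, F y ∂μ) * ∫⁻ y, (∫⁻ x, F x ∂μ) * H y ^ 2 ∂μ := by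
        congr 1
        refine lintegral_congr fun y => ?_
        rw [lintegral_mul_const _ (show Measurable fun x => F (x - y) from
          hF.comp (measurable_id.sub measurable_const)),
          lintegral_sub_right_eq_self]
    _ = _ := by rw [lintegral_const_mul _ (hH.pow_const 2), sq, mul_assoc]

theorem eLpNorm_lconv_le {F H : G → ℝ≥0∞} (hF : Measurable F) (hH : Measurable H) :
    eLpNorm (fun x => ∫⁻ y, F (x - y) * H y ∂μ) 2 μ ≤ eLpNorm F 1 μ * eLpNorm H 2 μ := by
  rw [eLpNorm_two_eq, eLpNorm_two_eq, eLpNorm_one_eq_lintegral_enorm]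
  simp only [enorm_eq_self]
  refine (ENNReal.rpow_le_rpow (lintegral_lconv_sq_le hF hH) (by norm_num)).trans (le_of_eq ?_)
  rw [ENNReal.mul_rpow_of_nonneg _ _ (by norm_num), ← ENNReal.rpow_natCast, ← ENNReal.rpow_mul]
  norm_num

theorem eLpNorm_lconv_le' {F H : G → ℝ≥0∞} (hF : Measurable F) (hH : Measurable H) :
    eLpNorm (fun x => ∫⁻ y, F (x - y) * H y ∂μ) 2 μ ≤ eLpNorm F 2 μ * eLpNorm H 1 μ := by
  simp_rw [lconv_swap (F := F)]
  rw [mul_comm]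
  exact eLpNorm_lconv_le hH hF

theorem lintegral_mul_le_eLpNorm_two {F H : G → ℝ≥0∞} (hF : Measurable F) (hH : Measurable H) :
    ∫⁻ x, F x * H x ∂μ ≤ eLpNorm F 2 μ * eLpNorm H 2 μ := by
  rw [eLpNorm_two_eq, eLpNorm_two_eq]
  have := ENNReal.lintegral_mul_le_Lp_mul_Lq μ (p := 2) (q := 2)
    (by constructor <;> norm_num) hF.aemeasurable hH.aemeasurable
  simpa using this

theorem measurable_pseudo {m : G → G → ℂ} {f g : G → ℂ} (hm : Measurable (Function.uncurry m))
    (hf : Measurable f) (hg : Measurable g) : Measurable (pseudo μ m f g) := by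
  have h : StronglyMeasurable (Function.uncurry fun x y : G => m (x - y) y * (f (x - y) * g y)) := by
    refine Measurable.stronglyMeasurable ?_
    exact (hm.comp ((measurable_fst.sub measurable_snd).prodMk measurable_snd)).mul
      ((hf.comp (measurable_fst.sub measurable_snd)).mul (hg.comp measurable_snd))
  exact h.integral_prod_right.measurable

theorem measurable_enorm_smul {W : G → ℝ} {f : G → ℂ} (hW : Measurable W) (hf : Measurable f) :
    Measurable fun x => ‖W x • f x‖ₑ := (hW.smul hf).enorm

/-- Young's inequality for weighted pseudo-products, with a symbol bound split in two parts. -/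
theorem eLpNorm_smul_pseudo_le {m : G → G → ℂ} {f g : G → ℂ} {W W₁ W₂ W₃ W₄ : G → ℝ} {C : ℝ}
    (hf : Measurable f) (hg : Measurable g) (hW₁ : Measurable W₁) (hW₂ : Measurable W₂)
    (hW₃ : Measurable W₃) (hW₄ : Measurable W₄)
    (h : ∀ x y, |W (x + y)| * ‖m x y‖ ≤ C * (|W₁ x| * |W₂ y| + |W₃ x| * |W₄ y|)) :
    eLpNorm (fun x => W x • pseudo μ m f g x) 2 μ ≤ ENNReal.ofReal C *
      (eLpNorm (fun x => W₁ x • f x) 2 μ * eLpNorm (fun x => W₂ x • g x) 1 μ +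
        eLpNorm (fun x => W₃ x • f x) 1 μ * eLpNorm (fun x => W₄ x • g x) 2 μ) := by
  have m1 := measurable_enorm_smul hW₁ hf
  have m2 := measurable_enorm_smul hW₂ hg
  have m3 := measurable_enorm_smul hW₃ hf
  have m4 := measurable_enorm_smul hW₄ hg
  have hpt : ∀ x, ‖W x • pseudo μ m f g x‖ₑ ≤ ‖ENNReal.ofReal C *
      ((∫⁻ y, ‖W₁ (x - y) • f (x - y)‖ₑ * ‖W₂ y • g y‖ₑ ∂μ) +
        ∫⁻ y, ‖W₃ (x - y) • f (x - y)‖ₑ * ‖W₄ y • g y‖ₑ ∂μ)‖ₑ := by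
    intro x
    rw [enorm_eq_self, enorm_smul, pseudo]
    refine (mul_le_mul_right (enorm_integral_le_lintegral_enorm _) _).trans ?_
    rw [← lintegral_const_mul' _ _ (by simp), ← lintegral_add_left, ← lintegral_const_mul]
    · refine lintegral_mono fun y => ?_
      simp only [enorm_smul, enorm_mul]
      have := h (x - y) y
      rw [sub_add_cancel] at this
      have h2 := ENNReal.ofReal_le_ofReal this
      have hC : 0 ≤ |W₁ (x - y)| * |W₂ y| + |W₃ (x - y)| * |W₄ y| := by positivity
      rw [ENNReal.ofReal_mul' hC, ENNReal.ofReal_add (by positivity) (by positivity),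
        ENNReal.ofReal_mul (by positivity), ENNReal.ofReal_mul (by positivity),
        ENNReal.ofReal_mul (by positivity)] at h2
      simp only [← Real.norm_eq_abs, ofReal_norm] at h2
      calc ‖W x‖ₑ * (‖m (x - y) y‖ₑ * (‖f (x - y)‖ₑ * ‖g y‖ₑ))
          = (‖W x‖ₑ * ‖m (x - y) y‖ₑ) * (‖f (x - y)‖ₑ * ‖g y‖ₑ) := by ring
        _ ≤ _ := mul_le_mul_left h2 _
        _ = _ := by ring
    · exact ((m1.comp (measurable_const.sub measurable_id)).mul m2).add
        ((m3.comp (measurable_const.sub measurable_id)).mul m4)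
    · exact (m1.comp (measurable_const.sub measurable_id)).mul m2
  refine (eLpNorm_mono_enorm hpt).trans ?_
  have i1 := measurable_lconv (μ := μ) m1 m2
  have i2 := measurable_lconv (μ := μ) m3 m4
  have hc : eLpNorm (fun x => ENNReal.ofReal C *
      ((∫⁻ y, ‖W₁ (x - y) • f (x - y)‖ₑ * ‖W₂ y • g y‖ₑ ∂μ) +
        ∫⁻ y, ‖W₃ (x - y) • f (x - y)‖ₑ * ‖W₄ y • g y‖ₑ ∂μ)) 2 μ ≤ ENNReal.ofReal C *
      eLpNorm (fun x => 
      ((∫⁻ y, ‖W₁ (x - y) • f (x - y)‖ₑ * ‖W₂ y • g y‖ₑ ∂μ) +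
        ∫⁻ y, ‖W₃ (x - y) • f (x - y)‖ₑ * ‖W₄ y • g y‖ₑ ∂μ)) 2 μ := by
    rw [eLpNorm_two_eq, eLpNorm_two_eq]
    simp only [enorm_eq_self, mul_pow]
    rw [lintegral_const_mul' _ _ (by simp), ENNReal.mul_rpow_of_nonneg _ _ (by norm_num),
      ← ENNReal.rpow_natCast, ← ENNReal.rpow_mul]
    norm_num
  refine hc.trans (mul_le_mul_right ?_ _)
  refine (eLpNorm_add_le i1.aestronglyMeasurable i2.aestronglyMeasurable (by norm_num)).trans ?_
  refine add_le_add ?_ ?_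
  · simpa only [eLpNorm_enorm] using eLpNorm_lconv_le' (μ := μ) m1 m2
  · simpa only [eLpNorm_enorm] using eLpNorm_lconv_le (μ := μ) m3 m4

/-- Cauchy–Schwarz for `v⁻¹ · (v f)`. With `v` a power of the bracket this plays the role of the
Sobolev embedding: it controls the `L¹` norm of a Fourier transform. -/
theorem eLpNorm_one_le_eLpNorm_two_mul {v : G → ℝ} {f : G → ℂ} (hv : Measurable v)
    (hv0 : ∀ x, v x ≠ 0) (hf : Measurable f) :
    eLpNorm f 1 μ ≤ eLpNorm (fun x => (v x)⁻¹) 2 μ * eLpNorm (fun x => v x • f x) 2 μ := by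
  rw [eLpNorm_one_eq_lintegral_enorm]
  have := lintegral_mul_le_eLpNorm_two (μ := μ) (F := fun x => ‖(v x)⁻¹‖ₑ)
    (H := fun x => ‖v x • f x‖ₑ) hv.inv.enorm (measurable_enorm_smul hv hf)
  simp only [eLpNorm_enorm] at this
  refine le_trans (le_of_eq (lintegral_congr fun x => ?_)) this
  rw [← enorm_smul, smul_smul, inv_mul_cancel₀ (hv0 x), one_smul]

end Convolution

/-! ### Frequency brackets, weights and symbols -/

section Energy

variable {G : Type*} [AddCommGroup G] [MeasurableSpace G]

/-- An abstract Japanese bracket on a group of frequencies. -/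
structure Bracket (μ : Measure G) where
  toFun : G → ℝ
  measurable : Measurable toFun
  one_le : ∀ x, 1 ≤ toFun x
  map_neg : ∀ x, toFun (-x) = toFun x
  abs_sub_le : ∀ x y, |toFun (x + y) - toFun y| ≤ toFun x
  σ : ℕ
  finite : eLpNorm (fun x => (toFun x ^ σ)⁻¹) 2 μ < ∞

instance (μ : Measure G) : CoeFun (Bracket μ) fun _ => G → ℝ := ⟨Bracket.toFun⟩

/-- Radial weights with at most polynomial growth of exponent `p`. -/
structure IsWeight (p : ℕ) (φ : ℝ → ℝ) : Prop where
  measurable : Measurable φ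
  nonneg : ∀ r, 1 ≤ r → 0 ≤ φ r
  mono : ∀ r s, 1 ≤ r → r ≤ s → φ r ≤ φ s
  scale : ∀ r c, 1 ≤ r → 1 ≤ c → φ (c * r) ≤ c ^ p * φ r

variable {μ : Measure G}

/-- The symbol of a bilinear operator which is a Burgers term `i κ(y)` up to a remainder that does
not lose derivatives. -/
structure BurgersSymbol (b : Bracket μ) where
  m : G → G → ℂ
  κ : G → ℝ
  A : ℝ
  M : ℕ
  measurable_m : Measurable (Function.uncurry m)
  measurable_κ : Measurable κ
  κ_add : ∀ x y, κ (x + y) = κ x + κ y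
  A_nonneg : 0 ≤ A
  κ_le : ∀ x, |κ x| ≤ A * b x
  one_le_M : 1 ≤ M
  rem_le : ∀ x y, ‖m x y - Complex.I * κ y‖ ≤ A * min (b x) (b y) ^ M
  m_neg : ∀ x y, m (-x) (-y) = (starRingEnd ℂ) (m x y)

namespace Bracket

variable (b : Bracket μ)

theorem pos (x : G) : 0 < b x := zero_lt_one.trans_le (b.one_le x)

theorem nonneg (x : G) : 0 ≤ b x := (b.pos x).le

theorem add_le (x y : G) : b (x + y) ≤ b x + b y := by
  linarith [(abs_le.1 (b.abs_sub_le x y)).2]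

theorem add_le_two_mul (x y : G) : b (x + y) ≤ 2 * (b x * b y) := by
  nlinarith [b.add_le x y, b.one_le x, b.one_le y]

end Bracket

/-- Convexity: on `[0, 1]` the power lies below its chord, which has slope `2^p - 1`. -/
theorem one_add_pow_sub_one_le (p : ℕ) {t : ℝ} (h0 : 0 ≤ t) (h1 : t ≤ 1) :
    (1 + t) ^ p ≤ 1 + (2 ^ p - 1) * t := by
  induction p with
  | zero => simp
  | succ p ih =>
    have h2 : (1 : ℝ) ≤ 2 ^ p := one_le_pow₀ (by norm_num)
    rw [pow_succ, pow_succ]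
    nlinarith [mul_le_mul_of_nonneg_right ih (by linarith : 0 ≤ 1 + t),
      mul_nonneg (sub_nonneg.2 h2) (mul_nonneg h0 (sub_nonneg.2 h1))]

namespace IsWeight

variable {p : ℕ} {φ : ℝ → ℝ} (hφ : IsWeight p φ) (b : Bracket μ)
include hφ

theorem measurable_comp : Measurable fun x => φ (b x) := hφ.measurable.comp b.measurable

theorem add_le (x y : G) : φ (b (x + y)) ≤ 2 ^ p * (φ (b x) + φ (b y)) := by
  have hx := hφ.nonneg _ (b.one_le x)
  have hy := hφ.nonneg _ (b.one_le y)
  have h := b.add_le x y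
  have h2 : (0 : ℝ) ≤ 2 ^ p := by positivity
  rcases le_total (b x) (b y) with hxy | hxy
  · refine ((hφ.mono _ (2 * b y) (b.one_le _) (by linarith)).trans
      (hφ.scale _ _ (b.one_le y) one_le_two)).trans ?_
    gcongr; linarith
  · refine ((hφ.mono _ (2 * b x) (b.one_le _) (by linarith)).trans
      (hφ.scale _ _ (b.one_le x) one_le_two)).trans ?_
    gcongr; linarith

/-- The commutator of the weight with a derivative on the second factor. When `x` is the lower
frequency, the relative change of `φ` is at most `2^p` times the relative change of the bracket,
hence at most `2^p b x / b y`, and the factor `b y` is absorbed. When `x` is the higher frequency no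
cancellation is needed, since both values of `φ` are at most `2^p φ (b x)`. -/
theorem abs_sub_mul_le (x y : G) :
    |φ (b (x + y)) - φ (b y)| * b y ≤ 2 ^ p * (φ (b x) * b y + b x * φ (b y)) := by
  have hx := hφ.nonneg _ (b.one_le x)
  have hy := hφ.nonneg _ (b.one_le y)
  have hb := abs_le.1 (b.abs_sub_le x y)
  have h2 : (1 : ℝ) ≤ 2 ^ p := one_le_pow₀ (by norm_num)
  have px := b.pos x
  have py := b.pos y
  have pxy := b.pos (x + y)
  rcases le_or_gt (b x) (b y) with hxy | hxy
  · suffices |φ (b (x + y)) - φ (b y)| * b y ≤ 2 ^ p * (b x * φ (b y)) by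
      refine this.trans ?_
      gcongr
      have := mul_nonneg hx py.le
      linarith
    rcases le_total (b y) (b (x + y)) with h | h
    · rw [abs_of_nonneg (sub_nonneg.2 (hφ.mono _ _ (b.one_le y) h))]
      -- The relative increment of the bracket; it lies in `[0, 1]` because `b x ≤ b y`.
      set t := (b (x + y) - b y) / b y with ht
      have ht0 : 0 ≤ t := div_nonneg (by linarith) py.le
      have ht1 : t ≤ 1 := by rw [ht, div_le_one py]; linarith
      have hr : b (x + y) = (1 + t) * b y := by rw [ht]; field_simp; ring
      have h3 := hφ.scale (b y) (1 + t) (b.one_le y) (by linarith)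
      rw [← hr] at h3
      have h4 := mul_le_mul_of_nonneg_right (one_add_pow_sub_one_le p ht0 ht1) hy
      have h5 : t * b y ≤ b x := by rw [ht, div_mul_cancel₀ _ py.ne']; linarith
      have h6 : φ (b (x + y)) - φ (b y) ≤ 2 ^ p * t * φ (b y) := by
        nlinarith [mul_nonneg ht0 hy]
      calc (φ (b (x + y)) - φ (b y)) * b y ≤ 2 ^ p * t * φ (b y) * b y := by gcongr
        _ = 2 ^ p * (t * b y * φ (b y)) := by ring
        _ ≤ _ := by gcongr
    · rw [abs_of_nonpos (sub_nonpos.2 (hφ.mono _ _ (b.one_le _) h))]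
      set t := (b y - b (x + y)) / b y with ht
      have ht0 : 0 ≤ t := div_nonneg (by linarith) py.le
      have ht1 : t ≤ 1 := by rw [ht, div_le_one py]; linarith
      have hr : b (x + y) = (1 - t) * b y := by rw [ht]; field_simp; ring
      -- The growth condition is used from `b (x + y)` up to `b y`, which bounds `φ (b (x + y))`
      -- below by `(1 - t)^p φ (b y)`; Bernoulli's inequality finishes.
      have h3 := hφ.scale (b (x + y)) (b y / b (x + y)) (b.one_le _)
        (by rw [le_div_iff₀ pxy]; linarith)
      rw [div_mul_cancel₀ _ pxy.ne', div_pow, div_mul_eq_mul_div, le_div_iff₀ (by positivity),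
        hr, mul_pow] at h3
      have h3' : φ (b y) * (1 - t) ^ p ≤ φ ((1 - t) * b y) := by
        have : 0 < b y ^ p := by positivity
        nlinarith
      have h7 := one_add_mul_le_pow (a := -t) (by linarith) p
      have h5 : t * b y ≤ b x := by rw [ht, div_mul_cancel₀ _ py.ne']; linarith
      have hp : (p : ℝ) ≤ 2 ^ p := by exact_mod_cast p.lt_two_pow_self.le
      have h6 : -(φ (b (x + y)) - φ (b y)) ≤ 2 ^ p * t * φ (b y) := by
        rw [hr]
        have h8 := mul_le_mul_of_nonneg_left h7 hy
        have h9 : (1 : ℝ) + -t = 1 - t := by ring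
        rw [h9] at h8
        have h10 := mul_le_mul_of_nonneg_right hp (mul_nonneg ht0 hy)
        nlinarith
      calc -(φ (b (x + y)) - φ (b y)) * b y ≤ 2 ^ p * t * φ (b y) * b y := by gcongr
        _ = 2 ^ p * (t * b y * φ (b y)) := by ring
        _ ≤ _ := by gcongr
  · have h1 : φ (b (x + y)) ≤ 2 ^ p * φ (b x) :=
      (hφ.mono _ (2 * b x) (b.one_le _) (by linarith [b.add_le x y])).trans
        (hφ.scale _ _ (b.one_le x) one_le_two)
    have h3 : φ (b y) ≤ φ (b x) := hφ.mono _ _ (b.one_le y) hxy.le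
    have h4 := hφ.nonneg _ (b.one_le (x + y))
    have h5 : |φ (b (x + y)) - φ (b y)| ≤ 2 ^ p * φ (b x) := by
      rw [abs_le]; constructor <;> nlinarith
    calc |φ (b (x + y)) - φ (b y)| * b y ≤ 2 ^ p * φ (b x) * b y := by gcongr
      _ = 2 ^ p * (φ (b x) * b y) := by ring
      _ ≤ _ := by
        gcongr
        have := mul_nonneg px.le hy
        linarith

/-- The weight of the sum falls on one of the two factors, and the minimum allows the `M`
derivatives to be placed on the other one. -/
theorem mul_min_pow_le (M : ℕ) (x y : G) : φ (b (x + y)) * min (b x) (b y) ^ M ≤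
    2 ^ p * (φ (b x) * b y ^ M + b x ^ M * φ (b y)) := by
  have hx := hφ.nonneg _ (b.one_le x)
  have hy := hφ.nonneg _ (b.one_le y)
  have hm : 0 ≤ min (b x) (b y) := le_min (b.nonneg x) (b.nonneg y)
  calc φ (b (x + y)) * min (b x) (b y) ^ M
      ≤ (2 ^ p * (φ (b x) + φ (b y))) * min (b x) (b y) ^ M := by
        gcongr; exact hφ.add_le b x y
    _ = 2 ^ p * (φ (b x) * min (b x) (b y) ^ M + min (b x) (b y) ^ M * φ (b y)) := by ring
    _ ≤ _ := by
      gcongr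
      · exact min_le_right _ _
      · exact min_le_left _ _

end IsWeight

theorem isWeight_pow (ν : ℕ) : IsWeight ν fun r => r ^ ν where
  measurable := measurable_id.pow_const ν
  nonneg r hr := by positivity
  mono r s hr hs := by gcongr
  scale r c _ _ := by rw [mul_pow]

/-- Truncated weights, which are uniformly admissible and detect high frequencies. -/
theorem isWeight_pow_mul_min (ν : ℕ) {ρ : ℝ} (hρ : 0 < ρ) :
    IsWeight (ν + 1) fun r => r ^ ν * min 1 (r / ρ) where
  measurable := (measurable_id.pow_const ν).mul (measurable_const.min (measurable_id.div_const ρ))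
  nonneg r hr := by positivity
  mono r s hr hs := by
    have : 0 ≤ s ^ ν := pow_nonneg (by linarith) ν
    gcongr
  scale r c hr hc := by
    -- The truncation factor grows at most linearly under dilation, whatever `ρ` is. Hence the
    -- exponent `ν + 1`, uniform in `ρ`.
    have : min 1 (c * r / ρ) ≤ c * min 1 (r / ρ) := by
      rw [mul_min_of_nonneg _ _ (by linarith)]
      refine min_le_min (by linarith) (by rw [mul_div_assoc])
    calc (c * r) ^ ν * min 1 (c * r / ρ) ≤ (c * r) ^ ν * (c * min 1 (r / ρ)) := by gcongr
      _ = _ := by ring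

theorem BurgersSymbol.norm_le {b : Bracket μ} (S : BurgersSymbol b) (x y : G) :
    ‖S.m x y‖ ≤ 2 * S.A * (min (b x) (b y) ^ S.M + b y) := by
  have h := S.rem_le x y
  have h2 := S.κ_le y
  have h3 : ‖S.m x y‖ ≤ ‖S.m x y - Complex.I * S.κ y‖ + ‖Complex.I * (S.κ y : ℂ)‖ := by
    simpa using norm_add_le (S.m x y - Complex.I * S.κ y) (Complex.I * S.κ y)
  have h4 : ‖Complex.I * (S.κ y : ℂ)‖ = |S.κ y| := by simp
  have h5 : 0 ≤ min (b x) (b y) ^ S.M :=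
    pow_nonneg (le_min (b.nonneg x) (b.nonneg y)) _
  have := mul_nonneg S.A_nonneg h5
  have := mul_nonneg S.A_nonneg (b.nonneg y)
  nlinarith

/-! ### The energy estimate -/

variable [MeasurableAdd₂ G] [MeasurableNeg G] [SFinite μ] [μ.IsAddLeftInvariant] [μ.IsNegInvariant]

theorem lintegral_trilinear_le {P F H : G → ℝ≥0∞} (hP : Measurable P) (hF : Measurable F)
    (hH : Measurable H) : ∫⁻ x, ∫⁻ y, P x * (F (x - y) * H y) ∂μ ∂μ ≤
      eLpNorm P 2 μ * (eLpNorm F 1 μ * eLpNorm H 2 μ) := by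
  have : ∀ x, ∫⁻ y, P x * (F (x - y) * H y) ∂μ = P x * ∫⁻ y, F (x - y) * H y ∂μ := fun x =>
    lintegral_const_mul _ ((hF.comp (measurable_const.sub measurable_id)).mul hH)
  simp_rw [this]
  exact (lintegral_mul_le_eLpNorm_two hP (measurable_lconv hF hH)).trans
    (mul_le_mul_right (eLpNorm_lconv_le hF hH) _)

theorem lintegral_trilinear_le' {P F H : G → ℝ≥0∞} (hP : Measurable P) (hF : Measurable F)
    (hH : Measurable H) : ∫⁻ x, ∫⁻ y, P x * (F (x - y) * H y) ∂μ ∂μ ≤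
      eLpNorm P 2 μ * (eLpNorm F 2 μ * eLpNorm H 1 μ) := by
  have : ∀ x, ∫⁻ y, P x * (F (x - y) * H y) ∂μ = P x * ∫⁻ y, F (x - y) * H y ∂μ := fun x =>
    lintegral_const_mul _ ((hF.comp (measurable_const.sub measurable_id)).mul hH)
  simp_rw [this]
  exact (lintegral_mul_le_eLpNorm_two hP (measurable_lconv hF hH)).trans
    (mul_le_mul_right (eLpNorm_lconv_le' hF hH) _)

/-- The leading part of the energy kernel is skew up to a zeroth order term. -/
theorem ofReal_abs_re_leading_le {b : Bracket μ} (S : BurgersSymbol b) {f g : G → ℂ}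
    (hf : Measurable f) (hg : Measurable g)
    (hsym : ∀ᵐ x ∂μ, f (-x) = (starRingEnd ℂ) (f x))
    (h1 : eLpNorm f 1 μ < ∞) (h2 : eLpNorm g 2 μ < ∞) (h3 : eLpNorm (fun x => b x • g x) 2 μ < ∞) :
    Integrable (fun p : G × G =>
      Complex.I * S.κ p.2 * f (p.1 - p.2) * g p.2 * (starRingEnd ℂ) (g p.1)) (μ.prod μ) ∧
    ENNReal.ofReal |2 * (∫ p : G × G,
      Complex.I * S.κ p.2 * f (p.1 - p.2) * g p.2 * (starRingEnd ℂ) (g p.1) ∂(μ.prod μ)).re| ≤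
      ENNReal.ofReal S.A * (eLpNorm g 2 μ * (eLpNorm (fun x => b x • f x) 1 μ * eLpNorm g 2 μ)) := by
  set H : G × G → ℂ := fun p =>
      Complex.I * S.κ p.2 * f (p.1 - p.2) * g p.2 * (starRingEnd ℂ) (g p.1) with hH
  have hfm : Measurable fun p : G × G => f (p.1 - p.2) := hf.comp (measurable_fst.sub measurable_snd)
  have hκ : Measurable fun p : G × G => (S.κ p.2 : ℂ) :=
    Complex.measurable_ofReal.comp (S.measurable_κ.comp measurable_snd)
  have hHm : Measurable H := (((measurable_const.mul hκ).mul hfm).mul (hg.comp measurable_snd)).mul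
    (Complex.continuous_conj.measurable.comp (hg.comp measurable_fst))
  have hκe : ∀ x, ‖S.κ x‖ₑ ≤ ENNReal.ofReal S.A * ‖b x‖ₑ := by
    intro x
    have := ENNReal.ofReal_le_ofReal (S.κ_le x)
    rwa [ENNReal.ofReal_mul S.A_nonneg, ← Real.norm_eq_abs, ofReal_norm,
      ← Real.enorm_eq_ofReal (b.nonneg x)] at this
  have hHint : Integrable H (μ.prod μ) := by
    refine ⟨hHm.aestronglyMeasurable, ?_⟩
    rw [HasFiniteIntegral, lintegral_prod _ hHm.enorm.aemeasurable]
    refine lt_of_le_of_lt (b := ENNReal.ofReal S.A * ∫⁻ x, ∫⁻ y, ‖g x‖ₑ *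
      (‖f (x - y)‖ₑ * ‖b y • g y‖ₑ) ∂μ ∂μ) ?_ ?_
    · rw [← lintegral_const_mul' _ _ (by simp)]
      refine lintegral_mono fun x => ?_
      rw [← lintegral_const_mul' _ _ (by simp)]
      refine lintegral_mono fun y => ?_
      simp only [hH, enorm_mul, enorm_smul]
      have e1 : ‖Complex.I‖ₑ = 1 := by simp [← ofReal_norm]
      have e2 : ‖(S.κ y : ℂ)‖ₑ = ‖S.κ y‖ₑ := by simp [← ofReal_norm]
      have e3 : ‖(starRingEnd ℂ) (g x)‖ₑ = ‖g x‖ₑ := by simp [← ofReal_norm]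
      rw [e1, e2, e3, one_mul]
      calc ‖S.κ y‖ₑ * ‖f (x - y)‖ₑ * ‖g y‖ₑ * ‖g x‖ₑ
          ≤ (ENNReal.ofReal S.A * ‖b y‖ₑ) * ‖f (x - y)‖ₑ * ‖g y‖ₑ * ‖g x‖ₑ := by
            gcongr; exact hκe y
        _ = _ := by ring
    · refine ENNReal.mul_lt_top (by simp) (lt_of_le_of_lt
        (lintegral_trilinear_le (μ := μ) (P := fun x => ‖g x‖ₑ) (F := fun x => ‖f x‖ₑ)
          (H := fun y => ‖b y • g y‖ₑ) hg.enorm hf.enorm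
          (measurable_enorm_smul b.measurable hg)) ?_)
      simp only [eLpNorm_enorm]
      exact ENNReal.mul_lt_top h2 (ENNReal.mul_lt_top h1 h3)
  refine ⟨hHint, ?_⟩
  -- Twice the real part of the integral is the integral of the kernel plus the conjugate of the
  -- kernel with its variables exchanged. Since `f(-·)` is the conjugate of `f`, the factors `κ y`
  -- and `κ x` combine to `κ y - κ x = -κ (x - y)`, so the derivative lands on `f`.
  have hsw : Integrable (fun p : G × G => (starRingEnd ℂ) (H p.swap)) (μ.prod μ) :=
    (LinearIsometryEquiv.integrable_comp_iff Complex.conjLIE).2 hHint.swap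
  have e1 : ((2 * (∫ p, H p ∂(μ.prod μ)).re : ℝ) : ℂ) =
      ∫ p, (H p + (starRingEnd ℂ) (H p.swap)) ∂(μ.prod μ) := by
    rw [integral_add hHint hsw, integral_conj, integral_prod_swap, Complex.add_conj]
  have e2 : ENNReal.ofReal |2 * (∫ p, H p ∂(μ.prod μ)).re| =
      ‖∫ p, (H p + (starRingEnd ℂ) (H p.swap)) ∂(μ.prod μ)‖ₑ := by
    rw [← e1, ← ofReal_norm, Complex.norm_real, Real.norm_eq_abs]
  rw [e2]
  refine (enorm_integral_le_lintegral_enorm _).trans ?_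
  have hm2 : Measurable fun p : G × G => H p + (starRingEnd ℂ) (H p.swap) :=
    hHm.add (Complex.continuous_conj.measurable.comp (hHm.comp measurable_swap))
  rw [lintegral_prod _ hm2.enorm.aemeasurable]
  refine le_trans ?_ (mul_le_mul_right (lintegral_trilinear_le (μ := μ) (P := fun x => ‖g x‖ₑ)
    (F := fun x => ‖b x • f x‖ₑ) (H := fun y => ‖g y‖ₑ) hg.enorm
      (measurable_enorm_smul b.measurable hf) hg.enorm |>.trans_eq (by simp only [eLpNorm_enorm])) _)
  rw [← lintegral_const_mul' _ _ (by simp)]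
  refine lintegral_mono fun x => ?_
  rw [← lintegral_const_mul' _ _ (by simp)]
  have hx : ∀ᵐ y ∂μ, f (-(x - y)) = (starRingEnd ℂ) (f (x - y)) :=
    (Measure.measurePreserving_sub_left μ x).quasiMeasurePreserving.ae hsym
  refine lintegral_mono_ae (hx.mono fun y hy => ?_)
  have hκ' : S.κ x = S.κ (x - y) + S.κ y := by rw [← S.κ_add, sub_add_cancel]
  have : H (x, y) + (starRingEnd ℂ) (H (x, y).swap) =
      -(Complex.I * (S.κ (x - y) : ℂ)) * f (x - y) * g y * (starRingEnd ℂ) (g x) := by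
    simp only [hH, Prod.swap, map_mul, Complex.conj_I, Complex.conj_ofReal, Complex.conj_conj]
    rw [neg_sub] at hy
    rw [hy, hκ', Complex.conj_conj]
    push_cast; ring
  rw [this]
  simp only [enorm_mul, enorm_smul, enorm_neg]
  have e1 : ‖Complex.I‖ₑ = 1 := by simp [← ofReal_norm]
  have e2 : ‖(S.κ (x - y) : ℂ)‖ₑ = ‖S.κ (x - y)‖ₑ := by simp [← ofReal_norm]
  have e3 : ‖(starRingEnd ℂ) (g x)‖ₑ = ‖g x‖ₑ := by simp [← ofReal_norm]
  rw [e1, e2, e3, one_mul]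
  calc ‖S.κ (x - y)‖ₑ * ‖f (x - y)‖ₑ * ‖g y‖ₑ * ‖g x‖ₑ
      ≤ (ENNReal.ofReal S.A * ‖b (x - y)‖ₑ) * ‖f (x - y)‖ₑ * ‖g y‖ₑ * ‖g x‖ₑ := by
        gcongr; exact hκe _
    _ = _ := by ring

/-- The weighted energy estimate: the Burgers part of the symbol loses no derivative. -/
theorem ofReal_abs_re_energy_le {b : Bracket μ} (S : BurgersSymbol b) {f z : G → ℂ} {W W' : G → ℝ}
    {K : ℝ} (hf : Measurable f) (hz : Measurable z) (hW : Measurable W) (hW' : Measurable W')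
    (hW0 : ∀ x, 0 ≤ W x) (hW0' : ∀ x, 0 ≤ W' x) (hK : 0 ≤ K)
    (hdiff : ∀ x y, |W (x + y) - W y| * b y ≤ K * (W' x * b y + b x * W y))
    (hmin : ∀ x y, W (x + y) * min (b x) (b y) ^ S.M ≤
      K * (W' x * b y ^ S.M + b x ^ S.M * W y))
    (hsym : ∀ᵐ x ∂μ, f (-x) = (starRingEnd ℂ) (f x))
    (h1 : eLpNorm (fun x => (b x ^ S.M) • f x) 1 μ < ∞)
    (h2 : eLpNorm (fun x => W x • z x) 2 μ < ∞)
    (h3 : eLpNorm (fun x => b x • W x • z x) 2 μ < ∞)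
    (h4 : eLpNorm (fun x => W' x • f x) 2 μ < ∞)
    (h5 : eLpNorm (fun x => (b x ^ S.M) • z x) 1 μ < ∞) :
    ENNReal.ofReal |2 * (∫ x, ((W x : ℂ) ^ 2 * (pseudo μ S.m f z x * (starRingEnd ℂ) (z x))) ∂μ).re|
      ≤ ENNReal.ofReal (S.A * (1 + 4 * K)) * (eLpNorm (fun x => W x • z x) 2 μ *
        (eLpNorm (fun x => (b x ^ S.M) • f x) 1 μ * eLpNorm (fun x => W x • z x) 2 μ +
          eLpNorm (fun x => W' x • f x) 2 μ * eLpNorm (fun x => (b x ^ S.M) • z x) 1 μ)) := by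
  set g : G → ℂ := fun x => W x • z x with hg
  have hgm : Measurable g := hW.smul hz
  have hbM : ∀ x, b x ≤ b x ^ S.M := fun x =>
    le_self_pow₀ (b.one_le x) (by have := S.one_le_M; omega)
  have h1b : eLpNorm (fun x => b x • f x) 1 μ ≤ eLpNorm (fun x => (b x ^ S.M) • f x) 1 μ := by
    refine eLpNorm_mono fun x => ?_
    rw [norm_smul, norm_smul, Real.norm_of_nonneg (b.nonneg x),
      Real.norm_of_nonneg (pow_nonneg (b.nonneg x) _)]
    exact mul_le_mul_of_nonneg_right (hbM x) (norm_nonneg _)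
  have h1' : eLpNorm f 1 μ ≤ eLpNorm (fun x => (b x ^ S.M) • f x) 1 μ := by
    refine eLpNorm_mono fun x => ?_
    rw [norm_smul, Real.norm_of_nonneg (pow_nonneg (b.nonneg x) _)]
    exact le_mul_of_one_le_left (norm_nonneg _) ((b.one_le x).trans (hbM x))
  obtain ⟨iA, bA⟩ := ofReal_abs_re_leading_le S hf hgm hsym (h1'.trans_lt h1) h2 h3
  -- The leading part: the symbol is replaced by `iκ(y)` and `W(x)²` by `W(x) W(y)`. The error
  -- consists of the remainder of the symbol and of the commutator `W x - W y`, both controlled in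
  -- absolute value.
  set HA : G × G → ℂ := fun p =>
      Complex.I * S.κ p.2 * f (p.1 - p.2) * g p.2 * (starRingEnd ℂ) (g p.1) with hHA
  set H : G × G → ℂ := fun p => (W p.1 : ℂ) ^ 2 * ((S.m (p.1 - p.2) p.2 *
    (f (p.1 - p.2) * z p.2)) * (starRingEnd ℂ) (z p.1)) with hH
  have hHm : Measurable H := by
    refine ((Complex.measurable_ofReal.comp (hW.comp measurable_fst)).pow_const 2).mul
      (((S.measurable_m.comp ((measurable_fst.sub measurable_snd).prodMk measurable_snd)).mul
        ((hf.comp (measurable_fst.sub measurable_snd)).mul (hz.comp measurable_snd))).mul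
        (Complex.continuous_conj.measurable.comp (hz.comp measurable_fst)))
  have hHAm : Measurable HA := by
    refine (((measurable_const.mul (Complex.measurable_ofReal.comp
      (S.measurable_κ.comp measurable_snd))).mul (hf.comp (measurable_fst.sub measurable_snd))).mul
        (hgm.comp measurable_snd)).mul
        (Complex.continuous_conj.measurable.comp (hgm.comp measurable_fst))
  have hBm : Measurable fun p => H p - HA p := hHm.sub hHAm
  have mg := measurable_enorm_smul hW hz
  have mWf := measurable_enorm_smul hW' hf
  have mbM : Measurable fun x => b x ^ S.M := b.measurable.pow_const _
  have mbf := measurable_enorm_smul mbM hf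
  have mbz := measurable_enorm_smul mbM hz
  -- the remainder
  have hpt : ∀ x y, ‖H (x, y) - HA (x, y)‖ₑ ≤ ENNReal.ofReal (2 * (S.A * K)) *
      (‖W x • z x‖ₑ * (‖(b (x - y) ^ S.M) • f (x - y)‖ₑ * ‖W y • z y‖ₑ) +
        ‖W x • z x‖ₑ * (‖W' (x - y) • f (x - y)‖ₑ * ‖(b y ^ S.M) • z y‖ₑ)) := by
    intro x y
    have key : H (x, y) - HA (x, y) = (W x * (starRingEnd ℂ) (z x)) * f (x - y) * z y *
        (W x * (S.m (x - y) y - Complex.I * S.κ y) + Complex.I * S.κ y * ((W x - W y : ℝ) : ℂ)) := by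
      simp only [hH, hHA, hg, Complex.real_smul, map_mul, Complex.conj_ofReal]
      push_cast; ring
    have hb : ‖(W x : ℂ) * (S.m (x - y) y - Complex.I * S.κ y) +
        Complex.I * S.κ y * ((W x - W y : ℝ) : ℂ)‖ ≤
        2 * (S.A * K) * (b (x - y) ^ S.M * W y + W' (x - y) * b y ^ S.M) := by
      have d1 := hdiff (x - y) y
      have d2 := hmin (x - y) y
      rw [sub_add_cancel] at d1 d2
      refine (norm_add_le _ _).trans ?_
      rw [norm_mul, norm_mul, norm_mul, Complex.norm_I, one_mul, Complex.norm_real,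
        Complex.norm_real, Complex.norm_real, Real.norm_of_nonneg (hW0 x), Real.norm_eq_abs,
        Real.norm_eq_abs]
      have t1 : W x * ‖S.m (x - y) y - Complex.I * S.κ y‖ ≤
          S.A * (K * (W' (x - y) * b y ^ S.M + b (x - y) ^ S.M * W y)) := by
        calc _ ≤ W x * (S.A * min (b (x - y)) (b y) ^ S.M) :=
              mul_le_mul_of_nonneg_left (S.rem_le _ _) (hW0 x)
          _ = S.A * (W x * min (b (x - y)) (b y) ^ S.M) := by ring
          _ ≤ _ := mul_le_mul_of_nonneg_left d2 S.A_nonneg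
      have t2 : |S.κ y| * |W x - W y| ≤
          S.A * (K * (W' (x - y) * b y ^ S.M + b (x - y) ^ S.M * W y)) := by
        calc _ ≤ (S.A * b y) * |W x - W y| :=
              mul_le_mul_of_nonneg_right (S.κ_le y) (abs_nonneg _)
          _ = S.A * (|W x - W y| * b y) := by ring
          _ ≤ S.A * (K * (W' (x - y) * b y + b (x - y) * W y)) :=
              mul_le_mul_of_nonneg_left d1 S.A_nonneg
          _ ≤ _ := by
            have := S.A_nonneg
            have := hW0' (x - y)
            have := hW0 y
            gcongr <;> exact hbM _
      linarith
    have h6 : ‖H (x, y) - HA (x, y)‖ ≤ 2 * (S.A * K) *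
        (‖W x • z x‖ * (‖(b (x - y) ^ S.M) • f (x - y)‖ * ‖W y • z y‖) +
        ‖W x • z x‖ * (‖W' (x - y) • f (x - y)‖ * ‖(b y ^ S.M) • z y‖)) := by
      rw [key]
      simp only [norm_mul, norm_smul, RCLike.norm_conj, Complex.norm_real,
        Real.norm_of_nonneg (hW0 _), Real.norm_of_nonneg (hW0' _),
        Real.norm_of_nonneg (pow_nonneg (b.nonneg _) _)]
      calc _ ≤ W x * ‖z x‖ * ‖f (x - y)‖ * ‖z y‖ *
          (2 * (S.A * K) * (b (x - y) ^ S.M * W y + W' (x - y) * b y ^ S.M)) := by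
            have := hW0 x
            gcongr
        _ = _ := by ring
    have h7 := ENNReal.ofReal_le_ofReal h6
    have := S.A_nonneg
    rw [ENNReal.ofReal_mul (by positivity), ENNReal.ofReal_add (by positivity) (by positivity)] at h7
    simpa only [ENNReal.ofReal_mul (norm_nonneg _), ofReal_norm] using h7
  have hBbound : ∫⁻ p, ‖H p - HA p‖ₑ ∂(μ.prod μ) ≤ ENNReal.ofReal (2 * (S.A * K)) *
      (eLpNorm g 2 μ * (eLpNorm (fun x => (b x ^ S.M) • f x) 1 μ * eLpNorm g 2 μ +
          eLpNorm (fun x => W' x • f x) 2 μ * eLpNorm (fun x => (b x ^ S.M) • z x) 1 μ)) := by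
    rw [lintegral_prod _ hBm.enorm.aemeasurable, mul_add]
    have T1 := lintegral_trilinear_le (μ := μ) mg mbf mg
    have T2 := lintegral_trilinear_le' (μ := μ) mg mWf mbz
    simp only [eLpNorm_enorm] at T1 T2
    refine le_trans ?_ (mul_le_mul_right (add_le_add T1 T2) _)
    have ma : ∀ {F : G → ℝ≥0∞} {H : G → ℝ≥0∞}, Measurable F → Measurable H → ∀ x,
        Measurable fun y => ‖W x • z x‖ₑ * (F (x - y) * H y) := fun hF hH x =>
      measurable_const.mul ((hF.comp (measurable_const.sub measurable_id)).mul hH)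
    have ma' : ∀ {F : G → ℝ≥0∞} {H : G → ℝ≥0∞}, Measurable F → Measurable H →
        Measurable fun x => ∫⁻ y, ‖W x • z x‖ₑ * (F (x - y) * H y) ∂μ := fun hF hH =>
      Measurable.lintegral_prod_right' (f := fun p : G × G => ‖W p.1 • z p.1‖ₑ *
        (_ * _)) ((mg.comp measurable_fst).mul
          ((hF.comp (measurable_fst.sub measurable_snd)).mul (hH.comp measurable_snd)))
    rw [← lintegral_add_left (ma' mbf mg), ← lintegral_const_mul' _ _ ENNReal.ofReal_ne_top]
    refine lintegral_mono fun x => ?_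
    rw [← lintegral_add_left (ma mbf mg x), ← lintegral_const_mul' _ _ ENNReal.ofReal_ne_top]
    exact lintegral_mono fun y => hpt x y
  have iB : Integrable (fun p => H p - HA p) (μ.prod μ) := by
    refine ⟨hBm.aestronglyMeasurable, hBbound.trans_lt ?_⟩
    refine ENNReal.mul_lt_top ENNReal.ofReal_lt_top (ENNReal.mul_lt_top h2 (ENNReal.add_lt_top.2
      ⟨ENNReal.mul_lt_top h1 h2, ENNReal.mul_lt_top h4 h5⟩))
  have iH : Integrable H (μ.prod μ) := (iB.add iA).congr (ae_of_all _ fun p => by simp)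
  have e0 : ∫ x, ((W x : ℂ) ^ 2 * (pseudo μ S.m f z x * (starRingEnd ℂ) (z x))) ∂μ =
      ∫ p, HA p ∂(μ.prod μ) + ∫ p, (H p - HA p) ∂(μ.prod μ) := by
    rw [integral_sub iH iA, add_sub_cancel, integral_prod _ iH]
    refine integral_congr_ae (ae_of_all _ fun x => ?_)
    simp only [hH, pseudo]
    rw [integral_const_mul, integral_mul_const]
  rw [e0, Complex.add_re, mul_add]
  refine (ENNReal.ofReal_le_ofReal (abs_add_le _ _)).trans ?_
  rw [ENNReal.ofReal_add (abs_nonneg _) (abs_nonneg _)]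
  have e5 : ENNReal.ofReal |2 * (∫ p, (H p - HA p) ∂(μ.prod μ)).re| ≤
      2 * ∫⁻ p, ‖H p - HA p‖ₑ ∂(μ.prod μ) := by
    rw [abs_mul, ENNReal.ofReal_mul (abs_nonneg _)]
    refine mul_le_mul' (by simp) ?_
    refine (ENNReal.ofReal_le_ofReal (Complex.abs_re_le_norm _)).trans ?_
    rw [ofReal_norm]
    exact enorm_integral_le_lintegral_enorm _
  refine (add_le_add bA (e5.trans (mul_le_mul_right hBbound 2))).trans ?_
  -- One `A` comes from the leading part. The error kernel is bounded with constant `2AK`, one `AK`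
  -- from the remainder and one from the commutator, and enters doubled.
  have e6 : ENNReal.ofReal (S.A * (1 + 4 * K)) =
      ENNReal.ofReal S.A + 2 * ENNReal.ofReal (2 * (S.A * K)) := by
    have := S.A_nonneg
    rw [show (2 : ℝ≥0∞) = ENNReal.ofReal 2 by simp, ← ENNReal.ofReal_mul (by norm_num),
      ← ENNReal.ofReal_add (by positivity) (by positivity)]
    congr 1; ring
  rw [e6, add_mul]
  exact add_le_add (mul_le_mul_right (mul_le_mul_right
    ((mul_le_mul_left h1b _).trans le_self_add) _) _) (mul_assoc _ _ _).ge

end Energy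

/-! ### Operators on the space of square integrable functions of the frequency -/

section Operators

variable {G : Type*} [MeasurableSpace G] {μ : Measure G}

/-- Bounded measurable multipliers. -/
def IsBdd (w : G → ℂ) : Prop := Measurable w ∧ ∃ c : ℝ, ∀ x, ‖w x‖ ≤ c

theorem IsBdd.mul {w w' : G → ℂ} (hw : IsBdd w) (hw' : IsBdd w') : IsBdd fun x => w x * w' x := by
  obtain ⟨m, c, hc⟩ := hw
  obtain ⟨m', c', hc'⟩ := hw'
  refine ⟨m.mul m', c * c', fun x => ?_⟩
  rw [norm_mul]
  exact mul_le_mul (hc x) (hc' x) (norm_nonneg _) ((norm_nonneg _).trans (hc x))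

theorem IsBdd.memLp_mul {w : G → ℂ} (hw : IsBdd w) (f : Lp ℂ 2 μ) :
    MemLp (fun x => w x * f x) 2 μ := by
  obtain ⟨m, c, hc⟩ := hw
  refine (Lp.memLp f).of_le_mul (c := c) (m.aestronglyMeasurable.mul
    (Lp.aestronglyMeasurable f)) (ae_of_all _ fun x => ?_)
  rw [norm_mul]
  exact mul_le_mul_of_nonneg_right (hc x) (norm_nonneg _)

/-- Multiplication by a bounded function on `L²`. -/
def mulL (μ : Measure G) (w : G → ℂ) : Lp ℂ 2 μ →L[ℂ] Lp ℂ 2 μ :=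
  open Classical in
  if hw : IsBdd w then
    LinearMap.mkContinuous
      { toFun := fun f => (hw.memLp_mul f).toLp _
        map_add' := fun f g => by
          ext1
          filter_upwards [(hw.memLp_mul (f + g)).coeFn_toLp, (hw.memLp_mul f).coeFn_toLp,
            (hw.memLp_mul g).coeFn_toLp, Lp.coeFn_add f g, Lp.coeFn_add
              ((hw.memLp_mul f).toLp _) ((hw.memLp_mul g).toLp _)] with x h1 h2 h3 h4 h5
          rw [h1, h5, h4, Pi.add_apply, Pi.add_apply, h2, h3, mul_add]
        map_smul' := fun c f => by
          ext1
          filter_upwards [(hw.memLp_mul (c • f)).coeFn_toLp, (hw.memLp_mul f).coeFn_toLp,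
            Lp.coeFn_smul c f, Lp.coeFn_smul c ((hw.memLp_mul f).toLp _)] with x h1 h2 h4 h5
          simp only [RingHom.id_apply]
          rw [h1, h5, h4, Pi.smul_apply, Pi.smul_apply, h2, smul_eq_mul, smul_eq_mul]
          ring }
      hw.2.choose fun f => by
        refine Lp.norm_le_mul_norm_of_ae_le_mul ?_
        filter_upwards [(hw.memLp_mul f).coeFn_toLp] with x h1
        simp only [LinearMap.coe_mk, AddHom.coe_mk]
        rw [h1, norm_mul]
        exact mul_le_mul_of_nonneg_right (hw.2.choose_spec x) (norm_nonneg _)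
  else 0

theorem coeFn_mulL {w : G → ℂ} (hw : IsBdd w) (f : Lp ℂ 2 μ) :
    mulL μ w f =ᵐ[μ] fun x => w x * f x := by
  rw [mulL, dif_pos hw]
  exact (hw.memLp_mul f).coeFn_toLp

theorem norm_mulL_le {w : G → ℂ} (hw : IsBdd w) {c : ℝ} (hc : ∀ x, ‖w x‖ ≤ c) (f : Lp ℂ 2 μ) :
    ‖mulL μ w f‖ ≤ c * ‖f‖ := by
  refine Lp.norm_le_mul_norm_of_ae_le_mul ?_
  filter_upwards [coeFn_mulL hw f] with x h1
  rw [h1, norm_mul]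
  exact mul_le_mul_of_nonneg_right (hc x) (norm_nonneg _)

theorem norm_mulL_mono {w w' : G → ℂ} (hw : IsBdd w) (hw' : IsBdd w')
    (h : ∀ x, ‖w x‖ ≤ ‖w' x‖) (f : Lp ℂ 2 μ) : ‖mulL μ w f‖ ≤ ‖mulL μ w' f‖ := by
  refine Lp.norm_le_norm_of_ae_le ?_
  filter_upwards [coeFn_mulL hw f, coeFn_mulL hw' f] with x h1 h2
  rw [h1, h2, norm_mul, norm_mul]
  exact mul_le_mul_of_nonneg_right (h x) (norm_nonneg _)

theorem mulL_mulL {w w' : G → ℂ} (hw : IsBdd w) (hw' : IsBdd w') (f : Lp ℂ 2 μ) :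
    mulL μ w (mulL μ w' f) = mulL μ (fun x => w x * w' x) f := by
  ext1
  filter_upwards [coeFn_mulL hw (mulL μ w' f), coeFn_mulL hw' f, coeFn_mulL (hw.mul hw') f]
    with x h1 h2 h3
  rw [h1, h2, h3, mul_assoc]

theorem enorm_mulL {w : G → ℂ} (hw : IsBdd w) (f : Lp ℂ 2 μ) :
    ‖mulL μ w f‖ₑ = eLpNorm (fun x => w x * f x) 2 μ := by
  rw [Lp.enorm_def]
  exact eLpNorm_congr_ae (coeFn_mulL hw f)

theorem inner_mulL_mulL {w w' : G → ℂ} (hw : IsBdd w) (hw' : IsBdd w') (f g : Lp ℂ 2 μ) :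
    inner ℂ (mulL μ w f) (mulL μ w' g) =
      ∫ x, (starRingEnd ℂ) (w x) * w' x * (g x * (starRingEnd ℂ) (f x)) ∂μ := by
  rw [L2.inner_def]
  refine integral_congr_ae ?_
  filter_upwards [coeFn_mulL hw f, coeFn_mulL hw' g] with x h1 h2
  rw [h1, h2]
  simp only [RCLike.inner_apply, map_mul]
  ring

variable [AddCommGroup G] [MeasurableNeg G] [μ.IsNegInvariant]

/-- Functions whose inverse Fourier transform is real. -/
def IsReal (f : Lp ℂ 2 μ) : Prop := ∀ᵐ x ∂μ, f (-x) = (starRingEnd ℂ) (f x)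

/-- The conjugation `f ↦ conj f(-·)`. -/
def conjL (μ : Measure G) [μ.IsNegInvariant] : Lp ℂ 2 μ →L[ℝ] Lp ℂ 2 μ :=
  (Complex.conjCLE : ℂ →L[ℝ] ℂ).compLpL 2 μ ∘L
    (Lp.compMeasurePreservingₗᵢ ℝ (Neg.neg : G → G)
      (Measure.measurePreserving_neg μ)).toContinuousLinearMap

theorem coeFn_conjL (f : Lp ℂ 2 μ) : conjL μ f =ᵐ[μ] fun x => (starRingEnd ℂ) (f (-x)) := by
  have h1 := ContinuousLinearMap.coeFn_compLpL (p := 2) (μ := μ) (Complex.conjCLE : ℂ →L[ℝ] ℂ)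
    (Lp.compMeasurePreserving (Neg.neg : G → G) (Measure.measurePreserving_neg μ) f)
  filter_upwards [h1, Lp.coeFn_compMeasurePreserving f (Measure.measurePreserving_neg μ)]
    with x h1 h2
  refine Eq.trans h1 ?_
  rw [h2]
  rfl

theorem ae_neg {p : G → Prop} (h : ∀ᵐ x ∂μ, p x) : ∀ᵐ x ∂μ, p (-x) :=
  (Measure.measurePreserving_neg μ).quasiMeasurePreserving.ae h

/-- Reality is the fixed point condition of a continuous real-linear map. In this form it passes to
sums and limits, and is conserved by differential equations whose field is real. -/
theorem isReal_iff {f : Lp ℂ 2 μ} : IsReal f ↔ conjL μ f = f := by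
  constructor
  · intro h
    ext1
    filter_upwards [coeFn_conjL f, h] with x h1 h2
    rw [h1, h2, Complex.conj_conj]
  · intro h
    have h3 : (conjL μ f : G → ℂ) =ᵐ[μ] f := by rw [h]
    filter_upwards [coeFn_conjL f, h3] with x h1 h2
    rw [← h2, h1, Complex.conj_conj]

theorem conjL_conjL (f : Lp ℂ 2 μ) : conjL μ (conjL μ f) = f := by
  ext1
  filter_upwards [coeFn_conjL (conjL μ f), ae_neg (coeFn_conjL f)] with x h1 h2
  rw [h1, h2, neg_neg, Complex.conj_conj]

theorem norm_conjL (f : Lp ℂ 2 μ) : ‖conjL μ f‖ ≤ ‖f‖ := by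
  refine (ContinuousLinearMap.norm_compLp_le _ _).trans ?_
  have : ‖(Complex.conjCLE : ℂ →L[ℝ] ℂ)‖ = 1 := Complex.conjCLE_norm
  rw [this, one_mul]
  exact (LinearIsometry.norm_map _ _).le

/-- The projection onto functions whose inverse Fourier transform is real. -/
def realL (μ : Measure G) [μ.IsNegInvariant] : Lp ℂ 2 μ →L[ℝ] Lp ℂ 2 μ :=
  (1 / 2 : ℝ) • (ContinuousLinearMap.id ℝ _ + conjL μ)

theorem isReal_realL (f : Lp ℂ 2 μ) : IsReal (realL μ f) := by
  rw [isReal_iff]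
  simp [realL, conjL_conjL, add_comm]

theorem IsReal.realL_eq {f : Lp ℂ 2 μ} (h : IsReal f) : realL μ f = f := by
  rw [isReal_iff] at h
  simp only [realL, smul_apply, add_apply,
    ContinuousLinearMap.id_apply, h]
  rw [← two_smul ℝ f, smul_smul]
  norm_num

theorem norm_realL_le (f : Lp ℂ 2 μ) : ‖realL μ f‖ ≤ ‖f‖ := by
  simp only [realL, smul_apply, add_apply,
    ContinuousLinearMap.id_apply]
  rw [norm_smul]
  have := norm_add_le f (conjL μ f)
  have := norm_conjL f
  norm_num
  linarith

theorem IsReal.mulL {f : Lp ℂ 2 μ} (h : IsReal f) {w : G → ℂ} (hw : IsBdd w)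
    (hw2 : ∀ x, w (-x) = (starRingEnd ℂ) (w x)) : IsReal (mulL μ w f) := by
  unfold IsReal
  filter_upwards [coeFn_mulL hw f, ae_neg (coeFn_mulL hw f), h] with x h1 h2 h3
  rw [h1, h2, h3, map_mul, hw2]

theorem IsReal.add {f g : Lp ℂ 2 μ} (hf : IsReal f) (hg : IsReal g) : IsReal (f + g) := by
  rw [isReal_iff] at *
  rw [map_add, hf, hg]

theorem IsReal.smul {f : Lp ℂ 2 μ} (hf : IsReal f) (c : ℝ) : IsReal (c • f) := by
  rw [isReal_iff] at *
  rw [map_smul, hf]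

theorem IsReal.neg {f : Lp ℂ 2 μ} (hf : IsReal f) : IsReal (-f) := by
  rw [isReal_iff] at *
  rw [map_neg, hf]

theorem isReal_of_tendsto {ι : Type*} {l : Filter ι} [l.NeBot] {u : ι → Lp ℂ 2 μ} {f : Lp ℂ 2 μ}
    (hu : ∀ᶠ i in l, IsReal (u i)) (h : Tendsto u l (𝓝 f)) : IsReal f := by
  rw [isReal_iff]
  refine tendsto_nhds_unique (((conjL μ).continuous.tendsto f).comp h) (h.congr' ?_)
  filter_upwards [hu] with i hi
  exact (isReal_iff.1 hi).symm

end Operators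

/-! ### The bilinear operator on weighted `L²` -/

section Bilinear

variable {G : Type*} [AddCommGroup G] [MeasurableSpace G] [MeasurableAdd₂ G] [MeasurableNeg G]
  {μ : Measure G} [SFinite μ] [μ.IsAddLeftInvariant] [μ.IsNegInvariant]

/-- The equality holds at every point: the integral at `x` sees both factors only up to null sets,
as `y ↦ x - y` preserves the measure. -/
theorem pseudo_congr {m : G → G → ℂ} {f f' g g' : G → ℂ} (hf : f =ᵐ[μ] f') (hg : g =ᵐ[μ] g') :
    pseudo μ m f g = pseudo μ m f' g' := by
  funext x
  refine integral_congr_ae ?_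
  filter_upwards [(Measure.measurePreserving_sub_left μ x).quasiMeasurePreserving.ae hf, hg]
    with y h1 h2
  simp only [h1, h2]

theorem pseudo_neg {m : G → G → ℂ} (hm : ∀ x y, m (-x) (-y) = (starRingEnd ℂ) (m x y))
    {f g : G → ℂ} (hf : ∀ᵐ x ∂μ, f (-x) = (starRingEnd ℂ) (f x))
    (hg : ∀ᵐ x ∂μ, g (-x) = (starRingEnd ℂ) (g x)) (x : G) :
    pseudo μ m f g (-x) = (starRingEnd ℂ) (pseudo μ m f g x) := by
  rw [pseudo, ← integral_neg_eq_self, pseudo, ← integral_conj]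
  refine integral_congr_ae ?_
  filter_upwards [(Measure.measurePreserving_sub_left μ x).quasiMeasurePreserving.ae hf, hg]
    with y h1 h2
  have e : -x - -y = -(x - y) := by abel
  rw [e, hm, h1, h2, map_mul, map_mul]

namespace BurgersSymbol

variable {b : Bracket μ} (S : BurgersSymbol b)

theorem norm_le_mul (x y : G) : ‖S.m x y‖ ≤ 4 * S.A * (b x ^ S.M * b y) := by
  have h := S.norm_le x y
  have h1 : min (b x) (b y) ^ S.M ≤ b x ^ S.M * b y := by
    calc min (b x) (b y) ^ S.M ≤ b x ^ S.M :=
          pow_le_pow_left₀ (le_min (b.nonneg x) (b.nonneg y)) (min_le_left _ _) _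
      _ ≤ _ := le_mul_of_one_le_right (pow_nonneg (b.nonneg x) _) (b.one_le y)
  have h2 : b y ≤ b x ^ S.M * b y :=
    le_mul_of_one_le_left (b.nonneg y) (one_le_pow₀ (b.one_le x))
  have := S.A_nonneg
  calc _ ≤ 2 * S.A * (b x ^ S.M * b y + b x ^ S.M * b y) := h.trans (by gcongr)
    _ = _ := by ring

/-- All the growth is put on the second frequency, so that the first factor enters only through its
unweighted `L²` norm. This makes `B(k, h')` harmless in the stability estimate, where `k` is a
difference of solutions. -/
theorem norm_le_pow (x y : G) : ‖S.m x y‖ ≤ 4 * S.A * b y ^ S.M := by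
  have h := S.norm_le x y
  have h1 : min (b x) (b y) ^ S.M ≤ b y ^ S.M :=
    pow_le_pow_left₀ (le_min (b.nonneg x) (b.nonneg y)) (min_le_right _ _) _
  have h2 : b y ≤ b y ^ S.M :=
    le_self_pow₀ (b.one_le y) (by have := S.one_le_M; omega)
  have := S.A_nonneg
  calc _ ≤ 2 * S.A * (b y ^ S.M + b y ^ S.M) := h.trans (by gcongr)
    _ = _ := by ring

/-- Cauchy–Schwarz gives integrability at every `x`, so the integral defining `pseudo` is bilinear
pointwise and not merely almost everywhere. -/
theorem integrable_kernel {f g : G → ℂ} (hf : Measurable f) (hg : Measurable g)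
    (h1 : eLpNorm (fun x => (b x ^ S.M) • f x) 2 μ < ∞)
    (h2 : eLpNorm (fun x => b x • g x) 2 μ < ∞) (x : G) :
    Integrable (fun y => S.m (x - y) y * (f (x - y) * g y)) μ := by
  have hsub : Measurable fun y => x - y := measurable_const.sub measurable_id
  have m1 := measurable_enorm_smul (b.measurable.pow_const S.M) hf
  have m2 := measurable_enorm_smul b.measurable hg
  refine ⟨((S.measurable_m.comp (hsub.prodMk measurable_id)).mul
    ((hf.comp hsub).mul hg)).aestronglyMeasurable, ?_⟩
  have h3 := lintegral_mul_le_eLpNorm_two (μ := μ) (m1.comp hsub) m2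
  have e : eLpNorm ((fun x => ‖(b x ^ S.M) • f x‖ₑ) ∘ fun y => x - y) 2 μ =
      eLpNorm (fun x => (b x ^ S.M) • f x) 2 μ := by
    rw [eLpNorm_comp_measurePreserving m1.aestronglyMeasurable
      (Measure.measurePreserving_sub_left μ x), eLpNorm_enorm]
  rw [e, eLpNorm_enorm] at h3
  have h4 := h3.trans_lt (ENNReal.mul_lt_top h1 h2)
  refine lt_of_le_of_lt (b := ENNReal.ofReal (4 * S.A) * ∫⁻ y, ((fun x => ‖(b x ^ S.M) • f x‖ₑ) ∘
    fun y => x - y) y * ‖b y • g y‖ₑ ∂μ) ?_ (ENNReal.mul_lt_top ENNReal.ofReal_lt_top h4)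
  rw [← lintegral_const_mul' _ _ ENNReal.ofReal_ne_top]
  refine lintegral_mono fun y => ?_
  have h5 := ENNReal.ofReal_le_ofReal (S.norm_le_mul (x - y) y)
  rw [ofReal_norm, ENNReal.ofReal_mul (by have := S.A_nonneg; positivity),
    ENNReal.ofReal_mul (pow_nonneg (b.nonneg _) _),
    ← Real.enorm_eq_ofReal (b.nonneg _), ← Real.enorm_eq_ofReal (pow_nonneg (b.nonneg _) _)] at h5
  simp only [Function.comp_apply, enorm_mul, enorm_smul]
  calc _ ≤ (ENNReal.ofReal (4 * S.A) * (‖b (x - y) ^ S.M‖ₑ * ‖b y‖ₑ)) *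
        (‖f (x - y)‖ₑ * ‖g y‖ₑ) := mul_le_mul_left h5 _
    _ = _ := by ring

end BurgersSymbol

/-- Division by the bracket to the power `s`. -/
def lower (b : Bracket μ) (s : ℕ) (f : G → ℂ) (x : G) : ℂ := (b x ^ s)⁻¹ • f x

theorem measurable_lower (b : Bracket μ) (s : ℕ) {f : G → ℂ} (hf : Measurable f) :
    Measurable (lower b s f) := (b.measurable.pow_const s).inv.smul hf

theorem measurable_coe (f : Lp ℂ 2 μ) : Measurable f := (Lp.stronglyMeasurable f).measurable

theorem eLpNorm_pow_lower_le (b : Bracket μ) {s j : ℕ} (hj : j ≤ s) (f : G → ℂ) :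
    eLpNorm (fun x => (b x ^ j) • lower b s f x) 2 μ ≤ eLpNorm f 2 μ := by
  refine eLpNorm_mono fun x => ?_
  have h0 : 0 < b x ^ s := pow_pos (b.pos x) s
  rw [lower, smul_smul, norm_smul, norm_mul, norm_inv,
    Real.norm_of_nonneg h0.le, Real.norm_of_nonneg (pow_nonneg (b.nonneg x) _)]
  refine mul_le_of_le_one_left (norm_nonneg _) ?_
  rw [← div_eq_mul_inv, div_le_one h0]
  exact pow_le_pow_right₀ (b.one_le x) hj

/-- The constant of the embedding into integrable functions. -/
def Bracket.embConst (b : Bracket μ) : ℝ≥0∞ := eLpNorm (fun x => (b x ^ b.σ)⁻¹) 2 μ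

theorem eLpNorm_one_le_embConst_mul (b : Bracket μ) {f : G → ℂ} (hf : Measurable f) :
    eLpNorm f 1 μ ≤ b.embConst * eLpNorm (fun x => (b x ^ b.σ) • f x) 2 μ :=
  eLpNorm_one_le_eLpNorm_two_mul (b.measurable.pow_const _) (fun x => (pow_pos (b.pos x) _).ne') hf

theorem eLpNorm_one_pow_le (b : Bracket μ) {j s : ℕ} (hj : j + b.σ ≤ s) {f : G → ℂ}
    (hf : Measurable f) : eLpNorm (fun x => (b x ^ j) • f x) 1 μ ≤
      b.embConst * eLpNorm (fun x => (b x ^ s) • f x) 2 μ := by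
  refine (eLpNorm_one_le_embConst_mul b ((b.measurable.pow_const j).smul hf)).trans
    (mul_le_mul_right (eLpNorm_mono fun x => ?_) _)
  have h := b.one_le x
  change ‖b x ^ b.σ • (b x ^ j • f x)‖ ≤ _
  rw [smul_smul, norm_smul, norm_smul, ← pow_add, Real.norm_of_nonneg (pow_nonneg (b.nonneg x) _),
    Real.norm_of_nonneg (pow_nonneg (b.nonneg x) _)]
  gcongr
  omega

theorem pow_smul_lower (b : Bracket μ) (s : ℕ) (f : G → ℂ) (x : G) :
    (b x ^ s) • lower b s f x = f x := by
  rw [lower, smul_smul, mul_inv_cancel₀ (pow_pos (b.pos x) s).ne', one_smul]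

theorem eLpNorm_one_pow_lower_le (b : Bracket μ) {s j : ℕ} (hj : j + b.σ ≤ s) {f : G → ℂ}
    (hf : Measurable f) :
    eLpNorm (fun x => (b x ^ j) • lower b s f x) 1 μ ≤ b.embConst * eLpNorm f 2 μ := by
  refine (eLpNorm_one_pow_le b hj (measurable_lower b s hf)).trans ?_
  simp_rw [pow_smul_lower]
  rfl

theorem lower_congr (b : Bracket μ) (s : ℕ) {f g : G → ℂ} (h : f =ᵐ[μ] g) :
    lower b s f =ᵐ[μ] lower b s g := by
  filter_upwards [h] with x hx
  rw [lower, lower, hx]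

namespace BurgersSymbol

variable {b : Bracket μ} (S : BurgersSymbol b) {s : ℕ}

theorem eLpNorm_pseudo_le (hs : S.M + b.σ ≤ s) {f g : G → ℂ} (hf : Measurable f)
    (hg : Measurable g) : eLpNorm (pseudo μ S.m f g) 2 μ ≤ ENNReal.ofReal (4 * S.A) * b.embConst *
      (eLpNorm f 2 μ * eLpNorm (fun x => (b x ^ s) • g x) 2 μ) := by
  have h := eLpNorm_smul_pseudo_le (μ := μ) (m := S.m) (W := fun _ => 1) (W₁ := fun _ => 1)
    (W₂ := fun x => b x ^ S.M) (W₃ := fun _ => 0) (W₄ := fun _ => 0) (C := 4 * S.A) hf hg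
    measurable_const (b.measurable.pow_const _) measurable_const measurable_const (fun x y => by
      simpa [abs_of_nonneg (b.nonneg y)] using S.norm_le_pow x y)
  simp only [one_smul, zero_smul, eLpNorm_zero', add_zero, mul_zero] at h
  refine h.trans ?_
  rw [mul_assoc, mul_left_comm b.embConst]
  gcongr
  exact eLpNorm_one_pow_le b hs hg

theorem memLp_pseudo_lower (hs : S.M + b.σ ≤ s) (h k : Lp ℂ 2 μ) :
    MemLp (pseudo μ S.m (lower b s h) (lower b s k)) 2 μ := by
  have mh := measurable_lower b s (measurable_coe h)
  have mk := measurable_lower b s (measurable_coe k)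
  refine ⟨(measurable_pseudo S.measurable_m mh mk).aestronglyMeasurable,
    (S.eLpNorm_pseudo_le hs mh mk).trans_lt ?_⟩
  refine ENNReal.mul_lt_top (ENNReal.mul_lt_top ENNReal.ofReal_lt_top b.finite)
    (ENNReal.mul_lt_top ?_ ?_)
  · have := eLpNorm_pow_lower_le (μ := μ) b (Nat.zero_le s) h
    simp only [pow_zero, one_smul] at this
    exact this.trans_lt (Lp.memLp h).2
  · simp_rw [pow_smul_lower]
    exact (Lp.memLp k).2

theorem integrable_kernel_lower (hs : S.M + b.σ ≤ s) (h k : Lp ℂ 2 μ) (x : G) :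
    Integrable (fun y => S.m (x - y) y * (lower b s h (x - y) * lower b s k y)) μ := by
  refine S.integrable_kernel (measurable_lower b s (measurable_coe h))
    (measurable_lower b s (measurable_coe k))
    ((eLpNorm_pow_lower_le b (by omega) h).trans_lt (Lp.memLp h).2) ?_ x
  have := eLpNorm_pow_lower_le (μ := μ) b (s := s) (j := 1) (by have := S.one_le_M; omega) k
  simp only [pow_one] at this
  exact this.trans_lt (Lp.memLp k).2

theorem norm_toLp_pseudo_lower_le (hs : S.M + b.σ ≤ s) (h k : Lp ℂ 2 μ) :
    ‖(S.memLp_pseudo_lower hs h k).toLp _‖ ≤ 4 * S.A * b.embConst.toReal *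
      (‖mulL μ (fun x => ((b x ^ s)⁻¹ : ℝ)) h‖ * ‖k‖) := by
  have mh := measurable_lower b s (measurable_coe h)
  have mk := measurable_lower b s (measurable_coe k)
  have h1 := S.eLpNorm_pseudo_le hs mh mk
  have hb : IsBdd fun x => (((b x ^ s)⁻¹ : ℝ) : ℂ) := by
    refine ⟨Complex.measurable_ofReal.comp (b.measurable.pow_const s).inv, 1, fun x => ?_⟩
    rw [Complex.norm_real, norm_inv, norm_pow, Real.norm_of_nonneg (b.nonneg x)]
    exact inv_le_one_of_one_le₀ (one_le_pow₀ (b.one_le x))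
  have e1 : eLpNorm (lower b s h) 2 μ = ‖mulL μ (fun x => (((b x ^ s)⁻¹ : ℝ) : ℂ)) h‖ₑ := by
    rw [enorm_mulL hb]
    rfl
  simp_rw [pow_smul_lower] at h1
  rw [e1, ← Lp.enorm_def k] at h1
  rw [Lp.norm_toLp]
  refine (ENNReal.toReal_mono ?_ h1).trans (le_of_eq ?_)
  · exact ENNReal.mul_ne_top (ENNReal.mul_ne_top ENNReal.ofReal_ne_top b.finite.ne)
      (ENNReal.mul_ne_top enorm_ne_top enorm_ne_top)
  · simp only [ENNReal.toReal_mul, toReal_enorm]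
    rw [ENNReal.toReal_ofReal (by have := S.A_nonneg; positivity)]

end BurgersSymbol

theorem isBdd_inv_pow (b : Bracket μ) (s : ℕ) : IsBdd fun x => (((b x ^ s)⁻¹ : ℝ) : ℂ) := by
  refine ⟨Complex.measurable_ofReal.comp (b.measurable.pow_const s).inv, 1, fun x => ?_⟩
  rw [Complex.norm_real, norm_inv, norm_pow, Real.norm_of_nonneg (b.nonneg x)]
  exact inv_le_one_of_one_le₀ (one_le_pow₀ (b.one_le x))

/-- Division by the bracket to the power `s`, as an operator. -/
def lowerL (b : Bracket μ) (s : ℕ) : Lp ℂ 2 μ →L[ℂ] Lp ℂ 2 μ :=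
  mulL μ fun x => (((b x ^ s)⁻¹ : ℝ) : ℂ)

theorem coeFn_lowerL (b : Bracket μ) (s : ℕ) (f : Lp ℂ 2 μ) :
    lowerL b s f =ᵐ[μ] lower b s f := coeFn_mulL (isBdd_inv_pow b s) f

theorem norm_lowerL_le (b : Bracket μ) (s : ℕ) (f : Lp ℂ 2 μ) : ‖lowerL b s f‖ ≤ ‖f‖ := by
  have h := norm_mulL_le (isBdd_inv_pow b s) (c := 1) (fun x => ?_) f
  · rwa [one_mul] at h
  · rw [Complex.norm_real, norm_inv, norm_pow, Real.norm_of_nonneg (b.nonneg x)]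
    exact inv_le_one_of_one_le₀ (one_le_pow₀ (b.one_le x))

namespace BurgersSymbol

variable {b : Bracket μ} (S : BurgersSymbol b) {s : ℕ}

/-- The bilinear operator with symbol `S`, on functions divided by the bracket to the power `s`. -/
def bilL (hs : S.M + b.σ ≤ s) : Lp ℂ 2 μ →L[ℂ] Lp ℂ 2 μ →L[ℂ] Lp ℂ 2 μ :=
  LinearMap.mkContinuous₂
    (LinearMap.mk₂ ℂ (fun h k => (S.memLp_pseudo_lower hs h k).toLp _)
      (fun h h' k => by
        rw [← MemLp.toLp_add]
        refine MemLp.toLp_congr _ _ (ae_of_all _ fun x => ?_)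
        rw [pseudo_congr (lower_congr b s (Lp.coeFn_add h h')) (EventuallyEq.refl _ _)]
        simp only [Pi.add_apply, pseudo]
        rw [← integral_add (S.integrable_kernel_lower hs h k x)
          (S.integrable_kernel_lower hs h' k x)]
        congr 1; funext y
        simp only [lower, Pi.add_apply, smul_add]
        ring)
      (fun c h k => by
        rw [← MemLp.toLp_const_smul]
        refine MemLp.toLp_congr _ _ (ae_of_all _ fun x => ?_)
        rw [pseudo_congr (lower_congr b s (Lp.coeFn_smul c h)) (EventuallyEq.refl _ _)]
        simp only [Pi.smul_apply, pseudo, smul_eq_mul]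
        rw [← integral_const_mul]
        congr 1; funext y
        simp only [lower, Pi.smul_apply, smul_eq_mul, Complex.real_smul]
        ring)
      (fun h k k' => by
        rw [← MemLp.toLp_add]
        refine MemLp.toLp_congr _ _ (ae_of_all _ fun x => ?_)
        rw [pseudo_congr (EventuallyEq.refl _ _) (lower_congr b s (Lp.coeFn_add k k'))]
        simp only [Pi.add_apply, pseudo]
        rw [← integral_add (S.integrable_kernel_lower hs h k x)
          (S.integrable_kernel_lower hs h k' x)]
        congr 1; funext y
        simp only [lower, Pi.add_apply, smul_add]
        ring)
      (fun c h k => by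
        rw [← MemLp.toLp_const_smul]
        refine MemLp.toLp_congr _ _ (ae_of_all _ fun x => ?_)
        rw [pseudo_congr (EventuallyEq.refl _ _) (lower_congr b s (Lp.coeFn_smul c k))]
        simp only [Pi.smul_apply, pseudo, smul_eq_mul]
        rw [← integral_const_mul]
        congr 1; funext y
        simp only [lower, Pi.smul_apply, smul_eq_mul, Complex.real_smul]
        ring))
    -- The sharper bound, with the first factor divided by `b^s`, is kept separately in
    -- `norm_bilL_le`; continuity only needs that division does not increase the norm.
    (4 * S.A * b.embConst.toReal) (fun h k => by
      simp only [LinearMap.mk₂_apply]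
      refine (S.norm_toLp_pseudo_lower_le hs h k).trans ?_
      rw [mul_assoc (4 * S.A * b.embConst.toReal)]
      have := S.A_nonneg
      gcongr
      exact norm_lowerL_le b s h)

theorem coeFn_bilL (hs : S.M + b.σ ≤ s) (h k : Lp ℂ 2 μ) :
    S.bilL hs h k =ᵐ[μ] pseudo μ S.m (lower b s h) (lower b s k) :=
  (S.memLp_pseudo_lower hs h k).coeFn_toLp

theorem norm_bilL_le (hs : S.M + b.σ ≤ s) (h k : Lp ℂ 2 μ) :
    ‖S.bilL hs h k‖ ≤ 4 * S.A * b.embConst.toReal * (‖lowerL b s h‖ * ‖k‖) :=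
  S.norm_toLp_pseudo_lower_le hs h k

theorem isReal_bilL (hs : S.M + b.σ ≤ s) {h k : Lp ℂ 2 μ} (hh : IsReal h) (hk : IsReal k) :
    IsReal (S.bilL hs h k) := by
  have hl : ∀ {f : Lp ℂ 2 μ}, IsReal f →
      ∀ᵐ x ∂μ, lower b s f (-x) = (starRingEnd ℂ) (lower b s f x) := by
    intro f hf
    filter_upwards [hf] with x hx
    simp [lower, hx, b.map_neg]
  unfold IsReal
  filter_upwards [S.coeFn_bilL hs h k, ae_neg (S.coeFn_bilL hs h k)] with x h1 h2
  rw [h1, h2, pseudo_neg S.m_neg (hl hh) (hl hk)]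

end BurgersSymbol

end Bilinear

/-! ### Truncated radial multipliers and energy estimates for operators -/

section Truncation

variable {G : Type*} [AddCommGroup G] [MeasurableSpace G] {μ : Measure G}

/-- The transport part `i ω(ξ)` of the linear equation. -/
structure TransportSymbol (b : Bracket μ) where
  ω : G → ℝ
  c : ℝ
  measurable_ω : Measurable ω
  ω_neg : ∀ x, ω (-x) = -ω x
  ω_le : ∀ x, |ω x| ≤ c * b x

/-- The truncated radial multiplier `φ(b(x)) 1_{b(x) ≤ n}`. -/
def radMul (b : Bracket μ) (φ : ℝ → ℝ) (n : ℝ) (x : G) : ℝ :=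
  open Classical in if b x ≤ n then φ (b x) else 0

theorem measurable_radMul (b : Bracket μ) {φ : ℝ → ℝ} (hφ : Measurable φ) (n : ℝ) :
    Measurable (radMul b φ n) :=
  Measurable.ite (measurableSet_le b.measurable measurable_const)
    (hφ.comp b.measurable) measurable_const

theorem radMul_nonneg (b : Bracket μ) {p : ℕ} {φ : ℝ → ℝ} (hφ : IsWeight p φ) (n : ℝ) (x : G) :
    0 ≤ radMul b φ n x := by
  unfold radMul
  split_ifs
  · exact hφ.nonneg _ (b.one_le x)
  · exact le_rfl

theorem radMul_le (b : Bracket μ) {p : ℕ} {φ : ℝ → ℝ} (hφ : IsWeight p φ) {n : ℝ} (hn : 1 ≤ n)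
    (x : G) : radMul b φ n x ≤ φ n := by
  unfold radMul
  split_ifs with h
  · exact hφ.mono _ _ (b.one_le x) h
  · exact hφ.nonneg _ hn

theorem isBdd_radMul (b : Bracket μ) {p : ℕ} {φ : ℝ → ℝ} (hφ : IsWeight p φ) (n : ℝ) :
    IsBdd fun x => (radMul b φ n x : ℂ) := by
  refine ⟨Complex.measurable_ofReal.comp (measurable_radMul b hφ.measurable n), φ (max 1 n),
    fun x => ?_⟩
  rw [Complex.norm_real, Real.norm_of_nonneg (radMul_nonneg b hφ n x)]
  refine le_trans ?_ (radMul_le b hφ (le_max_left 1 n) x)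
  unfold radMul
  split_ifs with h h2 h2
  · exact le_rfl
  · exact absurd (h.trans (le_max_right _ _)) h2
  · exact hφ.nonneg _ (b.one_le x)
  · exact le_rfl

/-- The operator of multiplication by `φ(b(x)) 1_{b(x) ≤ n}`. -/
def radL (b : Bracket μ) (φ : ℝ → ℝ) (n : ℝ) : Lp ℂ 2 μ →L[ℂ] Lp ℂ 2 μ :=
  mulL μ fun x => (radMul b φ n x : ℂ)

/-- The frequency truncation `1_{b(x) ≤ n}`. -/
def cutL (b : Bracket μ) (n : ℝ) : Lp ℂ 2 μ →L[ℂ] Lp ℂ 2 μ := radL b (fun r => r ^ 0) n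

/-- The multiplication by `b(x)^s 1_{b(x) ≤ n}`. -/
def raiseL (b : Bracket μ) (s : ℕ) (n : ℝ) : Lp ℂ 2 μ →L[ℂ] Lp ℂ 2 μ := radL b (fun r => r ^ s) n

theorem coeFn_radL (b : Bracket μ) {p : ℕ} {φ : ℝ → ℝ} (hφ : IsWeight p φ) (n : ℝ)
    (f : Lp ℂ 2 μ) : radL b φ n f =ᵐ[μ] fun x => (radMul b φ n x : ℂ) * f x :=
  coeFn_mulL (isBdd_radMul b hφ n) f

theorem norm_radL_le (b : Bracket μ) {p : ℕ} {φ : ℝ → ℝ} (hφ : IsWeight p φ) {n : ℝ} (hn : 1 ≤ n)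
    (f : Lp ℂ 2 μ) : ‖radL b φ n f‖ ≤ φ n * ‖f‖ := by
  refine norm_mulL_le (isBdd_radMul b hφ n) (fun x => ?_) f
  rw [Complex.norm_real, Real.norm_of_nonneg (radMul_nonneg b hφ n x)]
  exact radMul_le b hφ hn x

theorem norm_cutL_le (b : Bracket μ) {n : ℝ} (hn : 1 ≤ n) (f : Lp ℂ 2 μ) :
    ‖cutL b n f‖ ≤ ‖f‖ := by
  have h := norm_radL_le b (isWeight_pow 0) hn f
  rwa [pow_zero, one_mul] at h

theorem radL_cutL (b : Bracket μ) {p : ℕ} {φ : ℝ → ℝ} (hφ : IsWeight p φ) (n : ℝ)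
    (f : Lp ℂ 2 μ) : radL b φ n (cutL b n f) = radL b φ n f := by
  rw [radL, cutL, radL, mulL_mulL (isBdd_radMul b hφ n) (isBdd_radMul b (isWeight_pow 0) n)]
  congr 2; funext x
  unfold radMul
  split_ifs <;> simp

theorem cutL_radL (b : Bracket μ) {p : ℕ} {φ : ℝ → ℝ} (hφ : IsWeight p φ) (n : ℝ)
    (f : Lp ℂ 2 μ) : cutL b n (radL b φ n f) = radL b φ n f := by
  rw [radL, cutL, radL, mulL_mulL (isBdd_radMul b (isWeight_pow 0) n) (isBdd_radMul b hφ n)]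
  congr 2; funext x
  unfold radMul
  split_ifs <;> simp

theorem cutL_cutL (b : Bracket μ) (n : ℝ) (f : Lp ℂ 2 μ) : cutL b n (cutL b n f) = cutL b n f :=
  cutL_radL b (isWeight_pow 0) n f

theorem cutL_mulL (b : Bracket μ) {w : G → ℂ} (hw : IsBdd w) (n : ℝ) (f : Lp ℂ 2 μ) :
    cutL b n (mulL μ w f) = mulL μ w (cutL b n f) := by
  rw [cutL, radL, mulL_mulL (isBdd_radMul b (isWeight_pow 0) n) hw,
    mulL_mulL hw (isBdd_radMul b (isWeight_pow 0) n)]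
  congr 2; funext x; ring

variable [MeasurableAdd₂ G] [MeasurableNeg G] [SFinite μ] [μ.IsAddLeftInvariant] [μ.IsNegInvariant]

/-- Multiplication by `b^s` is bounded only after truncation; on truncated functions it is inverse
to division by `b^s`. Galerkin solutions can thus be written either as `u` or as `h = b^s u`. -/
theorem lowerL_raiseL (b : Bracket μ) (s : ℕ) (n : ℝ) (f : Lp ℂ 2 μ) :
    lowerL b s (raiseL b s n f) = cutL b n f := by
  rw [lowerL, raiseL, cutL, radL, radL, mulL_mulL (isBdd_inv_pow b s)
    (isBdd_radMul b (isWeight_pow s) n)]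
  congr 2; funext x
  have := (pow_pos (b.pos x) s).ne'
  unfold radMul
  split_ifs
  · rw [← Complex.ofReal_mul, inv_mul_cancel₀ this]
    simp
  · simp

theorem raiseL_lowerL (b : Bracket μ) (s : ℕ) (n : ℝ) (f : Lp ℂ 2 μ) :
    raiseL b s n (lowerL b s f) = cutL b n f := by
  rw [lowerL, raiseL, cutL, radL, radL, mulL_mulL
    (isBdd_radMul b (isWeight_pow s) n) (isBdd_inv_pow b s)]
  congr 2; funext x
  have := (pow_pos (b.pos x) s).ne'
  unfold radMul
  split_ifs
  · rw [← Complex.ofReal_mul, mul_inv_cancel₀ this]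
    simp
  · simp

theorem IsReal.radL {f : Lp ℂ 2 μ} (h : IsReal f) (b : Bracket μ) {p : ℕ} {φ : ℝ → ℝ}
    (hφ : IsWeight p φ) (n : ℝ) : IsReal (radL b φ n f) := by
  refine h.mulL (isBdd_radMul b hφ n) fun x => ?_
  rw [Complex.conj_ofReal]
  simp [radMul, b.map_neg]

theorem IsReal.lowerL {f : Lp ℂ 2 μ} (h : IsReal f) (b : Bracket μ) (s : ℕ) :
    IsReal (lowerL b s f) := by
  refine h.mulL (isBdd_inv_pow b s) fun x => ?_
  rw [Complex.conj_ofReal, b.map_neg]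

/-- High frequencies are small. -/
theorem norm_sub_cutL_le (b : Bracket μ) {n : ℝ} (hn : 1 ≤ n) {f : Lp ℂ 2 μ} {C : ℝ}
    (hf : eLpNorm (fun x => b x • f x) 2 μ ≤ ENNReal.ofReal C) (hC : 0 ≤ C) :
    ‖f - cutL b n f‖ ≤ C / n := by
  have h1 : ‖f - cutL b n f‖ₑ ≤ ENNReal.ofReal n⁻¹ * eLpNorm (fun x => b x • f x) 2 μ := by
    rw [Lp.enorm_def, ← Real.enorm_eq_ofReal (by positivity), ← eLpNorm_const_smul]
    refine eLpNorm_mono_ae ?_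
    filter_upwards [Lp.coeFn_sub f (cutL b n f), coeFn_radL b (isWeight_pow 0) n f] with x h1 h2
    rw [h1, Pi.sub_apply, cutL, h2, Pi.smul_apply, smul_smul, norm_smul,
      Real.norm_of_nonneg (by have := b.nonneg x; positivity)]
    unfold radMul
    split_ifs with h
    · simp only [pow_zero, Complex.ofReal_one, one_mul, sub_self, norm_zero]
      have := b.nonneg x
      positivity
    · simp only [Complex.ofReal_zero, zero_mul, sub_zero]
      refine le_mul_of_one_le_left (norm_nonneg _) ?_
      rw [inv_mul_eq_div, one_le_div (by linarith)]
      exact (not_le.1 h).le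
  have h2 := h1.trans (mul_le_mul_right hf _)
  rw [← ENNReal.ofReal_mul (by positivity), ← ofReal_norm] at h2
  rw [div_eq_inv_mul]
  exact (ENNReal.ofReal_le_ofReal_iff (by positivity)).1 h2

namespace TransportSymbol

variable {b : Bracket μ} (Ω : TransportSymbol b) {s : ℕ}

theorem isBdd (hs : 1 ≤ s) : IsBdd fun x => Complex.I * ((Ω.ω x * (b x ^ s)⁻¹ : ℝ) : ℂ) := by
  refine ⟨measurable_const.mul (Complex.measurable_ofReal.comp
    (Ω.measurable_ω.mul (b.measurable.pow_const s).inv)), Ω.c, fun x => ?_⟩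
  have h1 : 0 < b x ^ s := pow_pos (b.pos x) s
  have h2 : b x ≤ b x ^ s := le_self_pow₀ (b.one_le x) (by omega)
  rw [norm_mul, Complex.norm_I, one_mul, Complex.norm_real, norm_mul, norm_inv,
    Real.norm_of_nonneg h1.le, Real.norm_eq_abs, ← div_eq_mul_inv, div_le_iff₀ h1]
  have h3 := Ω.ω_le x
  have hc : 0 ≤ Ω.c := by
    have := (abs_nonneg _).trans h3
    exact nonneg_of_mul_nonneg_left this (b.pos x)
  nlinarith

/-- The transport operator on functions divided by the bracket to the power `s`. -/
def transL (s : ℕ) : Lp ℂ 2 μ →L[ℂ] Lp ℂ 2 μ :=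
  mulL μ fun x => Complex.I * ((Ω.ω x * (b x ^ s)⁻¹ : ℝ) : ℂ)

theorem isReal_transL (hs : 1 ≤ s) {f : Lp ℂ 2 μ} (hf : IsReal f) : IsReal (Ω.transL s f) := by
  refine hf.mulL (Ω.isBdd hs) fun x => ?_
  rw [map_mul, Complex.conj_ofReal, Complex.conj_I, Ω.ω_neg, b.map_neg]
  push_cast; ring

/-- The integrand is `i` times a real function. Consequently the transport term drops out of every
energy estimate. -/
theorem re_inner_mulL_eq_zero {w w' : G → ℝ} (hw : IsBdd fun x => (w x : ℂ))
    (hw' : IsBdd fun x => Complex.I * (w' x : ℂ)) (f : Lp ℂ 2 μ) :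
    (inner ℂ (mulL μ (fun x => (w x : ℂ)) f)
      (mulL μ (fun x => Complex.I * (w' x : ℂ)) f)).re = 0 := by
  rw [inner_mulL_mulL hw hw']
  have : ∀ x, (starRingEnd ℂ) (w x : ℂ) * (Complex.I * (w' x : ℂ)) *
      (f x * (starRingEnd ℂ) (f x)) =
      Complex.I * ((w x * w' x * ‖f x‖ ^ 2 : ℝ) : ℂ) := by
    intro x
    rw [Complex.conj_ofReal, Complex.mul_conj, Complex.normSq_eq_norm_sq]
    push_cast; ring
  simp_rw [this]
  rw [integral_const_mul, integral_complex_ofReal]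
  simp

theorem re_inner_transL (hs : 1 ≤ s) (k : Lp ℂ 2 μ) :
    (inner ℂ (lowerL b s k) (Ω.transL s k)).re = 0 :=
  re_inner_mulL_eq_zero (isBdd_inv_pow b s) (Ω.isBdd hs) k

/-- Weighting and truncating by real multipliers leaves the transport multiplier purely imaginary.
-/
theorem re_inner_radL_transL (hs : 1 ≤ s) {p : ℕ} {φ : ℝ → ℝ} (hφ : IsWeight p φ) (n : ℝ)
    (u : Lp ℂ 2 μ) :
    (inner ℂ (radL b φ n u) (radL b φ n (Ω.transL s (raiseL b s n u)))).re = 0 := by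
  have h1 : radL b φ n (Ω.transL s (raiseL b s n u)) = mulL μ (fun x => Complex.I *
      ((radMul b φ n x * (Ω.ω x * (b x ^ s)⁻¹) * radMul b (fun r => r ^ s) n x : ℝ) : ℂ)) u := by
    rw [raiseL, radL, radL, transL, mulL_mulL (Ω.isBdd hs) (isBdd_radMul b (isWeight_pow s) n),
      mulL_mulL (isBdd_radMul b hφ n) ((Ω.isBdd hs).mul (isBdd_radMul b (isWeight_pow s) n))]
    congr 2; funext x
    push_cast; ring
  have hb : IsBdd (fun x => Complex.I *
      ((radMul b φ n x * (Ω.ω x * (b x ^ s)⁻¹) * radMul b (fun r => r ^ s) n x : ℝ) : ℂ)) := by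
    convert! (isBdd_radMul b hφ n).mul ((Ω.isBdd hs).mul (isBdd_radMul b (isWeight_pow s) n))
      using 1
    funext x
    push_cast; ring
  rw [h1]
  exact re_inner_mulL_eq_zero (isBdd_radMul b hφ n) hb u

end TransportSymbol

namespace BurgersSymbol

variable {b : Bracket μ} (S : BurgersSymbol b) {s : ℕ}

theorem isReal_lower {f : Lp ℂ 2 μ} (hf : IsReal f) :
    ∀ᵐ x ∂μ, lower b s f (-x) = (starRingEnd ℂ) (lower b s f x) := by
  filter_upwards [hf] with x hx
  simp [lower, hx, b.map_neg]

theorem le_of_ofReal_le {a c : ℝ} {C : ℝ≥0∞} (h : ENNReal.ofReal a ≤ C) (hC : C ≠ ∞)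
    (e : C.toReal = c) : a ≤ c := by
  rw [← e]
  by_cases ha : 0 ≤ a
  · rw [← ENNReal.toReal_ofReal ha]
    exact ENNReal.toReal_mono hC h
  · exact (not_le.1 ha).le.trans ENNReal.toReal_nonneg

/-- The `L²` energy estimate. -/
theorem abs_re_inner_bilL_le (hs : S.M + b.σ ≤ s) {h : Lp ℂ 2 μ} (hh : IsReal h) (k : Lp ℂ 2 μ) :
    |2 * (inner ℂ (lowerL b s k) (S.bilL hs h k)).re| ≤
      5 * S.A * b.embConst.toReal * ‖h‖ * ‖lowerL b s k‖ ^ 2 := by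
  have mh := measurable_lower b s (measurable_coe h)
  have mk := measurable_lower b s (measurable_coe k)
  have hk2 : eLpNorm (lower b s k) 2 μ = ‖lowerL b s k‖ₑ := by
    rw [Lp.enorm_def]
    exact (eLpNorm_congr_ae (coeFn_lowerL b s k)).symm
  have n1 : eLpNorm (fun x => (b x ^ S.M) • lower b s h x) 1 μ ≤ b.embConst * ‖h‖ₑ := by
    rw [Lp.enorm_def]
    exact eLpNorm_one_pow_lower_le b hs (measurable_coe h)
  -- A constant weight has no commutator, and the power of the minimum can be put entirely on `h`,
  -- so `W' = 0` and `K = 1`. The constant is then `1 + 4 * 1 = 5`, and `k` is measured in `L²`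
  -- alone.
  have e := ofReal_abs_re_energy_le S (f := lower b s h) (z := lower b s k) (W := fun _ => 1)
    (W' := fun _ => 0) (K := 1) mh mk measurable_const measurable_const (by simp) (by simp)
    (by norm_num) (fun x y => by simpa using b.nonneg x)
    (fun x y => by
      simpa using pow_le_pow_left₀ (le_min (b.nonneg x) (b.nonneg y)) (min_le_left _ _) S.M)
    (isReal_lower hh) (n1.trans_lt (ENNReal.mul_lt_top b.finite enorm_lt_top))
    (by simpa only [one_smul, hk2] using enorm_lt_top)
    (by
      have := eLpNorm_pow_lower_le (μ := μ) b (s := s) (j := 1) (by have := S.one_le_M; omega) k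
      simp only [pow_one] at this
      simpa only [one_smul] using this.trans_lt (Lp.memLp k).2)
    (by simp)
    ((eLpNorm_one_pow_lower_le b hs (measurable_coe k)).trans_lt
      (ENNReal.mul_lt_top b.finite (Lp.memLp k).2))
  have ei : inner ℂ (lowerL b s k) (S.bilL hs h k) = ∫ x, (((1 : ℝ) : ℂ) ^ 2 *
      (pseudo μ S.m (lower b s h) (lower b s k) x * (starRingEnd ℂ) (lower b s k x))) ∂μ := by
    rw [L2.inner_def]
    refine integral_congr_ae ?_
    filter_upwards [coeFn_lowerL b s k, S.coeFn_bilL hs h k] with x h1 h2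
    rw [h1, h2]
    simp [RCLike.inner_apply]
  rw [ei]
  simp only [one_smul, hk2, zero_smul, eLpNorm_zero', zero_mul, add_zero] at e
  refine le_of_ofReal_le (e.trans (mul_le_mul_right (mul_le_mul_right (mul_le_mul_left n1 _) _) _))
    ?_ ?_
  · exact ENNReal.mul_ne_top ENNReal.ofReal_ne_top (ENNReal.mul_ne_top enorm_ne_top
      (ENNReal.mul_ne_top (ENNReal.mul_ne_top b.finite.ne enorm_ne_top) enorm_ne_top))
  · simp only [ENNReal.toReal_mul, toReal_enorm]
    rw [ENNReal.toReal_ofReal (by have := S.A_nonneg; positivity)]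
    ring

/-- The weighted energy estimate for truncated functions. -/
theorem abs_re_inner_radL_bilL_le (hs : S.M + b.σ ≤ s) {p : ℕ} {φ : ℝ → ℝ} (hφ : IsWeight p φ)
    {n : ℝ} (hn : 1 ≤ n) {u : Lp ℂ 2 μ} (hu : IsReal u) :
    |2 * (inner ℂ (radL b φ n u)
      (radL b φ n (S.bilL hs (raiseL b s n u) (raiseL b s n u)))).re| ≤
      2 * (S.A * (1 + 4 * 2 ^ p)) * b.embConst.toReal * ‖raiseL b s n u‖ * ‖radL b φ n u‖ ^ 2 := by
  set h := raiseL b s n u with hh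
  have hre : IsReal h := hu.radL b (isWeight_pow s) n
  have mh := measurable_lower b s (measurable_coe h)
  have hlow : lower b s h =ᵐ[μ] fun x => (radMul b (fun r => r ^ 0) n x : ℂ) * u x := by
    have h1 := coeFn_lowerL b s h
    rw [hh, lowerL_raiseL] at h1
    exact h1.symm.trans (coeFn_radL b (isWeight_pow 0) n u)
  have hW : (fun x => φ (b x) • lower b s h x) =ᵐ[μ] radL b φ n u := by
    filter_upwards [hlow, coeFn_radL b hφ n u] with x h1 h2
    rw [h1, h2]
    unfold radMul
    split_ifs <;> simp
  have n2 : eLpNorm (fun x => φ (b x) • lower b s h x) 2 μ = ‖radL b φ n u‖ₑ := by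
    rw [Lp.enorm_def]
    exact eLpNorm_congr_ae hW
  have n1 : eLpNorm (fun x => (b x ^ S.M) • lower b s h x) 1 μ ≤ b.embConst * ‖h‖ₑ := by
    rw [Lp.enorm_def]
    exact eLpNorm_one_pow_lower_le b hs (measurable_coe h)
  have n1f := n1.trans_lt (ENNReal.mul_lt_top b.finite enorm_lt_top)
  have mφ := hφ.measurable_comp b
  have e := ofReal_abs_re_energy_le S (f := lower b s h) (z := lower b s h)
    (W := fun x => φ (b x)) (W' := fun x => φ (b x)) (K := 2 ^ p) mh mh mφ mφ
    (fun x => hφ.nonneg _ (b.one_le x)) (fun x => hφ.nonneg _ (b.one_le x)) (by positivity)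
    (hφ.abs_sub_mul_le b) (hφ.mul_min_pow_le b S.M) (isReal_lower hre) n1f
    (n2.trans_lt enorm_lt_top) (by
      -- Only finiteness is at stake: the truncation gives `b ≤ n` on the support, and this factor
      -- `n` does not enter the final estimate.
      refine lt_of_le_of_lt (eLpNorm_mono_ae (g := fun x => n • radL b φ n u x) ?_) ?_
      · filter_upwards [hlow, hW] with x h1 h2
        rw [norm_smul, h2, norm_smul, Real.norm_of_nonneg (b.nonneg x),
          Real.norm_of_nonneg (by linarith)]
        by_cases hx : b x ≤ n
        · gcongr
        · have h3 : radL b φ n u x = 0 := by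
            rw [← h2, h1, radMul, if_neg hx]; simp
          rw [h3]; simp
      · have := eLpNorm_const_smul (μ := μ) n (radL b φ n u : G → ℂ) 2
        refine this.trans_lt (ENNReal.mul_lt_top enorm_lt_top (Lp.memLp _).2)) 
    (n2.trans_lt enorm_lt_top) n1f
  have ei : inner ℂ (radL b φ n u) (radL b φ n (S.bilL hs h h)) =
      ∫ x, ((φ (b x) : ℂ) ^ 2 *
      (pseudo μ S.m (lower b s h) (lower b s h) x * (starRingEnd ℂ) (lower b s h x))) ∂μ := by
    rw [L2.inner_def]
    refine integral_congr_ae ?_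
    filter_upwards [hlow, coeFn_radL b hφ n u, coeFn_radL b hφ n (S.bilL hs h h),
      S.coeFn_bilL hs h h] with x h1 h2 h3 h4
    rw [h1, h2, h3, h4]
    unfold radMul
    simp only [RCLike.inner_apply]
    split_ifs
    · simp only [map_mul, Complex.conj_ofReal, pow_zero, Complex.ofReal_one, map_one]
      ring
    · simp
  rw [ei]
  rw [n2] at e
  refine le_of_ofReal_le (e.trans (mul_le_mul_right (mul_le_mul_right (add_le_add
    (mul_le_mul_left n1 _) (mul_le_mul_right n1 _)) _) _)) ?_ ?_
  · have h1 : b.embConst * ‖h‖ₑ ≠ ∞ := ENNReal.mul_ne_top b.finite.ne enorm_ne_top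
    exact ENNReal.mul_ne_top ENNReal.ofReal_ne_top (ENNReal.mul_ne_top enorm_ne_top
      (ENNReal.add_ne_top.2 ⟨ENNReal.mul_ne_top h1 enorm_ne_top,
        ENNReal.mul_ne_top enorm_ne_top h1⟩))
  · rw [mul_comm (‖radL b φ n u‖ₑ) (b.embConst * ‖h‖ₑ), ← two_mul]
    simp only [ENNReal.toReal_mul, toReal_enorm, ENNReal.toReal_ofNat]
    rw [ENNReal.toReal_ofReal (by have := S.A_nonneg; positivity)]
    ring

/-- The bilinear operator loses one derivative. -/
theorem norm_bilL_sub_cutL_le (hs : S.M + b.σ + 1 ≤ s) {n : ℝ} (hn : 1 ≤ n) (h k : Lp ℂ 2 μ) :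
    ‖S.bilL (Nat.le_of_succ_le hs) h k - cutL b n (S.bilL (Nat.le_of_succ_le hs) h k)‖ ≤
      8 * S.A * b.embConst.toReal * (‖h‖ * ‖k‖) / n := by
  have hA := S.A_nonneg
  have h0 : 0 ≤ 8 * S.A * b.embConst.toReal * (‖h‖ * ‖k‖) := by positivity
  refine norm_sub_cutL_le b hn ?_ h0
  -- Here `b (x + y) ≤ 2 b x b y` doubles the constant `4 A` and raises the exponent on `y` to `M +
  -- 1`. That is the reason for one more unit in the condition on `s`.
  have e := eLpNorm_smul_pseudo_le (μ := μ) (m := S.m) (W := b) (W₁ := b)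
    (W₂ := fun x => b x ^ (S.M + 1)) (W₃ := fun _ => 0) (W₄ := fun _ => 0) (C := 8 * S.A)
    (measurable_lower b s (measurable_coe h)) (measurable_lower b s (measurable_coe k))
    b.measurable (b.measurable.pow_const _) measurable_const measurable_const (fun x y => by
      rw [abs_of_nonneg (b.nonneg _), abs_of_nonneg (b.nonneg _),
        abs_of_nonneg (pow_nonneg (b.nonneg _) _)]
      have h1 := S.norm_le_pow x y
      have h2 := b.add_le_two_mul x y
      have := b.nonneg x
      have := b.nonneg y
      calc b (x + y) * ‖S.m x y‖ ≤ 2 * (b x * b y) * (4 * S.A * b y ^ S.M) := by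
            gcongr
        _ ≤ _ := by rw [pow_succ]; simp; nlinarith)
  have e1 : eLpNorm (fun x => b x • S.bilL (Nat.le_of_succ_le hs) h k x) 2 μ =
      eLpNorm (fun x => b x • pseudo μ S.m (lower b s h) (lower b s k) x) 2 μ := by
    refine eLpNorm_congr_ae ?_
    filter_upwards [S.coeFn_bilL (Nat.le_of_succ_le hs) h k] with x hx
    rw [hx]
  rw [e1]
  refine e.trans ?_
  simp only [zero_smul, eLpNorm_zero', mul_zero, add_zero]
  have t1 := eLpNorm_pow_lower_le (μ := μ) b (s := s) (j := 1) (by omega) h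
  have t2 := eLpNorm_one_pow_lower_le (μ := μ) b (s := s) (j := S.M + 1) (by omega)
    (measurable_coe k)
  simp only [pow_one] at t1
  refine (mul_le_mul_right (mul_le_mul' t1 t2) _).trans (le_of_eq ?_)
  rw [← Lp.enorm_def, ← Lp.enorm_def, ← ofReal_norm, ← ofReal_norm,
    ← ENNReal.ofReal_toReal (a := b.embConst) b.finite.ne,
    ← ENNReal.ofReal_mul ENNReal.toReal_nonneg, ← ENNReal.ofReal_mul (norm_nonneg _),
    ← ENNReal.ofReal_mul (by positivity)]
  rw [ENNReal.toReal_ofReal ENNReal.toReal_nonneg]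
  congr 1; ring

end BurgersSymbol

end Truncation

/-! ### Ordinary differential equations -/

section ODE

/-- Grönwall's inequality with one-sided derivatives at the end points; the negative term `-ε/κ` of
the sharp bound is dropped. -/
theorem le_mul_exp_of_deriv_le {f : ℝ → ℝ} {T κ ε : ℝ} (hκ : 0 < κ) (hε : 0 ≤ ε)
    (h : ∀ t ∈ Icc 0 T, ∃ f', HasDerivWithinAt f f' (Icc 0 T) t ∧ f' ≤ κ * f t + ε) :
    ∀ t ∈ Icc 0 T, f t ≤ (f 0 + ε / κ) * Real.exp (κ * t) := by
  intro t ht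
  choose! f' hf h using h
  have h1 := le_gronwallBound_of_liminf_deriv_right_le (f := f) (f' := f') (δ := f 0) (K := κ)
    (ε := ε) (a := 0) (b := T) (fun t ht => (hf t ht).continuousWithinAt) (fun x hx r hr => by
      have h2 : HasDerivWithinAt f (f' x) (Ici x) x :=
        (hf x (Ico_subset_Icc_self hx)).mono_of_mem_nhdsWithin (Icc_mem_nhdsGE_of_mem hx)
      simpa [slope_def_field, div_eq_inv_mul] using h2.liminf_right_slope_le hr) le_rfl
    (fun x hx => h x (Ico_subset_Icc_self hx)) t ht
  rw [gronwallBound_of_K_ne_0 hκ.ne', sub_zero] at h1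
  have : 0 ≤ ε / κ := by positivity
  nlinarith

variable {E : Type*} [NormedAddCommGroup E] [NormedSpace ℝ E]

/-- Picard–Lindelöf on the ball of radius `L * T`: a field bounded by `L` cannot leave it before
time `T`, so the length of the interval is not restricted. -/
theorem exists_solution_of_lipschitz [CompleteSpace E] {V : E → E} {K : ℝ≥0} {L T : ℝ} (hT : 0 ≤ T)
    (hV : LipschitzWith K V) (hL : ∀ x, ‖V x‖ ≤ L) (x₀ : E) :
    ∃ u : ℝ → E, u 0 = x₀ ∧ ∀ t ∈ Icc 0 T, HasDerivWithinAt u (V (u t)) (Icc 0 T) t := by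
  have hL0 : 0 ≤ L := (norm_nonneg _).trans (hL x₀)
  have hp : IsPicardLindelof (fun _ : ℝ => V) (tmin := 0) (tmax := T) ⟨0, left_mem_Icc.2 hT⟩ x₀
      (⟨L, hL0⟩ * ⟨T, hT⟩) 0 ⟨L, hL0⟩ K := by
    refine IsPicardLindelof.of_time_independent (fun x _ => hL x) hV.lipschitzOnWith ?_
    have : ((⟨L, hL0⟩ * ⟨T, hT⟩ : ℝ≥0) : ℝ) = L * T := rfl
    simp only [sub_zero, sub_self, max_eq_left hT, this, NNReal.coe_zero]
    exact le_rfl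
  obtain ⟨u, h0, hu⟩ := hp.exists_eq_forall_mem_Icc_hasDerivWithinAt (Metric.mem_closedBall_self
    (by simp))
  exact ⟨u, h0, hu⟩

/-- A linear constraint annihilated by the field is conserved. It is applied to reality and to the
support in frequency. -/
theorem eq_zero_of_hasDerivWithinAt {F : Type*} [NormedAddCommGroup F] [NormedSpace ℝ F]
    {V : E → E} {u : ℝ → E} {T : ℝ}
    (hu : ∀ t ∈ Icc 0 T, HasDerivWithinAt u (V (u t)) (Icc 0 T) t) (Q : E →L[ℝ] F)
    (hQ : ∀ x, Q (V x) = 0) (h0 : Q (u 0) = 0) : ∀ t ∈ Icc 0 T, Q (u t) = 0 := by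
  intro t ht
  have h1 : ∀ t ∈ Icc 0 T, HasDerivWithinAt (fun t => Q (u t)) 0 (Icc 0 T) t := by
    intro t ht
    have := Q.hasFDerivAt.comp_hasDerivWithinAt t (hu t ht)
    rwa [hQ] at this
  have h2 := (convex_Icc 0 T).norm_image_sub_le_of_norm_hasDerivWithin_le (C := 0) h1 (by simp)
    (left_mem_Icc.2 (ht.1.trans ht.2)) ht
  rw [h0] at h2
  simpa using h2

/-- The mean value inequality for `τ ↦ f n τ - τ • G t` on a small convex neighbourhood inside the
interval gives a difference quotient bound independent of `n`, which survives the limit. End points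
are included. -/
theorem hasDerivWithinAt_of_tendstoUniformlyOn {f g : ℕ → ℝ → E} {F G : ℝ → E} {T : ℝ}
    (hf : ∀ n, ∀ t ∈ Icc 0 T, HasDerivWithinAt (f n) (g n t) (Icc 0 T) t)
    (hF : ∀ t ∈ Icc 0 T, Tendsto (fun n => f n t) atTop (𝓝 (F t)))
    (hg : TendstoUniformlyOn g G atTop (Icc 0 T)) (hG : ContinuousOn G (Icc 0 T)) :
    ∀ t ∈ Icc 0 T, HasDerivWithinAt F (G t) (Icc 0 T) t := by
  intro t ht
  rw [hasDerivWithinAt_iff_isLittleO, Asymptotics.isLittleO_iff]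
  intro ε hε
  rw [Metric.tendstoUniformlyOn_iff] at hg
  obtain ⟨δ, hδ, hδG⟩ := Metric.continuousWithinAt_iff.1 (hG t ht) (ε / 2) (by positivity)
  filter_upwards [inter_mem self_mem_nhdsWithin (mem_nhdsWithin_of_mem_nhds
    (Metric.ball_mem_nhds t hδ))] with y hy
  have key : ∀ᶠ n in atTop, ‖f n y - f n t - (y - t) • G t‖ ≤ ε * ‖y - t‖ := by
    filter_upwards [hg (ε / 2) (by positivity)] with n hn
    have hc : Convex ℝ (Icc 0 T ∩ Metric.ball t δ) := (convex_Icc 0 T).inter (convex_ball t δ)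
    have h1 : ∀ τ ∈ Icc 0 T ∩ Metric.ball t δ, HasDerivWithinAt (fun τ => f n τ - τ • G t)
        (g n τ - G t) (Icc 0 T ∩ Metric.ball t δ) τ := by
      intro τ hτ
      have := ((hf n τ hτ.1).mono inter_subset_left).sub
        (((hasDerivAt_id τ).smul_const (G t)).hasDerivWithinAt (s := Icc 0 T ∩ Metric.ball t δ))
      exact HasDerivWithinAt.congr_deriv this (by simp)
    have h2 : ∀ τ ∈ Icc 0 T ∩ Metric.ball t δ, ‖g n τ - G t‖ ≤ ε := by
      intro τ hτ
      have e1 := hn τ hτ.1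
      have e2 := hδG hτ.1 hτ.2
      rw [dist_comm] at e1
      rw [← dist_eq_norm]
      linarith [dist_triangle (g n τ) (G τ) (G t)]
    have h3 := hc.norm_image_sub_le_of_norm_hasDerivWithin_le h1 h2
      ⟨ht, Metric.mem_ball_self hδ⟩ hy
    rw [sub_smul]
    convert! h3 using 2
    abel
  have hlim : Tendsto (fun n => ‖f n y - f n t - (y - t) • G t‖) atTop
      (𝓝 ‖F y - F t - (y - t) • G t‖) :=
    (((hF y hy.1).sub (hF t ht)).sub_const _).norm
  exact le_of_tendsto hlim key

/-- The radial retraction onto the ball of radius `K`. -/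
def retr (K : ℝ) (x : E) : E := (K / max K ‖x‖) • x

theorem norm_retr_le {K : ℝ} (hK : 0 < K) (x : E) : ‖retr K x‖ ≤ K := by
  have h : 0 < max K ‖x‖ := hK.trans_le (le_max_left _ _)
  rw [retr, norm_smul, Real.norm_of_nonneg (by positivity), div_mul_eq_mul_div, div_le_iff₀ h]
  exact mul_le_mul_of_nonneg_left (le_max_right _ _) hK.le

theorem norm_retr_sub_le {K : ℝ} (hK : 0 < K) (x y : E) :
    ‖retr K x - retr K y‖ ≤ 2 * ‖x - y‖ := by
  have hx : 0 < max K ‖x‖ := hK.trans_le (le_max_left _ _)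
  have hy : 0 < max K ‖y‖ := hK.trans_le (le_max_left _ _)
  have e : retr K x - retr K y =
      (K / max K ‖x‖) • (x - y) + (K / max K ‖x‖ - K / max K ‖y‖) • y := by
    simp only [retr, smul_sub, sub_smul]; abel
  rw [e, two_mul]
  refine (norm_add_le _ _).trans (add_le_add ?_ ?_)
  · rw [norm_smul, Real.norm_of_nonneg (by positivity)]
    refine mul_le_of_le_one_left (norm_nonneg _) ?_
    rw [div_le_one hx]
    exact le_max_left _ _
  · rw [norm_smul, div_sub_div _ _ hx.ne' hy.ne', Real.norm_eq_abs, abs_div,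
      abs_of_pos (mul_pos hx hy), div_mul_eq_mul_div, div_le_iff₀ (mul_pos hx hy)]
    have h1 : |K * max K ‖y‖ - max K ‖x‖ * K| ≤ K * ‖x - y‖ := by
      rw [mul_comm _ K, ← mul_sub, abs_mul, abs_of_pos hK]
      refine mul_le_mul_of_nonneg_left ?_ hK.le
      rw [max_comm K, max_comm K]
      refine (abs_max_sub_max_le_abs _ _ _).trans ?_
      rw [norm_sub_rev x y]
      exact abs_norm_sub_norm_le y x
    have h2 : K * ‖y‖ ≤ max K ‖x‖ * max K ‖y‖ := by gcongr <;> simp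
    calc _ ≤ K * ‖x - y‖ * ‖y‖ := by gcongr
      _ = ‖x - y‖ * (K * ‖y‖) := by ring
      _ ≤ _ := by gcongr

end ODE

/-! ### Galerkin approximations and the stability estimate. -/

section Galerkin

variable {G : Type*} [MeasurableSpace G] {μ : Measure G}

theorem real_smul_eq (c : ℝ) (f : Lp ℂ 2 μ) : c • f = (c : ℂ) • f := by
  ext1
  filter_upwards [Lp.coeFn_smul c f, Lp.coeFn_smul (c : ℂ) f] with x h1 h2
  rw [h1, h2, Pi.smul_apply, Pi.smul_apply, Complex.coe_smul]

theorem re_inner_eq (f g : Lp ℂ 2 μ) : (inner ℂ f g).re = inner ℝ f g := by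
  rw [L2.inner_def, L2.inner_def]
  have := integral_re (L2.integrable_inner (𝕜 := ℂ) f g)
  exact this.symm

theorem hasDerivWithinAt_norm_sq {z : ℝ → Lp ℂ 2 μ} {z' : Lp ℂ 2 μ} {s : Set ℝ} {t : ℝ}
    (h : HasDerivWithinAt z z' s t) (L : Lp ℂ 2 μ →L[ℂ] Lp ℂ 2 μ) :
    HasDerivWithinAt (fun t => ‖L (z t)‖ ^ 2) (2 * (inner ℂ (L (z t)) (L z')).re) s t := by
  have h1 := ((L.restrictScalars ℝ).hasFDerivAt (x := z t)).comp_hasDerivWithinAt t h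
  rw [re_inner_eq]
  exact h1.norm_sq

/-- Dominated convergence, with `‖g‖²` as the dominating function. -/
theorem tendsto_eLpNorm_smul_zero {g : G → ℂ} (hg : MemLp g 2 μ) {w : ℕ → G → ℝ}
    (hm : ∀ n, Measurable (w n)) (h1 : ∀ n x, |w n x| ≤ 1)
    (h0 : ∀ x, Tendsto (fun n => w n x) atTop (𝓝 0)) :
    Tendsto (fun n => eLpNorm (fun x => w n x • g x) 2 μ) atTop (𝓝 0) := by
  simp_rw [eLpNorm_two_eq]
  have hfin : ∫⁻ x, ‖g x‖ₑ ^ 2 ∂μ ≠ ∞ := by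
    have := (eLpNorm_lt_top_iff_lintegral_rpow_enorm_lt_top (p := 2) (by norm_num) (by norm_num)).1
      hg.2
    simpa using this.ne
  have h := tendsto_lintegral_of_dominated_convergence' (μ := μ)
    (F := fun n x => ‖w n x • g x‖ₑ ^ 2) (f := fun _ => 0) (fun x => ‖g x‖ₑ ^ 2)
    (fun n => (((hm n).aestronglyMeasurable.smul hg.1).enorm.pow_const 2))
    (fun n => ae_of_all _ fun x => by
      refine pow_le_pow_left' ?_ 2
      rw [← ofReal_norm, ← ofReal_norm, norm_smul]
      exact ENNReal.ofReal_le_ofReal (mul_le_of_le_one_left (norm_nonneg _) (h1 n x)))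
    hfin (ae_of_all _ fun x => by
      have h2 : Tendsto (fun n => w n x • g x) atTop (𝓝 ((0 : ℝ) • g x)) := (h0 x).smul_const _
      rw [zero_smul] at h2
      have := ENNReal.Tendsto.pow (n := 2) h2.enorm
      simpa using this)
  have h3 := h.ennrpow_const (1 / 2 : ℝ)
  simpa using h3

variable [AddCommGroup G] [MeasurableAdd₂ G] [MeasurableNeg G] [SFinite μ] [μ.IsAddLeftInvariant]
  [μ.IsNegInvariant] {b : Bracket μ} (S : BurgersSymbol b) (Ω : TransportSymbol b) {s : ℕ}

theorem tendsto_cutL (f : Lp ℂ 2 μ) :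
    Tendsto (fun n : ℕ => cutL b ((n : ℝ) + 1) f) atTop (𝓝 f) := by
  rw [tendsto_iff_norm_sub_tendsto_zero]
  have h := tendsto_eLpNorm_smul_zero (μ := μ) (Lp.memLp f)
    (w := fun n x => radMul b (fun r => r ^ 0) ((n : ℝ) + 1) x - 1)
    (fun n => (measurable_radMul b (measurable_id.pow_const 0) _).sub_const 1)
    (fun n x => by unfold radMul; split_ifs <;> simp) (fun x => by
      refine tendsto_const_nhds.congr' ?_
      obtain ⟨N, hN⟩ := exists_nat_ge (b x)
      filter_upwards [eventually_ge_atTop N] with n hn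
      have : b x ≤ (n : ℝ) + 1 := by
        have : (N : ℝ) ≤ n := by exact_mod_cast hn
        linarith
      simp [radMul, this])
  have e : ∀ n : ℕ, ‖cutL b ((n : ℝ) + 1) f - f‖ = (eLpNorm (fun x =>
      (radMul b (fun r => r ^ 0) ((n : ℝ) + 1) x - 1) • f x) 2 μ).toReal := by
    intro n
    rw [Lp.norm_def]
    congr 1
    refine eLpNorm_congr_ae ?_
    filter_upwards [Lp.coeFn_sub (cutL b ((n : ℝ) + 1) f) f,
      coeFn_radL b (isWeight_pow 0) ((n : ℝ) + 1) f] with x h1 h2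
    rw [h1, Pi.sub_apply, cutL, h2, Complex.real_smul]
    push_cast; ring
  simp_rw [e]
  exact (ENNReal.tendsto_toReal ENNReal.zero_ne_top).comp h

/-- The stability estimate for the difference of two solutions. -/
theorem abs_re_inner_sub_le (hs : S.M + b.σ ≤ s) {h : Lp ℂ 2 μ} (hh : IsReal h) (h' : Lp ℂ 2 μ) :
    |2 * (inner ℂ (lowerL b s (h - h')) (Ω.transL s (h - h') +
      (S.bilL hs h h - S.bilL hs h' h'))).re| ≤
      8 * S.A * b.embConst.toReal * (‖h‖ + ‖h'‖) * ‖lowerL b s (h - h')‖ ^ 2 := by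
  have hs1 : 1 ≤ s := by have := S.one_le_M; omega
  set k := h - h' with hk
  -- This splitting keeps the derivative off the difference `k` as far as possible: in `B(h, k)` it
  -- is removed by the energy estimate, as `h` is real, and in `B(k, h')` the whole loss is on `h'`.
  have e : S.bilL hs h h - S.bilL hs h' h' = S.bilL hs h k + S.bilL hs k h' := by
    rw [hk, map_sub, map_sub]; simp
  have hA : 0 ≤ S.A * b.embConst.toReal := mul_nonneg S.A_nonneg ENNReal.toReal_nonneg
  rw [e, inner_add_right, inner_add_right, Complex.add_re, Complex.add_re,
    Ω.re_inner_transL hs1, zero_add, mul_add]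
  refine (abs_add_le _ _).trans ?_
  have e1 := S.abs_re_inner_bilL_le hs hh k
  have e2 : |2 * (inner ℂ (lowerL b s k) (S.bilL hs k h')).re| ≤
      8 * S.A * b.embConst.toReal * ‖h'‖ * ‖lowerL b s k‖ ^ 2 := by
    rw [abs_mul, abs_two]
    have h1 := (Complex.abs_re_le_norm _).trans (norm_inner_le_norm (𝕜 := ℂ) (lowerL b s k)
      (S.bilL hs k h'))
    have h2 := mul_le_mul_of_nonneg_left (S.norm_bilL_le hs k h') (norm_nonneg (lowerL b s k))
    nlinarith
  have e3 : 5 * S.A * b.embConst.toReal * ‖h‖ * ‖lowerL b s k‖ ^ 2 ≤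
      8 * S.A * b.embConst.toReal * ‖h‖ * ‖lowerL b s k‖ ^ 2 := by
    have : 0 ≤ S.A * b.embConst.toReal * (‖h‖ * ‖lowerL b s k‖ ^ 2) := by positivity
    nlinarith
  linarith

/-- Solutions of the Galerkin system with a cut off nonlinearity. -/
theorem exists_galerkin (hs : S.M + b.σ ≤ s) {n K T : ℝ} (hn : 1 ≤ n) (hK : 0 < K) (hT : 0 ≤ T)
    {u₀ : Lp ℂ 2 μ} (h0 : IsReal u₀) (hc : cutL b n u₀ = u₀) :
    ∃ u : ℝ → Lp ℂ 2 μ, u 0 = u₀ ∧ ∀ t ∈ Icc 0 T, IsReal (u t) ∧ cutL b n (u t) = u t ∧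
      ∃ l : ℝ, 0 ≤ l ∧ l ≤ 1 ∧ l * ‖raiseL b s n (u t)‖ ≤ K ∧
        (‖raiseL b s n (u t)‖ ≤ K → l = 1) ∧
        HasDerivWithinAt u (-(l • Ω.transL s (raiseL b s n (u t))) -
          l ^ 2 • cutL b n (S.bilL hs (raiseL b s n (u t)) (raiseL b s n (u t)))) (Icc 0 T) t := by
  have hs1 : 1 ≤ s := by have := S.one_le_M; omega
  -- The retraction makes the field bounded and globally Lipschitz. The projection `realL` makes the
  -- field take real values everywhere, so that reality of the data is conserved; it then acts
  -- trivially along the solution.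
  set r : Lp ℂ 2 μ → Lp ℂ 2 μ := fun u => retr K (raiseL b s n (realL μ u)) with hr
  set V : Lp ℂ 2 μ → Lp ℂ 2 μ := fun u =>
    -(Ω.transL s (r u)) - cutL b n (S.bilL hs (r u) (r u)) with hV
  have hrK : ∀ u, ‖r u‖ ≤ K := fun u => norm_retr_le hK _
  have hn0 : 0 ≤ n ^ s := by positivity
  have hrL : ∀ u v, ‖r u - r v‖ ≤ 2 * n ^ s * ‖u - v‖ := by
    intro u v
    refine (norm_retr_sub_le hK _ _).trans ?_
    rw [← map_sub, ← map_sub, mul_assoc]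
    refine mul_le_mul_of_nonneg_left ?_ zero_le_two
    exact (norm_radL_le b (isWeight_pow s) hn _).trans
      (mul_le_mul_of_nonneg_left (norm_realL_le _) hn0)
  have hVL : ∀ u v, dist (V u) (V v) ≤ ((‖Ω.transL (μ := μ) s‖ + 2 * ‖S.bilL hs‖ * K) * (2 * n ^ s)) *
      dist u v := by
    intro u v
    have e : V u - V v = -(Ω.transL s (r u - r v)) -
        cutL b n (S.bilL hs (r u - r v) (r u) + S.bilL hs (r v) (r u - r v)) := by
      simp only [hV, map_sub, map_add, sub_apply]
      abel
    rw [dist_eq_norm, dist_eq_norm, e]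
    have t1 := (Ω.transL (μ := μ) s).le_opNorm (r u - r v)
    have t2 := (S.bilL hs).le_opNorm₂ (r u - r v) (r u)
    have t3 := (S.bilL hs).le_opNorm₂ (r v) (r u - r v)
    have t4 := norm_cutL_le b hn (S.bilL hs (r u - r v) (r u) + S.bilL hs (r v) (r u - r v))
    have t5 := norm_add_le (S.bilL hs (r u - r v) (r u)) (S.bilL hs (r v) (r u - r v))
    have t6 := norm_sub_le (-(Ω.transL s (r u - r v)))
      (cutL b n (S.bilL hs (r u - r v) (r u) + S.bilL hs (r v) (r u - r v)))
    rw [norm_neg] at t6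
    have t7 : ‖S.bilL hs‖ * ‖r u - r v‖ * ‖r u‖ ≤ ‖S.bilL hs‖ * ‖r u - r v‖ * K := by
      gcongr; exact hrK u
    have t8 : ‖S.bilL hs‖ * ‖r v‖ * ‖r u - r v‖ ≤ ‖S.bilL hs‖ * K * ‖r u - r v‖ := by
      gcongr; exact hrK v
    calc _ ≤ (‖Ω.transL (μ := μ) s‖ + 2 * ‖S.bilL hs‖ * K) * ‖r u - r v‖ := by linarith
      _ ≤ (‖Ω.transL (μ := μ) s‖ + 2 * ‖S.bilL hs‖ * K) * (2 * n ^ s * ‖u - v‖) := by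
        gcongr; exact hrL u v
      _ = _ := by ring
  have hVb : ∀ u, ‖V u‖ ≤ ‖Ω.transL (μ := μ) s‖ * K + ‖S.bilL hs‖ * K * K := by
    intro u
    refine (norm_sub_le _ _).trans (add_le_add ?_ ?_)
    · rw [norm_neg]
      exact ((Ω.transL s).le_opNorm _).trans (by gcongr; exact hrK u)
    · refine (norm_cutL_le b hn _).trans (((S.bilL hs).le_opNorm₂ _ _).trans ?_)
      have := hrK u
      gcongr
  obtain ⟨u, hu0, hu⟩ := exists_solution_of_lipschitz hT (LipschitzWith.of_dist_le' hVL) hVb u₀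
  have hrr : ∀ x, IsReal (r x) := fun x =>
    ((isReal_realL x).radL b (isWeight_pow s) n).smul _
  have hVr : ∀ x, IsReal (V x) := by
    intro x
    have h1 := (Ω.isReal_transL hs1 (hrr x)).neg
    have h2 := ((S.isReal_bilL hs (hrr x) (hrr x)).radL b (isWeight_pow 0) n).neg
    have h3 := h1.add h2
    rwa [← sub_eq_add_neg] at h3
  have hreal : ∀ t ∈ Icc 0 T, IsReal (u t) := by
    intro t ht
    have := eq_zero_of_hasDerivWithinAt hu (conjL μ - ContinuousLinearMap.id ℝ _)
      (fun x => by simp [isReal_iff.1 (hVr x)]) (by simp [hu0, isReal_iff.1 h0]) t ht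
    rw [isReal_iff]
    simpa [sub_eq_zero] using this
  have hVc : ∀ x, cutL b n (V x) = V x := by
    intro x
    simp only [hV, map_sub, map_neg, cutL_cutL]
    congr 2
    simp only [hr, retr]
    rw [ContinuousLinearMap.map_smul_of_tower, ContinuousLinearMap.map_smul_of_tower,
      TransportSymbol.transL, cutL_mulL b (Ω.isBdd hs1), raiseL, cutL_radL b (isWeight_pow s)]
  have hcut : ∀ t ∈ Icc 0 T, cutL b n (u t) = u t := by
    intro t ht
    have := eq_zero_of_hasDerivWithinAt hu
      ((cutL b n).restrictScalars ℝ - ContinuousLinearMap.id ℝ _)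
      (fun x => by simp [hVc x]) (by simp [hu0, hc]) t ht
    simpa [sub_eq_zero] using this
  refine ⟨u, hu0, fun t ht => ⟨hreal t ht, hcut t ht, ?_⟩⟩
  set x := raiseL b s n (u t) with hx
  have hm : 0 < max K ‖x‖ := hK.trans_le (le_max_left _ _)
  -- The number `l` is the factor of the radial retraction; it equals `1` exactly while the
  -- retraction is inactive.
  refine ⟨K / max K ‖x‖, by positivity, (div_le_one hm).2 (le_max_left _ _), ?_, ?_, ?_⟩
  · rw [div_mul_eq_mul_div, div_le_iff₀ hm]
    exact mul_le_mul_of_nonneg_left (le_max_right _ _) hK.le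
  · intro h
    rw [max_eq_left h, div_self hK.ne']
  · have h1 := hu t ht
    have h2 : r (u t) = (K / max K ‖x‖) • x := by
      simp only [hr, (hreal t ht).realL_eq, retr, hx]
    have h3 : S.bilL hs ((K / max K ‖x‖) • x) ((K / max K ‖x‖) • x) =
        (K / max K ‖x‖) ^ 2 • S.bilL hs x x := by
      simp only [real_smul_eq, map_smul, smul_apply, smul_smul]
      push_cast; rw [sq]
    convert! h1 using 1
    simp only [hV, h2]
    rw [h3, ContinuousLinearMap.map_smul_of_tower, ContinuousLinearMap.map_smul_of_tower]

/-- The growth rate in weighted energy estimates. -/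
def BurgersSymbol.rate (S : BurgersSymbol b) (p : ℕ) (K : ℝ) : ℝ :=
  2 * (S.A * (1 + 4 * 2 ^ p)) * b.embConst.toReal * K + 1

theorem BurgersSymbol.rate_pos (S : BurgersSymbol b) (p : ℕ) {K : ℝ} (hK : 0 ≤ K) :
    0 < S.rate p K := by
  have := S.A_nonneg
  unfold BurgersSymbol.rate
  positivity

/-- Galerkin approximations, on a time interval depending only on the size of the data, with
uniform weighted estimates. -/
theorem exists_galerkin_uniform (hs : S.M + b.σ ≤ s) {n R T : ℝ} (hn : 1 ≤ n) (hR : 0 < R)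
    (hT : T = Real.log 4 / S.rate s (2 * R)) {h₀ : Lp ℂ 2 μ} (h0 : IsReal h₀) (h0R : ‖h₀‖ ≤ R) :
    ∃ u : ℝ → Lp ℂ 2 μ, u 0 = cutL b n (lowerL b s h₀) ∧ ∀ t ∈ Icc 0 T, IsReal (u t) ∧
      cutL b n (u t) = u t ∧ ‖raiseL b s n (u t)‖ ≤ 2 * R ∧
      HasDerivWithinAt u (-(Ω.transL s (raiseL b s n (u t))) -
          cutL b n (S.bilL hs (raiseL b s n (u t)) (raiseL b s n (u t)))) (Icc 0 T) t ∧
      ∀ p φ, IsWeight p φ → ‖radL b φ n (u t)‖ ^ 2 ≤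
        ‖radL b φ n (lowerL b s h₀)‖ ^ 2 * Real.exp (S.rate p (2 * R) * T) := by
  have hs1 : 1 ≤ s := by have := S.one_le_M; omega
  have hrate := S.rate_pos s (K := 2 * R) (by positivity)
  have hT0 : 0 ≤ T := hT ▸ div_nonneg (Real.log_nonneg (by norm_num)) hrate.le
  obtain ⟨u, hu0, hu⟩ := exists_galerkin S Ω hs hn (K := 2 * R) (by positivity) hT0
    (u₀ := cutL b n (lowerL b s h₀)) ((h0.lowerL b s).radL b (isWeight_pow 0) n)
    (cutL_cutL b n _)
  have hw : ∀ t ∈ Icc 0 T, ∀ p φ, IsWeight p φ → ‖radL b φ n (u t)‖ ^ 2 ≤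
        ‖radL b φ n (lowerL b s h₀)‖ ^ 2 * Real.exp (S.rate p (2 * R) * t) := by
    intro t ht p φ hφ
    choose hr hc l hl0 hl1 hlK _ hd using hu
    have := le_mul_exp_of_deriv_le (S.rate_pos p (K := 2 * R) (by positivity)) le_rfl
      (fun t ht => ⟨_, hasDerivWithinAt_norm_sq (hd t ht) (radL b φ n), ?_⟩) t ht
    · rw [hu0, zero_div, add_zero, radL_cutL b hφ] at this
      exact this
    set x := raiseL b s n (u t) with hx
    rw [map_sub, map_neg, ContinuousLinearMap.map_smul_of_tower,
      ContinuousLinearMap.map_smul_of_tower, radL_cutL b hφ, inner_sub_right, inner_neg_right,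
      Complex.sub_re, Complex.neg_re, real_smul_eq, real_smul_eq, inner_smul_right,
      inner_smul_right, Complex.re_ofReal_mul, Complex.re_ofReal_mul,
      Ω.re_inner_radL_transL hs1 hφ, mul_zero, neg_zero, zero_sub]
    have e := S.abs_re_inner_radL_bilL_le hs hφ hn (hr t ht)
    rw [← hx] at e
    set q := (inner ℂ (radL b φ n (u t)) (radL b φ n (S.bilL hs x x))).re with hq
    have e1 : -(2 * q) ≤ |2 * q| := neg_le_abs _
    have l0 := hl0 t ht
    have l1 := hl1 t ht
    have lK := hlK t ht
    -- From `l ≤ 1` and `l ‖x‖ ≤ 2R`. The growth rate is thus available before the retraction is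
    -- known to be inactive, and no continuation argument is needed.
    have h2 : l t ht ^ 2 * ‖x‖ ≤ 2 * R := by
      rw [← hx] at lK
      nlinarith [mul_nonneg l0 (norm_nonneg x)]
    have hA : 0 ≤ 2 * (S.A * (1 + 4 * 2 ^ p)) * b.embConst.toReal := by
      have := S.A_nonneg
      positivity
    calc 2 * -(l t ht ^ 2 * q) = l t ht ^ 2 * -(2 * q) := by ring
      _ ≤ l t ht ^ 2 * (2 * (S.A * (1 + 4 * 2 ^ p)) * b.embConst.toReal * ‖x‖ *
          ‖radL b φ n (u t)‖ ^ 2) := by gcongr; exact e1.trans e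
      _ = 2 * (S.A * (1 + 4 * 2 ^ p)) * b.embConst.toReal * (l t ht ^ 2 * ‖x‖) *
          ‖radL b φ n (u t)‖ ^ 2 := by ring
      _ ≤ 2 * (S.A * (1 + 4 * 2 ^ p)) * b.embConst.toReal * (2 * R) *
          ‖radL b φ n (u t)‖ ^ 2 := by gcongr
      _ ≤ _ := by
        unfold BurgersSymbol.rate
        nlinarith [sq_nonneg ‖radL b φ n (u t)‖]
  have hbound : ∀ t ∈ Icc 0 T, ‖raiseL b s n (u t)‖ ≤ 2 * R := by
    intro t ht
    have h1 := hw t ht s _ (isWeight_pow s)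
    have h2 : radL b (fun r => r ^ s) n (lowerL b s h₀) = cutL b n h₀ := raiseL_lowerL b s n h₀
    rw [h2] at h1
    -- The choice of `T`: the squared base norm grows at most by a factor `4` on the interval, so
    -- the norm stays below `2R` and the retraction is never active.
    have h3 : Real.exp (S.rate s (2 * R) * t) ≤ 4 := by
      rw [← Real.exp_log (show (0 : ℝ) < 4 by norm_num), Real.exp_le_exp]
      have := mul_le_mul_of_nonneg_left ht.2 hrate.le
      rwa [hT, mul_div_cancel₀ _ hrate.ne'] at this
    have h4 : ‖cutL b n h₀‖ ≤ R := (norm_cutL_le b hn _).trans h0R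
    refine abs_le_of_sq_le_sq' (b := 2 * R) ?_ (by positivity) |>.2
    calc _ ≤ ‖cutL b n h₀‖ ^ 2 * Real.exp (S.rate s (2 * R) * t) := h1
      _ ≤ R ^ 2 * 4 := by gcongr
      _ = _ := by ring
  refine ⟨u, hu0, fun t ht => ⟨(hu t ht).1, (hu t ht).2.1, hbound t ht, ?_, fun p φ hφ => ?_⟩⟩
  · obtain ⟨l, _, _, _, hl, hd⟩ := (hu t ht).2.2
    rw [hl (hbound t ht)] at hd
    simpa using hd
  · refine (hw t ht p φ hφ).trans (mul_le_mul_of_nonneg_left ?_ (sq_nonneg _))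
    rw [Real.exp_le_exp]
    exact mul_le_mul_of_nonneg_left ht.2 (S.rate_pos p (by positivity)).le

end Galerkin

/-! ### Well-posedness on the Fourier side -/

section WellPosed

variable {G : Type*} [MeasurableSpace G] {μ : Measure G} [AddCommGroup G] [MeasurableAdd₂ G]
  [MeasurableNeg G] [SFinite μ] [μ.IsAddLeftInvariant] [μ.IsNegInvariant] {b : Bracket μ}
  (S : BurgersSymbol b) (Ω : TransportSymbol b) {s : ℕ}

theorem norm_sub_cutL_le_norm (n : ℝ) (f : Lp ℂ 2 μ) : ‖f - cutL b n f‖ ≤ ‖f‖ := by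
  refine Lp.norm_le_norm_of_ae_le ?_
  filter_upwards [Lp.coeFn_sub f (cutL b n f), coeFn_radL b (isWeight_pow 0) n f] with x h1 h2
  rw [h1, Pi.sub_apply, cutL, h2]
  unfold radMul
  split_ifs <;> simp

/-- Interpolation between low frequencies, controlled in `L²`, and high frequencies. -/
theorem norm_raiseL_sub_le {n m r : ℝ} (hr : 1 ≤ r) {u v : Lp ℂ 2 μ} (hu : cutL b n u = u)
    (hv : cutL b m v = v) : ‖raiseL b s n u - raiseL b s m v‖ ≤ r ^ s * ‖u - v‖ +
      (‖radL b (fun q => q ^ s * min 1 (q / r)) n u‖ +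
        ‖radL b (fun q => q ^ s * min 1 (q / r)) m v‖) := by
  set φ : ℝ → ℝ := fun q => q ^ s * min 1 (q / r) with hφ
  have hφw : IsWeight (s + 1) φ := isWeight_pow_mul_min s (by linarith)
  -- Where `b ≤ r` the first term is everything; where `b > r` the factor `min 1 (b/r)` equals `1`,
  -- so `φ(b)` coincides with `b^s`.
  have e : raiseL b s n u - raiseL b s m v = radL b (fun q => q ^ s) r (u - v) +
      ((radL b φ n u - radL b φ m v) - cutL b r (radL b φ n u - radL b φ m v)) := by
    ext1
    have c1 := coeFn_radL b (isWeight_pow 0) n u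
    have c2 := coeFn_radL b (isWeight_pow 0) m v
    rw [← cutL, hu] at c1
    rw [← cutL, hv] at c2
    filter_upwards [c1, c2, Lp.coeFn_sub (raiseL b s n u) (raiseL b s m v),
      coeFn_radL b (isWeight_pow s) n u, coeFn_radL b (isWeight_pow s) m v,
      Lp.coeFn_add (radL b (fun q => q ^ s) r (u - v))
        ((radL b φ n u - radL b φ m v) - cutL b r (radL b φ n u - radL b φ m v)),
      coeFn_radL b (isWeight_pow s) r (u - v), Lp.coeFn_sub u v,
      Lp.coeFn_sub (radL b φ n u - radL b φ m v) (cutL b r (radL b φ n u - radL b φ m v)),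
      Lp.coeFn_sub (radL b φ n u) (radL b φ m v), coeFn_radL b hφw n u, coeFn_radL b hφw m v,
      coeFn_radL b (isWeight_pow 0) r (radL b φ n u - radL b φ m v)]
      with x h1 h2 h3 h4 h5 h6 h7 h8 h9 h10 h11 h12 h13
    rw [h3, h6, Pi.sub_apply, Pi.add_apply, h9, Pi.sub_apply, cutL, h13, h10, Pi.sub_apply, h7, h8,
      Pi.sub_apply, h11, h12, raiseL, raiseL, h4, h5]
    by_cases hx : b x ≤ r
    · have e1 : (radMul b (fun q => q ^ s) n x : ℂ) * u x = (b x ^ s : ℝ) * u x := by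
        rw [h1]; unfold radMul; split_ifs <;> simp
      have e2 : (radMul b (fun q => q ^ s) m x : ℂ) * v x = (b x ^ s : ℝ) * v x := by
        rw [h2]; unfold radMul; split_ifs <;> simp
      have e3 : radMul b (fun q => q ^ s) r x = b x ^ s := by simp [radMul, hx]
      have e4 : radMul b (fun q => q ^ 0) r x = 1 := by simp [radMul, hx]
      rw [e1, e2, e3, e4]
      push_cast; ring
    · have e3 : radMul b (fun q => q ^ s) r x = 0 := by simp [radMul, hx]
      have e4 : radMul b (fun q => q ^ 0) r x = 0 := by simp [radMul, hx]
      have e5 : min 1 (b x / r) = 1 :=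
        min_eq_left ((one_le_div (by linarith)).2 (not_le.1 hx).le)
      have e6 : ∀ k, radMul b φ k x = radMul b (fun q => q ^ s) k x := by
        intro k; simp only [radMul, hφ, e5, mul_one]
      rw [e3, e4, e6, e6]
      simp
  rw [e]
  refine (norm_add_le _ _).trans (add_le_add (norm_radL_le b (isWeight_pow s) hr _) ?_)
  exact (norm_sub_cutL_le_norm r _).trans (norm_sub_le _ _)

/-- Weighted norms of functions divided by a power of the bracket. -/
def wnorm (b : Bracket μ) (s : ℕ) (φ : ℝ → ℝ) (h : Lp ℂ 2 μ) : ℝ≥0∞ :=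
  eLpNorm (fun x => φ (b x) • lower b s h x) 2 μ

theorem enorm_radL_lowerL_le {p : ℕ} {φ : ℝ → ℝ} (hφ : IsWeight p φ) (n : ℝ) (h : Lp ℂ 2 μ) :
    ‖radL b φ n (lowerL b s h)‖ₑ ≤ wnorm b s φ h := by
  rw [Lp.enorm_def]
  refine eLpNorm_mono_ae ?_
  filter_upwards [coeFn_radL b hφ n (lowerL b s h), coeFn_lowerL b s h] with x h1 h2
  rw [h1, h2, norm_mul, norm_smul, Complex.norm_real]
  unfold radMul
  split_ifs
  · exact le_rfl
  · rw [norm_zero, zero_mul]; positivity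

/-- Fatou's lemma along the truncations `b ≤ n + 1`, which eventually contain any given frequency.
This transfers bounds on truncated functions to the possibly infinite weighted norm. -/
theorem wnorm_le_of_forall {p : ℕ} {φ : ℝ → ℝ} (hφ : IsWeight p φ) (h : Lp ℂ 2 μ) {C : ℝ≥0∞}
    (hC : ∀ n : ℕ, ‖radL b φ ((n : ℝ) + 1) (lowerL b s h)‖ₑ ≤ C) : wnorm b s φ h ≤ C := by
  have h1 : eLpNorm (fun x => φ (b x) • lower b s h x) 2 μ ≤
      liminf (fun n : ℕ => eLpNorm (radL b φ ((n : ℝ) + 1) (lowerL b s h)) 2 μ) atTop := by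
    refine Lp.eLpNorm_lim_le_liminf_eLpNorm (fun n => Lp.aestronglyMeasurable _) _ ?_
    have h2 : ∀ᵐ x ∂μ, ∀ n : ℕ, radL b φ ((n : ℝ) + 1) (lowerL b s h) x =
        (radMul b φ ((n : ℝ) + 1) x : ℂ) * lowerL b s h x :=
      ae_all_iff.2 fun n => coeFn_radL b hφ _ _
    filter_upwards [h2, coeFn_lowerL b s h] with x h2 h3
    refine tendsto_const_nhds.congr' ?_
    obtain ⟨N, hN⟩ := exists_nat_ge (b x)
    filter_upwards [eventually_ge_atTop N] with n hn
    have : b x ≤ (n : ℝ) + 1 := by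
      have : (N : ℝ) ≤ n := by exact_mod_cast hn
      linarith
    rw [h2, h3, radMul, if_pos this, Complex.real_smul]
  refine h1.trans (liminf_le_of_le (by isBoundedDefault) fun c hc => ?_)
  obtain ⟨n, hn⟩ := hc.exists
  rw [← Lp.enorm_def] at hn
  exact hn.trans (hC n)

theorem norm_radL_le_of_le {p : ℕ} {φ : ℝ → ℝ} (hφ : IsWeight p φ) {m n : ℝ} (hmn : m ≤ n)
    (f : Lp ℂ 2 μ) : ‖radL b φ m f‖ ≤ ‖radL b φ n f‖ := by
  refine norm_mulL_mono (isBdd_radMul b hφ m) (isBdd_radMul b hφ n) (fun x => ?_) f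
  rw [Complex.norm_real, Complex.norm_real, Real.norm_of_nonneg (radMul_nonneg b hφ m x),
    Real.norm_of_nonneg (radMul_nonneg b hφ n x)]
  unfold radMul
  split_ifs with h1 h2 h2
  · exact le_rfl
  · exact absurd (h1.trans hmn) h2
  · exact hφ.nonneg _ (b.one_le x)
  · exact le_rfl

/-- Truncated weights detect high frequencies. -/
theorem tendsto_eLpNorm_min {g : G → ℂ} (hg : MemLp g 2 μ) :
    Tendsto (fun r : ℕ => eLpNorm (fun x => min 1 (b x / ((r : ℝ) + 1)) • g x) 2 μ) atTop (𝓝 0) := by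
  refine tendsto_eLpNorm_smul_zero hg (fun r => measurable_const.min (b.measurable.div_const _))
    (fun r x => ?_) fun x => ?_
  · have := b.nonneg x
    rw [abs_of_nonneg (by positivity)]
    exact min_le_left _ _
  · have h1 : Tendsto (fun r : ℕ => b x / ((r : ℝ) + 1)) atTop (𝓝 0) :=
      tendsto_const_nhds.div_atTop
        (tendsto_atTop_add_const_right _ _ tendsto_natCast_atTop_atTop)
    have h2 := (tendsto_const_nhds (x := (1 : ℝ))).min h1
    simpa using h2

theorem wnorm_pow_mul_min (ν : ℕ) (r : ℝ) (h : Lp ℂ 2 μ) :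
    wnorm b s (fun q => q ^ ν * min 1 (q / r)) h =
      eLpNorm (fun x => min 1 (b x / r) • ((b x ^ ν) • lower b s h x)) 2 μ := by
  unfold wnorm
  simp_rw [smul_smul, mul_comm]

/-- Two Galerkin approximations stay close in `L²`. -/
theorem norm_sub_sq_le_of_galerkin (hs : S.M + b.σ + 1 ≤ s) {R T n m : ℝ} (hR : 0 < R)
    (hn : 1 ≤ n) (hm : 1 ≤ m) {u v : ℝ → Lp ℂ 2 μ}
    (hu : ∀ t ∈ Icc 0 T, IsReal (u t) ∧ cutL b n (u t) = u t ∧ ‖raiseL b s n (u t)‖ ≤ 2 * R ∧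
      HasDerivWithinAt u (-(Ω.transL s (raiseL b s n (u t))) - cutL b n
        (S.bilL (Nat.le_of_succ_le hs) (raiseL b s n (u t)) (raiseL b s n (u t)))) (Icc 0 T) t)
    (hv : ∀ t ∈ Icc 0 T, IsReal (v t) ∧ cutL b m (v t) = v t ∧ ‖raiseL b s m (v t)‖ ≤ 2 * R ∧
      HasDerivWithinAt v (-(Ω.transL s (raiseL b s m (v t))) - cutL b m
        (S.bilL (Nat.le_of_succ_le hs) (raiseL b s m (v t)) (raiseL b s m (v t)))) (Icc 0 T) t) :
    ∀ t ∈ Icc 0 T, ‖u t - v t‖ ^ 2 ≤ (‖u 0 - v 0‖ ^ 2 +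
      (8 * S.A * b.embConst.toReal * (4 * R ^ 2) / n +
        8 * S.A * b.embConst.toReal * (4 * R ^ 2) / m) ^ 2 /
          (8 * S.A * b.embConst.toReal * (4 * R) + 1)) *
        Real.exp ((8 * S.A * b.embConst.toReal * (4 * R) + 1) * t) := by
  have hA := S.A_nonneg
  refine le_mul_exp_of_deriv_le (by positivity) (by positivity) fun t ht => ?_
  obtain ⟨ru, cu, bu, du⟩ := hu t ht
  obtain ⟨rv, cv, bv, dv⟩ := hv t ht
  refine ⟨_, hasDerivWithinAt_norm_sq (du.sub dv) (ContinuousLinearMap.id ℂ _), ?_⟩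
  set h := raiseL b s n (u t) with hh
  set h' := raiseL b s m (v t) with hh'
  set B := S.bilL (Nat.le_of_succ_le hs) h h with hB
  set B' := S.bilL (Nat.le_of_succ_le hs) h' h' with hB'
  have hl : lowerL b s (h - h') = u t - v t := by
    rw [map_sub, hh, hh', lowerL_raiseL, lowerL_raiseL, cu, cv]
  have hre : IsReal h := ru.radL b (isWeight_pow s) n
  have e1 := abs_re_inner_sub_le S Ω (Nat.le_of_succ_le hs) hre h'
  rw [← hB, ← hB', hl] at e1
  set z := u t - v t with hz
  -- The difference of the two fields is that of the untruncated equation, handled by the stability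
  -- estimate, plus two truncation errors of sizes `O(1/n)` and `O(1/m)`.
  have e2 : -(Ω.transL s h) - cutL b n B - (-(Ω.transL s h') - cutL b m B') =
      -(Ω.transL s (h - h') + (B - B')) + ((B - cutL b n B) - (B' - cutL b m B')) := by
    rw [map_sub]; abel
  have r1 : ‖B - cutL b n B‖ ≤ 8 * S.A * b.embConst.toReal * (4 * R ^ 2) / n := by
    refine (S.norm_bilL_sub_cutL_le hs hn h h).trans ?_
    have q : ‖h‖ * ‖h‖ ≤ 4 * R ^ 2 := by nlinarith [norm_nonneg h]
    have := S.A_nonneg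
    exact div_le_div_of_nonneg_right (mul_le_mul_of_nonneg_left q (by positivity)) (by positivity)
  have r2 : ‖B' - cutL b m B'‖ ≤ 8 * S.A * b.embConst.toReal * (4 * R ^ 2) / m := by
    refine (S.norm_bilL_sub_cutL_le hs hm h' h').trans ?_
    have q : ‖h'‖ * ‖h'‖ ≤ 4 * R ^ 2 := by nlinarith [norm_nonneg h']
    have := S.A_nonneg
    exact div_le_div_of_nonneg_right (mul_le_mul_of_nonneg_left q (by positivity)) (by positivity)
  set d := 8 * S.A * b.embConst.toReal * (4 * R ^ 2) / n +
        8 * S.A * b.embConst.toReal * (4 * R ^ 2) / m with hd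
  have r3 : ‖(B - cutL b n B) - (B' - cutL b m B')‖ ≤ d :=
    (norm_sub_le _ _).trans (add_le_add r1 r2)
  simp only [ContinuousLinearMap.id_apply, Pi.sub_apply]
  rw [e2, inner_add_right, inner_neg_right, Complex.add_re, Complex.neg_re, mul_add]
  have e3 := (abs_le.1 e1).1
  have e4 : (inner ℂ z ((B - cutL b n B) - (B' - cutL b m B'))).re ≤ ‖z‖ * d :=
    (Complex.re_le_norm _).trans ((norm_inner_le_norm _ _).trans (by gcongr))
  have e5 : 8 * S.A * b.embConst.toReal * (‖h‖ + ‖h'‖) * ‖z‖ ^ 2 ≤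
      8 * S.A * b.embConst.toReal * (4 * R) * ‖z‖ ^ 2 := by
    gcongr
    linarith
  -- The errors contribute `2 ‖z‖ d ≤ ‖z‖² + d²`, whence the `1` added to the rate and the source
  -- term `d²`.
  nlinarith [sq_nonneg (‖z‖ - d)]

set_option maxHeartbeats 1000000 in
/-- Local existence on the Fourier side, on a time interval depending only on the size of the data
in the base norm, with propagation of all weighted norms. -/
theorem exists_fourier_solution (hs : S.M + b.σ + 1 ≤ s) {R : ℝ} (hR : 0 < R) :
    ∃ T > 0, ∀ h₀ : Lp ℂ 2 μ, IsReal h₀ → ‖h₀‖ ≤ R → ∃ h : ℝ → Lp ℂ 2 μ, h 0 = h₀ ∧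
      ContinuousOn h (Icc 0 T) ∧ (∀ t ∈ Icc 0 T, IsReal (h t)) ∧
      (∀ t ∈ Icc 0 T, HasDerivWithinAt (fun t => lowerL b s (h t))
        (-(Ω.transL s (h t)) - S.bilL (Nat.le_of_succ_le hs) (h t) (h t)) (Icc 0 T) t) ∧
      ∀ p, ∃ C : ℝ≥0∞, C ≠ ∞ ∧ ∀ φ, IsWeight p φ → ∀ t ∈ Icc 0 T,
        wnorm b s φ (h t) ≤ C * wnorm b s φ h₀ := by
  have hA := S.A_nonneg
  have hrate := S.rate_pos s (K := 2 * R) (by positivity)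
  obtain ⟨T, hT⟩ : ∃ T, T = Real.log 4 / S.rate s (2 * R) := ⟨_, rfl⟩
  have hT0 : 0 < T := hT ▸ div_pos (Real.log_pos (by norm_num)) hrate
  refine ⟨T, hT0, fun h₀ h0 h0R => ?_⟩
  have hs' := Nat.le_of_succ_le hs
  have hn1 : ∀ n : ℕ, (1 : ℝ) ≤ (n : ℝ) + 1 := fun n => by simp
  choose u hu0 hu using fun n : ℕ =>
    exists_galerkin_uniform S Ω hs' (hn1 n) hR hT h0 h0R
  set h : ℕ → ℝ → Lp ℂ 2 μ := fun n t => raiseL b s ((n : ℝ) + 1) (u n t) with hh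
  have hlow : ∀ n, ∀ t ∈ Icc 0 T, lowerL b s (h n t) = u n t := fun n t ht => by
    simp only [hh]
    rw [lowerL_raiseL, (hu n t ht).2.1]
  -- Cauchy in `L²`
  set a₀ := lowerL b s h₀ with ha₀
  set d := 8 * S.A * b.embConst.toReal * (4 * R ^ 2) with hd
  set κ := 8 * S.A * b.embConst.toReal * (4 * R) + 1 with hκ
  have hκ0 : 0 < κ := by positivity
  -- A single null sequence dominating both the truncation of the data and the truncation of the
  -- nonlinearity.
  set η : ℕ → ℝ := fun n => ‖cutL b ((n : ℝ) + 1) a₀ - a₀‖ + d / ((n : ℝ) + 1) with hη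
  have hη0 : Tendsto η atTop (𝓝 0) := by
    have t1 := tendsto_iff_norm_sub_tendsto_zero.1 (tendsto_cutL (b := b) a₀)
    have t2 : Tendsto (fun n : ℕ => d / ((n : ℝ) + 1)) atTop (𝓝 0) :=
      tendsto_const_nhds.div_atTop
        (tendsto_atTop_add_const_right _ _ tendsto_natCast_atTop_atTop)
    simpa using t1.add t2
  set Q := Real.sqrt ((1 + 1 / κ) * Real.exp (κ * T)) with hQ
  have hcl : ∀ n m, ∀ t ∈ Icc 0 T, ‖u n t - u m t‖ ≤ Q * (η n + η m) := by
    intro n m t ht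
    have d0 : 0 ≤ d := by positivity
    have e1 := norm_sub_sq_le_of_galerkin S Ω hs hR (hn1 n) (hn1 m)
      (fun t ht => ⟨(hu n t ht).1, (hu n t ht).2.1, (hu n t ht).2.2.1, (hu n t ht).2.2.2.1⟩)
      (fun t ht => ⟨(hu m t ht).1, (hu m t ht).2.1, (hu m t ht).2.2.1, (hu m t ht).2.2.2.1⟩) t ht
    rw [hu0, hu0, ← hd, ← hκ] at e1
    have p1 : 0 ≤ d / ((n : ℝ) + 1) := by positivity
    have p2 : 0 ≤ d / ((m : ℝ) + 1) := by positivity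
    have e2 : ‖cutL b ((n : ℝ) + 1) a₀ - cutL b ((m : ℝ) + 1) a₀‖ ≤ η n + η m := by
      have := norm_sub_le (cutL b ((n : ℝ) + 1) a₀ - a₀) (cutL b ((m : ℝ) + 1) a₀ - a₀)
      rw [sub_sub_sub_cancel_right] at this
      simp only [hη]; linarith
    have e3 : d / ((n : ℝ) + 1) + d / ((m : ℝ) + 1) ≤ η n + η m := by
      simp only [hη]
      linarith [norm_nonneg (cutL b ((n : ℝ) + 1) a₀ - a₀),
        norm_nonneg (cutL b ((m : ℝ) + 1) a₀ - a₀)]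
    have e4 : 0 ≤ η n + η m := (norm_nonneg _).trans e2
    refine abs_le_of_sq_le_sq' (b := Q * (η n + η m)) ?_ (by positivity) |>.2
    rw [mul_pow, hQ, Real.sq_sqrt (by positivity)]
    refine e1.trans ?_
    have e5 : Real.exp (κ * t) ≤ Real.exp (κ * T) := by
      rw [Real.exp_le_exp]
      exact mul_le_mul_of_nonneg_left ht.2 hκ0.le
    calc _ ≤ ((η n + η m) ^ 2 + (η n + η m) ^ 2 / κ) * Real.exp (κ * T) := by gcongr
      _ = _ := by ring
  -- uniform smallness of high frequencies
  set q := Real.sqrt (Real.exp (S.rate (s + 1) (2 * R) * T)) with hq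
  set τ : ℕ → ℝ := fun r => q * (eLpNorm (fun x => min 1 (b x / ((r : ℝ) + 1)) • h₀ x) 2 μ).toReal
    with hτ
  have hτ0 : Tendsto τ atTop (𝓝 0) := by
    have := (ENNReal.tendsto_toReal ENNReal.zero_ne_top).comp
      (tendsto_eLpNorm_min (b := b) (Lp.memLp h₀))
    have h2 := this.const_mul q
    rw [ENNReal.toReal_zero, mul_zero] at h2
    exact h2
  have hmin_ne : ∀ r : ℕ, eLpNorm (fun x => min 1 (b x / ((r : ℝ) + 1)) • h₀ x) 2 μ ≠ ∞ := by
    intro r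
    refine ((eLpNorm_mono fun x => ?_).trans_lt (Lp.memLp h₀).2).ne
    rw [norm_smul, Real.norm_of_nonneg (by have := b.nonneg x; positivity)]
    exact mul_le_of_le_one_left (norm_nonneg _) (min_le_left _ _)
  -- All these weights have growth exponent `s + 1`, hence the same rate, so the tail beyond `r` is
  -- bounded by that of the data with a factor independent of `r`, `n` and `t`.
  have htail : ∀ r n : ℕ, ∀ t ∈ Icc 0 T,
      ‖radL b (fun q => q ^ s * min 1 (q / ((r : ℝ) + 1))) ((n : ℝ) + 1) (u n t)‖ ≤ τ r := by
    intro r n t ht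
    have hφ := isWeight_pow_mul_min s (show (0 : ℝ) < (r : ℝ) + 1 by positivity)
    have e1 := (hu n t ht).2.2.2.2 _ _ hφ
    have e2 : ‖radL b (fun q => q ^ s * min 1 (q / ((r : ℝ) + 1))) ((n : ℝ) + 1) a₀‖ ≤
        (eLpNorm (fun x => min 1 (b x / ((r : ℝ) + 1)) • h₀ x) 2 μ).toReal := by
      have e3 := enorm_radL_lowerL_le (b := b) (s := s) hφ ((n : ℝ) + 1) h₀
      rw [wnorm_pow_mul_min] at e3
      simp_rw [pow_smul_lower] at e3
      rw [← toReal_enorm]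
      exact ENNReal.toReal_mono (hmin_ne r) e3
    refine abs_le_of_sq_le_sq' (b := τ r) ?_ (by positivity) |>.2
    simp only [hτ, mul_pow, hq, Real.sq_sqrt (Real.exp_nonneg _)]
    rw [mul_comm]
    exact e1.trans (by gcongr)
  have huc : UniformCauchySeqOn h atTop (Icc 0 T) := by
    rw [Metric.uniformCauchySeqOn_iff]
    intro ε hε
    -- First `r` is fixed so that each of the two tails costs at most `ε/4`; then the indices are
    -- taken large for the `L²` difference, which is multiplied by the now fixed power of `r + 1`.
    obtain ⟨r, hr⟩ := ((tendsto_order.1 hτ0).2 (ε / 4) (by positivity)).exists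
    have hlim : Tendsto (fun n => ((r : ℝ) + 1) ^ s * (Q * η n)) atTop (𝓝 0) := by
      simpa using (hη0.const_mul Q).const_mul (((r : ℝ) + 1) ^ s)
    obtain ⟨N, hN⟩ := eventually_atTop.1 ((tendsto_order.1 hlim).2 (ε / 4) (by positivity))
    refine ⟨N, fun m hm n hn t ht => ?_⟩
    rw [dist_eq_norm]
    have e1 := norm_raiseL_sub_le (b := b) (s := s) (hn1 r) (hu m t ht).2.1 (hu n t ht).2.1
    have e2 := htail r m t ht
    have e3 := htail r n t ht
    have e4 := mul_le_mul_of_nonneg_left (hcl m n t ht)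
      (show (0 : ℝ) ≤ ((r : ℝ) + 1) ^ s by positivity)
    have e5 := hN m hm
    have e6 := hN n hn
    simp only [hh]
    nlinarith
  -- the limit
  have hex : ∀ t, ∃ x, t ∈ Icc 0 T → Tendsto (fun n => h n t) atTop (𝓝 x) := by
    intro t
    by_cases ht : t ∈ Icc 0 T
    · obtain ⟨x, hx⟩ := cauchySeq_tendsto_of_complete (huc.cauchySeq ht)
      exact ⟨x, fun _ => hx⟩
    · exact ⟨0, fun h => absurd h ht⟩
  choose H hH using hex
  have hunif : TendstoUniformlyOn h H atTop (Icc 0 T) :=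
    huc.tendstoUniformlyOn_of_tendsto fun t ht => hH t ht
  have hcont : ∀ n, ContinuousOn (h n) (Icc 0 T) := fun n =>
    (raiseL b s ((n : ℝ) + 1)).continuous.comp_continuousOn fun t ht =>
      (hu n t ht).2.2.2.1.continuousWithinAt
  have hHc : ContinuousOn H (Icc 0 T) := hunif.continuousOn (Eventually.frequently (.of_forall hcont))
  have hlowT : ∀ t ∈ Icc 0 T, Tendsto (fun n => u n t) atTop (𝓝 (lowerL b s (H t))) := by
    intro t ht
    refine (((lowerL b s).continuous.tendsto _).comp (hH t ht)).congr fun n => hlow n t ht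
  have hHR : ∀ t ∈ Icc 0 T, ‖H t‖ ≤ 2 * R := fun t ht =>
    le_of_tendsto (hH t ht).norm (.of_forall fun n => (hu n t ht).2.2.1)
  have hH0 : H 0 = h₀ := by
    have h1 := hH 0 (left_mem_Icc.2 hT0.le)
    have h2 : ∀ n, h n 0 = cutL b ((n : ℝ) + 1) h₀ := by
      intro n
      simp only [hh]
      rw [hu0, raiseL, radL_cutL b (isWeight_pow s)]
      exact raiseL_lowerL b s _ h₀
    simp_rw [h2] at h1
    exact tendsto_nhds_unique h1 (tendsto_cutL h₀)
  refine ⟨H, hH0, hHc, fun t ht => ?_, ?_, fun p => ?_⟩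
  · exact isReal_of_tendsto (.of_forall fun n => (hu n t ht).1.radL b (isWeight_pow s) _) (hH t ht)
  -- The fields converge uniformly in time: continuity of the linear and bilinear operators treats
  -- `h n → H`, and the truncation of the nonlinearity adds `O(1/n)`.
  · refine hasDerivWithinAt_of_tendstoUniformlyOn (fun n t ht => (hu n t ht).2.2.2.1) hlowT ?_ ?_
    · rw [Metric.tendstoUniformlyOn_iff]
      intro ε hε
      set c := ‖Ω.transL (μ := μ) s‖ + 4 * R * ‖S.bilL hs'‖ + 1 with hc
      have hc0 : 0 < c := by positivity
      have t2 : Tendsto (fun n : ℕ => d / ((n : ℝ) + 1)) atTop (𝓝 0) :=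
        tendsto_const_nhds.div_atTop
          (tendsto_atTop_add_const_right _ _ tendsto_natCast_atTop_atTop)
      filter_upwards [Metric.tendstoUniformlyOn_iff.1 hunif (ε / (2 * c)) (by positivity),
        (tendsto_order.1 t2).2 (ε / 2) (by positivity)] with n hn hn2 t ht
      rw [dist_eq_norm]
      have h1 := hn t ht
      rw [dist_eq_norm] at h1
      have e : -(Ω.transL s (H t)) - S.bilL hs' (H t) (H t) -
          (-(Ω.transL s (h n t)) - cutL b ((n : ℝ) + 1) (S.bilL hs' (h n t) (h n t))) =
          -(Ω.transL s (H t - h n t)) - (S.bilL hs' (H t - h n t) (H t) +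
            S.bilL hs' (h n t) (H t - h n t)) - (S.bilL hs' (h n t) (h n t) -
              cutL b ((n : ℝ) + 1) (S.bilL hs' (h n t) (h n t))) := by
        simp only [map_sub, sub_apply]; abel
      refine lt_of_eq_of_lt (congrArg norm e) ?_
      have b1 := (Ω.transL (μ := μ) s).le_opNorm (H t - h n t)
      have b2 := (S.bilL hs').le_opNorm₂ (H t - h n t) (H t)
      have b3 := (S.bilL hs').le_opNorm₂ (h n t) (H t - h n t)
      have b4 := S.norm_bilL_sub_cutL_le hs (hn1 n) (h n t) (h n t)
      have b5 := hHR t ht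
      have b6 : ‖h n t‖ ≤ 2 * R := (hu n t ht).2.2.1
      have b7 : 8 * S.A * b.embConst.toReal * (‖h n t‖ * ‖h n t‖) / ((n : ℝ) + 1) ≤
          d / ((n : ℝ) + 1) := by
        have q : ‖h n t‖ * ‖h n t‖ ≤ 4 * R ^ 2 := by nlinarith [norm_nonneg (h n t)]
        have := S.A_nonneg
        rw [hd]
        exact div_le_div_of_nonneg_right (mul_le_mul_of_nonneg_left q (by positivity))
          (by positivity)
      have b8 : ‖S.bilL hs'‖ * ‖H t - h n t‖ * ‖H t‖ ≤
          ‖S.bilL hs'‖ * ‖H t - h n t‖ * (2 * R) := by gcongr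
      have b9 : ‖S.bilL hs'‖ * ‖h n t‖ * ‖H t - h n t‖ ≤
          ‖S.bilL hs'‖ * (2 * R) * ‖H t - h n t‖ := by gcongr
      have n1 := norm_sub_le (-(Ω.transL s (H t - h n t)) - (S.bilL hs' (H t - h n t) (H t) +
            S.bilL hs' (h n t) (H t - h n t))) (S.bilL hs' (h n t) (h n t) -
              cutL b ((n : ℝ) + 1) (S.bilL hs' (h n t) (h n t)))
      have n2 := norm_sub_le (-(Ω.transL s (H t - h n t))) (S.bilL hs' (H t - h n t) (H t) +
            S.bilL hs' (h n t) (H t - h n t))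
      have n3 := norm_add_le (S.bilL hs' (H t - h n t) (H t)) (S.bilL hs' (h n t) (H t - h n t))
      rw [norm_neg] at n2
      have n4 : c * ‖H t - h n t‖ ≤ ε / 2 := by
        have := mul_le_mul_of_nonneg_left h1.le hc0.le
        refine this.trans (le_of_eq ?_)
        field_simp
      have n5 : (‖Ω.transL (μ := μ) s‖ + 4 * R * ‖S.bilL hs'‖) * ‖H t - h n t‖ ≤
          c * ‖H t - h n t‖ := by
        exact mul_le_mul_of_nonneg_right (by rw [hc]; linarith) (norm_nonneg _)
      linarith
    · have c1 : ContinuousOn (fun t => Ω.transL s (H t)) (Icc 0 T) :=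
        (Ω.transL s).continuous.comp_continuousOn hHc
      have c2 : ContinuousOn (fun t => S.bilL hs' (H t) (H t)) (Icc 0 T) :=
        ((S.bilL hs').continuous.comp_continuousOn hHc).clm_apply hHc
      exact c1.neg.sub c2
  · refine ⟨ENNReal.ofReal (Real.sqrt (Real.exp (S.rate p (2 * R) * T))), ENNReal.ofReal_ne_top,
      fun φ hφ t ht => wnorm_le_of_forall hφ _ fun m => ?_⟩
    have hlim : Tendsto (fun n => ‖radL b φ ((m : ℝ) + 1) (u n t)‖ₑ) atTop
        (𝓝 ‖radL b φ ((m : ℝ) + 1) (lowerL b s (H t))‖ₑ) :=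
      (((radL b φ ((m : ℝ) + 1)).continuous.tendsto _).comp (hlowT t ht)).enorm
    refine le_of_tendsto hlim ?_
    -- The observation radius `m + 1` is fixed while `n` grows: for `n ≥ m` the norm truncated at `m
    -- + 1` is below the one truncated at `n + 1`, to which the energy estimate applies.
    filter_upwards [eventually_ge_atTop m] with n hn
    have hmn : (m : ℝ) + 1 ≤ (n : ℝ) + 1 := by
      have : (m : ℝ) ≤ n := by exact_mod_cast hn
      linarith
    have e1 := norm_radL_le_of_le (b := b) hφ hmn (u n t)
    have e2 := (hu n t ht).2.2.2.2 _ _ hφ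
    have e3 : ‖radL b φ ((m : ℝ) + 1) (u n t)‖ ≤ Real.sqrt (Real.exp (S.rate p (2 * R) * T)) *
        ‖radL b φ ((n : ℝ) + 1) a₀‖ := by
      refine e1.trans (abs_le_of_sq_le_sq' ?_ (by positivity) |>.2)
      rw [mul_pow, Real.sq_sqrt (Real.exp_nonneg _), mul_comm]
      exact e2
    have e4 := ENNReal.ofReal_le_ofReal e3
    rw [ofReal_norm, ENNReal.ofReal_mul (Real.sqrt_nonneg _), ofReal_norm] at e4
    exact e4.trans (mul_le_mul_right (enorm_radL_lowerL_le hφ _ h₀) _)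

/-- Uniqueness on the Fourier side. -/
theorem fourier_solution_unique (hs : S.M + b.σ ≤ s) {T : ℝ} {h k : ℝ → Lp ℂ 2 μ} {K : ℝ}
    (hh : ∀ t ∈ Icc 0 T, IsReal (h t) ∧ ‖h t‖ ≤ K ∧ HasDerivWithinAt (fun t => lowerL b s (h t))
        (-(Ω.transL s (h t)) - S.bilL hs (h t) (h t)) (Icc 0 T) t)
    (hk : ∀ t ∈ Icc 0 T, ‖k t‖ ≤ K ∧ HasDerivWithinAt (fun t => lowerL b s (k t))
        (-(Ω.transL s (k t)) - S.bilL hs (k t) (k t)) (Icc 0 T) t)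
    (h0 : lowerL b s (h 0) = lowerL b s (k 0)) :
    ∀ t ∈ Icc 0 T, lowerL b s (h t) = lowerL b s (k t) := by
  intro t ht
  have hA := S.A_nonneg
  have hK : 0 ≤ K := (norm_nonneg _).trans (hk t ht).1
  have key := le_mul_exp_of_deriv_le (f := fun t => ‖lowerL b s (h t) - lowerL b s (k t)‖ ^ 2)
    (T := T) (κ := 8 * S.A * b.embConst.toReal * (2 * K) + 1) (ε := 0) (by positivity) le_rfl
    (fun t ht => by
      obtain ⟨r1, b1, d1⟩ := hh t ht
      obtain ⟨b2, d2⟩ := hk t ht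
      refine ⟨_, hasDerivWithinAt_norm_sq (d1.sub d2) (ContinuousLinearMap.id ℂ _), ?_⟩
      have e1 := (abs_le.1 (abs_re_inner_sub_le S Ω hs r1 (k t))).1
      rw [map_sub (lowerL b s)] at e1
      set z := lowerL b s (h t) - lowerL b s (k t) with hz
      have e2 : -(Ω.transL s (h t)) - S.bilL hs (h t) (h t) -
          (-(Ω.transL s (k t)) - S.bilL hs (k t) (k t)) =
          -(Ω.transL s (h t - k t) + (S.bilL hs (h t) (h t) - S.bilL hs (k t) (k t))) := by
        rw [map_sub]; abel
      simp only [ContinuousLinearMap.id_apply, Pi.sub_apply]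
      rw [e2, inner_neg_right, Complex.neg_re]
      have e3 : 8 * S.A * b.embConst.toReal * (‖h t‖ + ‖k t‖) * ‖z‖ ^ 2 ≤
          8 * S.A * b.embConst.toReal * (2 * K) * ‖z‖ ^ 2 := by
        gcongr
        linarith
      nlinarith [sq_nonneg ‖z‖]) t ht
  rw [h0] at key
  simp only [sub_self, norm_zero, zero_div, add_zero] at key
  have : ‖lowerL b s (h t) - lowerL b s (k t)‖ = 0 := by
    have h2 := sq_nonneg ‖lowerL b s (h t) - lowerL b s (k t)‖
    norm_num at key
    simpa [sub_eq_zero] using key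
  exact sub_eq_zero.1 (norm_eq_zero.1 this)

end WellPosed

/-! ### The Fourier transform of `L²` on integrable functions, and its behaviour under conjugation.
-/

section InverseFourier

variable {V : Type*} [NormedAddCommGroup V] [InnerProductSpace ℝ V] [FiniteDimensional ℝ V]
  [MeasurableSpace V] [BorelSpace V]

theorem continuous_fourierInv_of_integrable {f : V → ℂ} (hf : Integrable f) :
    Continuous (𝓕⁻ f) :=
  VectorFourier.fourierIntegral_continuous Real.continuous_fourierChar
    (by simpa using! (continuous_fst.inner continuous_snd).neg) hf

/-- On `L¹ ∩ L²` the inverse Fourier transform of `L²` is given by the integral. -/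
theorem fourierInv_toLp_ae_eq {f : V → ℂ} (h1 : Integrable f) (h2 : MemLp f 2) :
    (𝓕⁻ (h2.toLp f) : Lp ℂ 2 (volume : Measure V)) =ᵐ[volume] 𝓕⁻ f := by
  refine ae_eq_of_integral_contDiff_smul_eq ((Lp.memLp _).locallyIntegrable one_le_two)
    (continuous_fourierInv_of_integrable h1).locallyIntegrable fun g g_smooth g_cpt => ?_
  have hg₁ : HasCompactSupport (Complex.ofRealCLM ∘ g) := g_cpt.comp_left rfl
  have hg₂ : ContDiff ℝ ((⊤ : ℕ∞) : WithTop ℕ∞) (Complex.ofRealCLM ∘ g) :=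
    Complex.ofRealCLM.contDiff.comp g_smooth
  -- Both candidates are tested against a Schwartz function. The transform of `L²` agrees with that
  -- of tempered distributions, which moves it onto `φ`; as `f` is integrable, Fubini moves it back
  -- as an integral.
  set φ := hg₁.toSchwartzMap hg₂ with hφ
  have e1 : ∫ x, g x • (𝓕⁻ (h2.toLp f) : Lp ℂ 2 (volume : Measure V)) x =
      ∫ x, φ x • (𝓕⁻ (h2.toLp f) : Lp ℂ 2 (volume : Measure V)) x := by simp [hφ]
  have e2 : ∫ x, g x • 𝓕⁻ f x = ∫ x, φ x • 𝓕⁻ f x := by simp [hφ]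
  rw [e1, e2, ← Lp.toTemperedDistribution_apply, ← Lp.fourierInv_toTemperedDistribution_eq,
    TemperedDistribution.fourierInv_apply, Lp.toTemperedDistribution_apply]
  have e3 : ∫ x, (𝓕⁻ φ) x • (h2.toLp f) x = ∫ x, (𝓕⁻ (φ : V → ℂ)) x • f x := by
    refine integral_congr_ae ?_
    filter_upwards [h2.coeFn_toLp] with x hx
    rw [hx, SchwartzMap.fourierInv_coe]
  rw [e3]
  exact VectorFourier.integral_fourierIntegral_smul_eq_flip (L := -innerₗ V)
    Real.continuous_fourierChar (by simpa using! (continuous_fst.inner continuous_snd).neg)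
    φ.integrable h1 |>.trans (by
      congr 1
      ext x
      congr 2
      ext a b
      simp [real_inner_comm])

theorem fourierInv_conj_neg (f : V → ℂ) (y : V) :
    𝓕⁻ (fun x => (starRingEnd ℂ) (f (-x))) y = (starRingEnd ℂ) (𝓕⁻ f y) := by
  rw [Real.fourierInv_eq', Real.fourierInv_eq', ← integral_conj, ← integral_neg_eq_self]
  refine integral_congr_ae (.of_forall fun x => ?_)
  simp [← Complex.exp_conj, Complex.conj_ofNat]

/-- Complex conjugation on `L²`. -/
def starL {α : Type*} [MeasurableSpace α] (μ : Measure α) : Lp ℂ 2 μ →L[ℝ] Lp ℂ 2 μ :=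
  Complex.conjCLE.toContinuousLinearMap.compLpL 2 μ

theorem coeFn_starL {α : Type*} [MeasurableSpace α] {μ : Measure α} (f : Lp ℂ 2 μ) :
    starL μ f =ᵐ[μ] fun x => (starRingEnd ℂ) (f x) :=
  ContinuousLinearMap.coeFn_compLpL _ f

/-- Both sides are continuous in `f`, so it suffices to check Schwartz functions, for which the
inverse transform is an integral. -/
theorem fourierInv_conjL (f : Lp ℂ 2 (volume : Measure V)) :
    𝓕⁻ (conjL volume f) = starL volume (𝓕⁻ f) := by
  refine (SchwartzMap.denseRange_toLpCLM (E := V) (F := ℂ) (p := 2) (μ := (volume : Measure V))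
    ENNReal.ofNat_ne_top).induction_on
    (p := fun f => 𝓕⁻ (conjL volume f) = starL volume (𝓕⁻ f)) f
    (isClosed_eq ?_ ?_) fun φ => ?_
  · exact (Lp.fourierTransformₗᵢ V ℂ).symm.continuous.comp (conjL _).continuous
  · exact (starL _).continuous.comp (Lp.fourierTransformₗᵢ V ℂ).symm.continuous
  · have h1 : Integrable (fun x => (starRingEnd ℂ) (φ (-x))) :=
      (Complex.conjCLE.toContinuousLinearMap.integrable_comp (φ.integrable (μ := volume)).comp_neg)
    have h2 : conjL volume ((φ.memLp 2).toLp φ : Lp ℂ 2 (volume : Measure V)) =ᵐ[volume]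
        fun x => (starRingEnd ℂ) (φ (-x)) := by
      filter_upwards [coeFn_conjL ((φ.memLp 2).toLp φ : Lp ℂ 2 (volume : Measure V)),
        ae_neg (φ.memLp 2 (volume : Measure V)).coeFn_toLp] with x hx hx'
      rw [hx, hx']
    have h3 : MemLp (fun x => (starRingEnd ℂ) (φ (-x))) 2 (volume : Measure V) :=
      (memLp_congr_ae h2).1 (Lp.memLp _)
    have h4 : conjL volume ((φ.memLp 2).toLp φ : Lp ℂ 2 (volume : Measure V)) = h3.toLp _ :=
      Lp.ext (h2.trans h3.coeFn_toLp.symm)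
    change 𝓕⁻ (conjL volume ((φ.memLp 2).toLp φ : Lp ℂ 2 (volume : Measure V))) =
      starL volume (𝓕⁻ ((φ.memLp 2).toLp φ : Lp ℂ 2 (volume : Measure V)))
    rw [h4]
    refine Lp.ext ?_
    filter_upwards [fourierInv_toLp_ae_eq h1 h3, coeFn_starL (𝓕⁻ ((φ.memLp 2).toLp φ)),
      fourierInv_toLp_ae_eq φ.integrable (φ.memLp 2)] with x e1 e2 e3
    rw [e1, e2, e3, fourierInv_conj_neg]

theorem fourier_starL (f : Lp ℂ 2 (volume : Measure V)) :
    𝓕 (starL volume f) = conjL volume (𝓕 f) := by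
  have h := fourierInv_conjL (𝓕 f)
  have e1 : 𝓕⁻ (𝓕 f) = f := fourierInv_fourier_eq f
  rw [e1] at h
  rw [← h]
  exact fourier_fourierInv_eq _

end InverseFourier

/-! ### The frequency space and the Sobolev bracket. -/

section Freq

variable {d : ℕ} {Θ : ℝ}

/-- The product of counting measure and Lebesgue measure on the frequencies `(k, ξ)`. -/
abbrev freq (d : ℕ) : Measure (ℤ × Tan d) := (Measure.count : Measure ℤ).prod volume

instance : (freq d).IsNegInvariant where
  neg_eq_self := by
    have h : Measure.neg (freq d) = Measure.map (Prod.map Neg.neg Neg.neg) (freq d) := rfl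
    rw [h, ← Measure.map_prod_map _ _ measurable_neg measurable_neg, Measure.map_neg_eq_self,
      Measure.map_neg_eq_self]

/-- The counting measure charges every point and there are countably many `k`. This translates
between identities of transforms and identities mode by mode. -/
theorem ae_freq {p : ℤ × Tan d → Prop} :
    (∀ᵐ x ∂freq d, p x) ↔ ∀ k, ∀ᵐ ξ : Tan d, p (k, ξ) := by
  constructor
  · intro h
    exact Measure.ae_count_iff.1 (Measure.ae_ae_of_ae_prod h)
  · intro h
    have : {x | ¬ p x} ⊆ ⋃ k : ℤ, ({k} : Set ℤ) ×ˢ {ξ | ¬ p (k, ξ)} := by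
      rintro ⟨k, ξ⟩ hx
      exact mem_iUnion.2 ⟨k, rfl, hx⟩
    refine measure_mono_null this (measure_iUnion_null fun k => ?_)
    rw [Measure.prod_prod, show volume {ξ | ¬ p (k, ξ)} = 0 from h k, mul_zero]

theorem lintegral_freq {F : ℤ × Tan d → ℝ≥0∞} (hF : Measurable F) :
    ∫⁻ x, F x ∂freq d = ∑' k, ∫⁻ ξ, F (k, ξ) := by
  rw [lintegral_prod _ hF.aemeasurable, lintegral_count]

variable (d Θ) in
/-- The square root of `1 + |2πξ|² + (2πk/Θ)²`. -/
def japanese (x : ℤ × Tan d) : ℝ :=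
  √(1 + (2 * Real.pi * ‖x.2‖) ^ 2 + (2 * Real.pi * x.1 / Θ) ^ 2)

theorem japanese_sq (x : ℤ × Tan d) :
    japanese d Θ x ^ 2 = 1 + (2 * Real.pi * ‖x.2‖) ^ 2 + (2 * Real.pi * x.1 / Θ) ^ 2 :=
  Real.sq_sqrt (by positivity)

theorem one_le_japanese (x : ℤ × Tan d) : 1 ≤ japanese d Θ x := by
  rw [japanese, Real.one_le_sqrt]
  nlinarith [sq_nonneg (2 * Real.pi * ‖x.2‖), sq_nonneg (2 * Real.pi * x.1 / Θ)]

/-- The triangle inequality in Euclidean space, with Cauchy–Schwarz for the cross terms. The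
constant `1` occurs once on the left and twice on the right, so it causes no loss. -/
theorem japanese_add_le (x y : ℤ × Tan d) :
    japanese d Θ (x + y) ≤ japanese d Θ x + japanese d Θ y := by
  have hx := one_le_japanese (Θ := Θ) x
  have hy := one_le_japanese (Θ := Θ) y
  refine Real.sqrt_le_iff.2 ⟨by linarith, ?_⟩
  have h1 : 2 * Real.pi * ‖(x + y).2‖ ≤ 2 * Real.pi * ‖x.2‖ + 2 * Real.pi * ‖y.2‖ := by
    rw [← mul_add]
    exact mul_le_mul_of_nonneg_left (norm_add_le _ _) (by positivity)
  have h2 : 2 * Real.pi * ((x + y).1 : ℤ) / Θ =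
      2 * Real.pi * x.1 / Θ + 2 * Real.pi * y.1 / Θ := by
    simp only [Prod.fst_add, Int.cast_add]; ring
  rw [h2]
  have sx := japanese_sq (Θ := Θ) x
  have sy := japanese_sq (Θ := Θ) y
  have p0 : 0 ≤ 2 * Real.pi * ‖(x + y).2‖ := by positivity
  have px : 0 ≤ 2 * Real.pi * ‖x.2‖ := by positivity
  have py : 0 ≤ 2 * Real.pi * ‖y.2‖ := by positivity
  set X := japanese d Θ x
  set Y := japanese d Θ y
  set p := 2 * Real.pi * ‖x.2‖
  set q := 2 * Real.pi * ‖y.2‖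
  set k := 2 * Real.pi * x.1 / Θ
  set l := 2 * Real.pi * y.1 / Θ
  have h3 : p * q + k * l ≤ X * Y := by
    refine abs_le_of_sq_le_sq' ?_ (by nlinarith) |>.2
    rw [mul_pow, sx, sy]
    nlinarith [sq_nonneg (p * l - q * k), sq_nonneg p, sq_nonneg q, sq_nonneg k, sq_nonneg l]
  nlinarith [pow_le_pow_left₀ p0 h1 2]

theorem japanese_neg (x : ℤ × Tan d) : japanese d Θ (-x) = japanese d Θ x := by
  simp only [japanese, Prod.snd_neg, Prod.fst_neg, norm_neg, Int.cast_neg]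
  congr 2
  ring

theorem measurable_japanese : Measurable (japanese d Θ) := by
  have h1 : Measurable fun x : ℤ × Tan d => (x.1 : ℝ) :=
    (measurable_from_top (f := fun k : ℤ => (k : ℝ))).comp measurable_fst
  have h2 : Measurable fun x : ℤ × Tan d => ‖x.2‖ := measurable_snd.norm
  unfold japanese
  fun_prop

theorem abs_fst_le_japanese (x : ℤ × Tan d) :
    |2 * Real.pi * x.1 / Θ| ≤ japanese d Θ x :=
  Real.abs_le_sqrt (by nlinarith [sq_nonneg (2 * Real.pi * ‖x.2‖)])

theorem norm_snd_le_japanese (x : ℤ × Tan d) : 2 * Real.pi * ‖x.2‖ ≤ japanese d Θ x :=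
  (le_abs_self _).trans (Real.abs_le_sqrt (by nlinarith [sq_nonneg (2 * Real.pi * x.1 / Θ)]))

/-- After squaring there are `d + 2` factors `b⁻²`: one makes the sum over `k` converge, the other
`d + 1` make the integral over `ξ ∈ ℝ^(d-1)` converge. The exponent is not optimal. -/
theorem eLpNorm_japanese_lt_top (hΘ : 0 < Θ) :
    eLpNorm (fun x => (japanese d Θ x ^ (d + 2))⁻¹) 2 (freq d) < ∞ := by
  rw [eLpNorm_lt_top_iff_lintegral_rpow_enorm_lt_top (by norm_num) (by norm_num)]
  have h1 : ∀ x : ℤ × Tan d, ‖(japanese d Θ x ^ (d + 2))⁻¹‖ₑ ^ (2 : ℝ≥0∞).toReal ≤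
      ENNReal.ofReal ((1 + (2 * Real.pi * x.1 / Θ) ^ 2)⁻¹) *
        ENNReal.ofReal ((1 + ‖x.2‖ ^ 2) ^ (-(2 * (d + 1) : ℝ) / 2)) := by
    intro x
    have hb := one_le_japanese (Θ := Θ) x
    rw [← ofReal_norm, ← ENNReal.ofReal_mul (by positivity), ENNReal.toReal_ofNat,
      ENNReal.ofReal_rpow_of_nonneg (norm_nonneg _) (by norm_num)]
    refine ENNReal.ofReal_le_ofReal ?_
    rw [Real.norm_of_nonneg (by positivity), Real.rpow_two, inv_pow, ← pow_mul, mul_comm,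
      pow_mul, pow_succ', mul_inv]
    have e : (-(2 * (d + 1) : ℝ) / 2) = -((d + 1 : ℕ) : ℝ) := by push_cast; ring
    rw [e, Real.rpow_neg (by positivity), Real.rpow_natCast]
    have hs := japanese_sq (Θ := Θ) x
    have hp : 1 ≤ 2 * Real.pi := by linarith [Real.pi_gt_three]
    have hq : ‖x.2‖ ^ 2 ≤ (2 * Real.pi * ‖x.2‖) ^ 2 :=
      pow_le_pow_left₀ (norm_nonneg _) (le_mul_of_one_le_left (norm_nonneg _) hp) 2
    gcongr
    · nlinarith [sq_nonneg (2 * Real.pi * ‖x.2‖)]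
    · nlinarith [sq_nonneg (2 * Real.pi * x.1 / Θ)]
  refine (lintegral_mono h1).trans_lt ?_
  rw [lintegral_prod_mul (f := fun k : ℤ => ENNReal.ofReal ((1 + (2 * Real.pi * k / Θ) ^ 2)⁻¹))
    (g := fun ξ : Tan d => ENNReal.ofReal ((1 + ‖ξ‖ ^ 2) ^ (-(2 * (d + 1) : ℝ) / 2)))
    (by fun_prop) (by fun_prop)]
  refine ENNReal.mul_lt_top ?_ ?_
  · rw [lintegral_count]
    have hs : Summable fun k : ℤ => (1 + (2 * Real.pi * k / Θ) ^ 2)⁻¹ := by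
      have h2 : Summable fun k : ℤ => (Θ / (2 * Real.pi)) ^ 2 * (1 / (k : ℝ) ^ 2) :=
        (Real.summable_one_div_int_pow.2 one_lt_two).mul_left _
      refine Summable.of_norm_bounded_eventually h2 ?_
      filter_upwards [(finite_singleton (0 : ℤ)).compl_mem_cofinite] with k hk
      have hk : (k : ℝ) ≠ 0 := by simpa using hk
      rw [Real.norm_of_nonneg (by positivity)]
      have : (Θ / (2 * Real.pi)) ^ 2 * (1 / (k : ℝ) ^ 2) = ((2 * Real.pi * k / Θ) ^ 2)⁻¹ := by
        have := Real.pi_ne_zero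
        field_simp
      rw [this]
      have : 0 < (2 * Real.pi * k / Θ) ^ 2 := by positivity
      gcongr
      linarith
    rw [← ENNReal.ofReal_tsum_of_nonneg (fun k => by positivity) hs]
    exact ENNReal.ofReal_lt_top
  · refine (integrable_rpow_neg_one_add_norm_sq ?_).lintegral_lt_top
    rw [finrank_euclideanSpace, Fintype.card_fin]
    have : ((d - 1 : ℕ) : ℝ) ≤ d := by exact_mod_cast Nat.sub_le d 1
    linarith

variable (d Θ) in
/-- The weight `(1 + |2πξ|² + (2πk/Θ)²)^(1/2)` of the Sobolev norms. -/
def sobolevBracket [Fact (0 < Θ)] : Bracket (freq d) where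
  toFun := japanese d Θ
  measurable := measurable_japanese
  one_le := one_le_japanese
  map_neg := japanese_neg
  abs_sub_le x y := by
    rw [abs_le]
    have h1 := japanese_add_le (Θ := Θ) x y
    have h2 := japanese_add_le (Θ := Θ) (-x) (x + y)
    rw [japanese_neg, neg_add_cancel_left] at h2
    constructor <;> linarith
  σ := d + 2
  finite := eLpNorm_japanese_lt_top Fact.out

end Freq

/-! ### Parseval's identity in the periodic variable. -/

section Parseval

variable {d : ℕ} {Θ : ℝ} [Fact (0 < Θ)]

theorem tsum_enorm_sq_fourierCoeff {v : AddCircle Θ → ℂ}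
    (hv : MemLp v 2 AddCircle.haarAddCircle) :
    ∑' k : ℤ, ‖fourierCoeff v k‖ₑ ^ 2 = ∫⁻ θ, ‖v θ‖ₑ ^ 2 ∂AddCircle.haarAddCircle := by
  have h1 := hasSum_sq_fourierCoeff (hv.toLp v)
  have h2 : ∀ k, fourierCoeff (hv.toLp v) k = fourierCoeff v k := fun k =>
    congrFun (fourierCoeff_congr_ae hv.coeFn_toLp) k
  have h3 : ∫ t, ‖(hv.toLp v) t‖ ^ 2 ∂AddCircle.haarAddCircle =
      ∫ t, ‖v t‖ ^ 2 ∂AddCircle.haarAddCircle := by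
    refine integral_congr_ae ?_
    filter_upwards [hv.coeFn_toLp] with t ht
    rw [ht]
  simp_rw [h2] at h1
  rw [h3] at h1
  have h4 := ENNReal.ofReal_tsum_of_nonneg (fun k => sq_nonneg ‖fourierCoeff v k‖) h1.summable
  rw [h1.tsum_eq, ofReal_integral_eq_lintegral_ofReal hv.integrable_norm_pow'
    (.of_forall fun _ => by positivity)] at h4
  have e : ∀ z : ℂ, ENNReal.ofReal (‖z‖ ^ 2) = ‖z‖ₑ ^ 2 := fun z => by
    rw [ENNReal.ofReal_pow (norm_nonneg _), ofReal_norm]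
  simp_rw [e] at h4
  exact h4.symm

theorem measurable_fourierCoeff {v : Tan d × AddCircle Θ → ℂ} (hv : StronglyMeasurable v) (k : ℤ) :
    Measurable fun y => fourierCoeff (fun θ => v (y, θ)) k := by
  have h : StronglyMeasurable (fun p : Tan d × AddCircle Θ => fourier (-k) p.2 • v p) :=
    (((fourier (-k)).continuous.comp continuous_snd).stronglyMeasurable).mul hv
  exact h.integral_prod_right.measurable

/-- Parseval's identity in `θ`, integrated over `y`. -/
theorem mul_tsum_lintegral_fourierCoeff {v : Tan d × AddCircle Θ → ℂ} (hv : StronglyMeasurable v)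
    (h2 : ∀ᵐ y : Tan d, MemLp (fun θ => v (y, θ)) 2 AddCircle.haarAddCircle) :
    ENNReal.ofReal Θ * ∑' k : ℤ, ∫⁻ y : Tan d, ‖fourierCoeff (fun θ => v (y, θ)) k‖ₑ ^ 2 =
      ∫⁻ p, ‖v p‖ₑ ^ 2 := by
  rw [← lintegral_tsum fun k => ((measurable_fourierCoeff hv k).enorm.pow_const 2).aemeasurable]
  have e : ∫⁻ p, ‖v p‖ₑ ^ 2 = ∫⁻ y : Tan d, ∫⁻ θ : AddCircle Θ, ‖v (y, θ)‖ₑ ^ 2 :=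
    lintegral_prod (μ := (volume : Measure (Tan d)))
      (ν := (volume : Measure (AddCircle Θ))) _ (hv.measurable.enorm.pow_const 2).aemeasurable
  rw [e]
  simp_rw [AddCircle.volume_eq_smul_haarAddCircle, lintegral_smul_measure, smul_eq_mul]
  rw [lintegral_const_mul' _ _ ENNReal.ofReal_ne_top]
  congr 1
  refine lintegral_congr_ae ?_
  filter_upwards [h2] with y hy
  exact tsum_enorm_sq_fourierCoeff hy

end Parseval

/-! ### The transform as an isometry up to the factor `√Θ`. -/

section Transform

variable {d : ℕ} {Θ : ℝ} [Fact (0 < Θ)]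

theorem period_pos (Θ : ℝ) [h : Fact (0 < Θ)] : 0 < Θ := h.out

theorem lintegral_volume_eq {F : Tan d × AddCircle Θ → ℝ≥0∞} (hF : Measurable F) :
    ∫⁻ p, F p = ENNReal.ofReal Θ *
      ∫⁻ y : Tan d, ∫⁻ θ : AddCircle Θ, F (y, θ) ∂AddCircle.haarAddCircle := by
  have e : ∫⁻ p, F p = ∫⁻ y : Tan d, ∫⁻ θ : AddCircle Θ, F (y, θ) :=
    lintegral_prod (μ := (volume : Measure (Tan d)))
      (ν := (volume : Measure (AddCircle Θ))) _ hF.aemeasurable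
  rw [e]
  simp_rw [AddCircle.volume_eq_smul_haarAddCircle, lintegral_smul_measure, smul_eq_mul]
  rw [lintegral_const_mul' _ _ ENNReal.ofReal_ne_top]

theorem ae_ae_of_ae_volume {p : Tan d × AddCircle Θ → Prop} (h : ∀ᵐ x, p x) :
    ∀ᵐ y : Tan d, ∀ᵐ θ ∂(AddCircle.haarAddCircle (T := Θ)), p (y, θ) := by
  filter_upwards [Measure.ae_ae_of_ae_prod (μ := (volume : Measure (Tan d)))
      (ν := (volume : Measure (AddCircle Θ))) h] with y hy
  rw [AddCircle.volume_eq_smul_haarAddCircle] at hy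
  exact (Measure.ae_ennreal_smul_measure_iff (by simpa using period_pos Θ)).1 hy

theorem stronglyMeasurable_ofReal_coe (u : L2 d Θ) :
    StronglyMeasurable fun p : Tan d × AddCircle Θ => ((u p : ℝ) : ℂ) :=
  Complex.continuous_ofReal.comp_stronglyMeasurable (Lp.stronglyMeasurable u)

theorem lintegral_enorm_sq_lt_top (u : L2 d Θ) :
    ∫⁻ p : Tan d × AddCircle Θ, ‖((u p : ℝ) : ℂ)‖ₑ ^ 2 < ∞ := by
  have := (eLpNorm_lt_top_iff_lintegral_rpow_enorm_lt_top (p := 2) (by norm_num) (by norm_num)).1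
      (Lp.memLp u).2
  refine lt_of_eq_of_lt (lintegral_congr fun p => ?_) this
  rw [← ofReal_norm, Complex.norm_real, ofReal_norm]
  simp

theorem memLp_slice {v : Tan d × AddCircle Θ → ℂ} (hv : StronglyMeasurable v)
    (h : ∫⁻ p, ‖v p‖ₑ ^ 2 < ∞) :
    ∀ᵐ y : Tan d, MemLp (fun θ => v (y, θ)) 2 (AddCircle.haarAddCircle (T := Θ)) := by
  rw [lintegral_volume_eq (hv.measurable.enorm.pow_const 2)] at h
  have hΘ : ENNReal.ofReal Θ ≠ 0 := by simpa using period_pos Θ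
  have h2 : ∫⁻ y : Tan d, ∫⁻ θ : AddCircle Θ, ‖v (y, θ)‖ₑ ^ 2 ∂AddCircle.haarAddCircle < ∞ :=
    (ENNReal.mul_lt_top_iff.1 h).elim (·.2) (·.elim (absurd · hΘ) (by simp +contextual))
  have hm : Measurable fun y : Tan d =>
      ∫⁻ θ : AddCircle Θ, ‖v (y, θ)‖ₑ ^ 2 ∂AddCircle.haarAddCircle :=
    (hv.measurable.enorm.pow_const 2).lintegral_prod_right'
  filter_upwards [ae_lt_top hm h2.ne] with y hy
  refine ⟨(hv.comp_measurable measurable_prodMk_left).aestronglyMeasurable, ?_⟩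
  rw [eLpNorm_lt_top_iff_lintegral_rpow_enorm_lt_top (by norm_num) (by norm_num)]
  simpa using hy

theorem mode_ae_eq (u : L2 d Θ) (k : ℤ) : mode u k =ᵐ[volume] modeFun u k :=
  (memLp_modeFun u k).coeFn_toLp

theorem modeFun_congr {u : L2 d Θ} {v : Tan d × AddCircle Θ → ℂ}
    (h : ∀ᵐ p, ((u p : ℝ) : ℂ) = v p) (k : ℤ) :
    modeFun u k =ᵐ[volume] fun y => fourierCoeff (fun θ => v (y, θ)) k := by
  filter_upwards [ae_ae_of_ae_volume h] with y hy
  exact congrFun (fourierCoeff_congr_ae hy) k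

theorem integrable_slice (u : L2 d Θ) :
    ∀ᵐ y : Tan d, Integrable (fun θ => ((u (y, θ) : ℝ) : ℂ))
      (AddCircle.haarAddCircle (T := Θ)) := by
  filter_upwards [memLp_slice (stronglyMeasurable_ofReal_coe u) (lintegral_enorm_sq_lt_top u)]
    with y hy using hy.integrable one_le_two

theorem mode_add (u v : L2 d Θ) (k : ℤ) : mode (u + v) k = mode u k + mode v k := by
  refine Lp.ext ?_
  have h : ∀ᵐ p, (((u + v : L2 d Θ) p : ℝ) : ℂ) = ((u p : ℝ) : ℂ) + ((v p : ℝ) : ℂ) := by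
    filter_upwards [Lp.coeFn_add u v] with p hp
    rw [hp]; simp
  filter_upwards [mode_ae_eq (u + v) k, mode_ae_eq u k, mode_ae_eq v k, modeFun_congr h k,
    integrable_slice u, integrable_slice v, Lp.coeFn_add (mode u k) (mode v k)]
    with y h1 h2 h3 h4 h5 h6 h7
  rw [h1, h7, Pi.add_apply, h2, h3, h4]
  exact congrFun (fourierCoeff.add h5 h6) k

theorem mode_smul (c : ℝ) (u : L2 d Θ) (k : ℤ) : mode (c • u) k = c • mode u k := by
  refine Lp.ext ?_
  have h : ∀ᵐ p, (((c • u : L2 d Θ) p : ℝ) : ℂ) = (c : ℂ) • ((u p : ℝ) : ℂ) := by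
    filter_upwards [Lp.coeFn_smul c u] with p hp
    rw [hp]; simp
  filter_upwards [mode_ae_eq (c • u) k, mode_ae_eq u k, modeFun_congr h k,
    Lp.coeFn_smul c (mode u k)] with y h1 h2 h3 h4
  rw [h1, h4, Pi.smul_apply, h2, h3, Complex.real_smul]
  exact fourierCoeff.const_smul _ _ _

theorem transform_add (u v : L2 d Θ) (k : ℤ) :
    transform (u + v) k = transform u k + transform v k := by
  rw [transform, mode_add]
  exact (Lp.fourierTransformₗᵢ (Tan d) ℂ).map_add _ _

theorem transform_smul (c : ℝ) (u : L2 d Θ) (k : ℤ) :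
    transform (c • u) k = c • transform u k := by
  rw [transform, mode_smul, real_smul_eq, real_smul_eq]
  exact (Lp.fourierTransformₗᵢ (Tan d) ℂ).map_smul _ _

theorem measurable_transform (u : L2 d Θ) :
    Measurable fun x : ℤ × Tan d => transform u x.1 x.2 :=
  measurable_from_prod_countable_right fun k => measurable_coe (transform u k)

theorem lintegral_enorm_sq_fourier {V : Type*} [NormedAddCommGroup V] [InnerProductSpace ℝ V]
    [FiniteDimensional ℝ V] [MeasurableSpace V] [BorelSpace V]
    (f : Lp ℂ 2 (volume : Measure V)) :
    ∫⁻ ξ, ‖(𝓕 f : Lp ℂ 2 (volume : Measure V)) ξ‖ₑ ^ 2 = ∫⁻ y, ‖f y‖ₑ ^ 2 := by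
  have h : ∀ g : Lp ℂ 2 (volume : Measure V), ∫⁻ ξ, ‖g ξ‖ₑ ^ 2 = ‖g‖ₑ ^ 2 := fun g => by
    rw [Lp.enorm_def, eLpNorm_two_eq, ← ENNReal.rpow_natCast, ← ENNReal.rpow_mul]
    norm_num
  refine (h (𝓕 f)).trans (Eq.trans ?_ (h f).symm)
  rw [← ofReal_norm, ← ofReal_norm, Lp.norm_fourier_eq]

/-- Plancherel in `y` for each mode, followed by Parseval in `θ`. The factor `Θ` relates the
Lebesgue measure of the circle to its normalized Haar measure. -/
theorem mul_lintegral_transform (u : L2 d Θ) :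
    ENNReal.ofReal Θ * ∫⁻ x : ℤ × Tan d, ‖transform u x.1 x.2‖ₑ ^ 2 ∂freq d =
      ∫⁻ p, ‖((u p : ℝ) : ℂ)‖ₑ ^ 2 := by
  rw [lintegral_freq ((measurable_transform u).enorm.pow_const 2)]
  refine Eq.trans ?_ (mul_tsum_lintegral_fourierCoeff (v := fun p => ((u p : ℝ) : ℂ))
    (stronglyMeasurable_ofReal_coe u) (memLp_slice (v := fun p => ((u p : ℝ) : ℂ))
      (stronglyMeasurable_ofReal_coe u) (lintegral_enorm_sq_lt_top u)))
  congr 1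
  refine tsum_congr fun k => ?_
  refine (lintegral_enorm_sq_fourier (mode u k)).trans (lintegral_congr_ae ?_)
  filter_upwards [mode_ae_eq u k] with y hy
  rw [hy, modeFun]

theorem memLp_transform (u : L2 d Θ) :
    MemLp (fun x : ℤ × Tan d => transform u x.1 x.2) 2 (freq d) := by
  refine ⟨(measurable_transform u).aestronglyMeasurable, ?_⟩
  rw [eLpNorm_lt_top_iff_lintegral_rpow_enorm_lt_top (by norm_num) (by norm_num)]
  have h := (mul_lintegral_transform u).trans_lt (lintegral_enorm_sq_lt_top u)
  have hΘ : ENNReal.ofReal Θ ≠ 0 := by simpa using period_pos Θ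
  have := (ENNReal.mul_lt_top_iff.1 h).elim (·.2) (·.elim (absurd · hΘ) (by simp +contextual))
  simpa using this

/-- The Fourier transform of a function on `ℝ^(d-1) × (ℝ/Θℤ)`. -/
def tr (u : L2 d Θ) : Lp ℂ 2 (freq d) := (memLp_transform u).toLp _

theorem coeFn_tr (u : L2 d Θ) : tr u =ᵐ[freq d] fun x => transform u x.1 x.2 :=
  (memLp_transform u).coeFn_toLp

theorem tr_section (u : L2 d Θ) (k : ℤ) : (fun ξ => tr u (k, ξ)) =ᵐ[volume] transform u k :=
  ae_freq.1 (coeFn_tr u) k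

theorem tr_eq_iff {u v : L2 d Θ} : tr u = tr v ↔ ∀ k, mode u k = mode v k := by
  constructor
  · intro h k
    have h1 : transform u k = transform v k := Lp.ext
      ((tr_section u k).symm.trans (by rw [h]; exact tr_section v k))
    exact (Lp.fourierTransformₗᵢ (Tan d) ℂ).injective h1
  · intro h
    have h1 : transform u = transform v := funext fun k => by rw [transform, h, transform]
    refine Lp.ext ((coeFn_tr u).trans (EventuallyEq.trans ?_ (coeFn_tr v).symm))
    rw [h1]

theorem tr_add (u v : L2 d Θ) : tr (u + v) = tr u + tr v := by
  refine Lp.ext (ae_freq.2 fun k => ?_)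
  filter_upwards [tr_section (u + v) k, tr_section u k, tr_section v k,
    Lp.coeFn_add (transform u k) (transform v k), ae_freq.1 (Lp.coeFn_add (tr u) (tr v)) k]
    with ξ h1 h2 h3 h4 h5
  rw [h1, h5, Pi.add_apply, h2, h3, transform_add, h4, Pi.add_apply]

theorem tr_smul (c : ℝ) (u : L2 d Θ) : tr (c • u) = c • tr u := by
  refine Lp.ext (ae_freq.2 fun k => ?_)
  filter_upwards [tr_section (c • u) k, tr_section u k, Lp.coeFn_smul c (transform u k),
    ae_freq.1 (Lp.coeFn_smul c (tr u)) k] with ξ h1 h2 h4 h5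
  rw [h1, h5, Pi.smul_apply, h2, transform_smul, h4, Pi.smul_apply]

theorem enorm_sq_tr (u : L2 d Θ) : ENNReal.ofReal Θ * ‖tr u‖ₑ ^ 2 = ‖u‖ₑ ^ 2 := by
  have h1 : ‖tr u‖ₑ ^ 2 = ∫⁻ x : ℤ × Tan d, ‖transform u x.1 x.2‖ₑ ^ 2 ∂freq d := by
    rw [Lp.enorm_def, eLpNorm_congr_ae (coeFn_tr u), eLpNorm_two_eq, ← ENNReal.rpow_natCast,
      ← ENNReal.rpow_mul]
    norm_num
  rw [h1, mul_lintegral_transform, Lp.enorm_def, eLpNorm_two_eq, ← ENNReal.rpow_natCast,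
    ← ENNReal.rpow_mul]
  norm_num
  refine lintegral_congr fun p => ?_
  rw [← ofReal_norm, Complex.norm_real, ofReal_norm]

theorem norm_tr (u : L2 d Θ) : √Θ * ‖tr u‖ = ‖u‖ := by
  have h := congrArg ENNReal.toReal (enorm_sq_tr u)
  rw [ENNReal.toReal_mul, ENNReal.toReal_pow, ENNReal.toReal_pow, toReal_enorm, toReal_enorm,
    ENNReal.toReal_ofReal (period_pos Θ).le] at h
  rw [← Real.sqrt_sq (norm_nonneg (tr u)), ← Real.sqrt_mul (period_pos Θ).le, h,
    Real.sqrt_sq (norm_nonneg _)]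

variable (d Θ) in
/-- The Fourier transform as a continuous real-linear map. -/
def trL : L2 d Θ →L[ℝ] Lp ℂ 2 (freq d) :=
  LinearMap.mkContinuous ⟨⟨tr, tr_add⟩, tr_smul⟩ (√Θ)⁻¹ fun u => by
    have : 0 < √Θ := Real.sqrt_pos.2 (period_pos Θ)
    change ‖tr u‖ ≤ _
    rw [← norm_tr u, inv_mul_cancel_left₀ this.ne']

theorem tr_sub (u v : L2 d Θ) : tr (u - v) = tr u - tr v := (trL d Θ).map_sub u v

theorem tr_neg (u : L2 d Θ) : tr (-u) = -tr u := (trL d Θ).map_neg u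

theorem tr_injective : Function.Injective (tr : L2 d Θ → Lp ℂ 2 (freq d)) := fun u v h => by
  have h1 := norm_tr (u - v)
  rw [tr_sub, h, sub_self, norm_zero, mul_zero] at h1
  exact sub_eq_zero.1 (norm_eq_zero.1 h1.symm)

theorem mode_neg_index (u : L2 d Θ) (k : ℤ) : mode u (-k) = starL volume (mode u k) := by
  refine Lp.ext ?_
  filter_upwards [mode_ae_eq u (-k), mode_ae_eq u k, coeFn_starL (mode u k)] with y h1 h2 h3
  rw [h1, h3, h2, modeFun, modeFun, fourierCoeff, fourierCoeff, ← integral_conj]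
  refine integral_congr_ae (.of_forall fun θ => ?_)
  simp only [smul_eq_mul, map_mul, Complex.conj_ofReal, fourier_neg, Complex.conj_conj]

/-- For real `u` the modes `k` and `-k` are conjugate, and the Fourier transform in `y` turns
conjugation into conjugation composed with reflection. -/
theorem isReal_tr (u : L2 d Θ) : IsReal (tr u) := by
  refine ae_freq.2 fun k => ?_
  have h : transform u (-k) = conjL volume (transform u k) := by
    rw [transform, mode_neg_index, fourier_starL, transform]
  have h2 : (fun ξ => transform u (-k) ξ) =ᵐ[volume] conjL volume (transform u k) := by rw [h]
  filter_upwards [tr_section u k, ae_neg (tr_section u (-k)), ae_neg h2,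
    ae_neg (coeFn_conjL (transform u k))] with ξ e1 e2 e3 e4
  have : -((k, ξ) : ℤ × Tan d) = (-k, -ξ) := rfl
  rw [this, e1, e2, e3, e4, neg_neg]

theorem sobolevNorm_eq (ν : ℕ) (u : L2 d Θ) : sobolevNorm ν u =
    ENNReal.ofReal √Θ * eLpNorm (fun x => sobolevBracket d Θ x ^ ν • tr u x) 2 (freq d) := by
  have h1 : eLpNorm (fun x => sobolevBracket d Θ x ^ ν • tr u x) 2 (freq d) =
      eLpNorm (fun x : ℤ × Tan d => sobolevBracket d Θ x ^ ν • transform u x.1 x.2) 2 (freq d) := by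
    refine eLpNorm_congr_ae ?_
    filter_upwards [coeFn_tr u] with x hx
    rw [hx]
  have hm : Measurable fun x : ℤ × Tan d => sobolevBracket d Θ x ^ ν • transform u x.1 x.2 :=
    ((sobolevBracket d Θ).measurable.pow_const ν).smul (measurable_transform u)
  rw [h1, eLpNorm_two_eq, lintegral_freq (hm.enorm.pow_const 2), sobolevNorm,
    ENNReal.mul_rpow_of_nonneg _ _ (by norm_num), Real.sqrt_eq_rpow,
    ENNReal.ofReal_rpow_of_nonneg (period_pos Θ).le (by norm_num)]
  congr 2
  refine tsum_congr fun k => lintegral_congr fun ξ => ?_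
  have hb := (sobolevBracket d Θ).nonneg (k, ξ)
  have hs : (sobolevBracket d Θ (k, ξ)) ^ 2 = _ := japanese_sq (Θ := Θ) (k, ξ)
  rw [enorm_smul, mul_pow ‖sobolevBracket d Θ (k, ξ) ^ ν‖ₑ, ← ofReal_norm (_ ^ ν), Real.norm_of_nonneg (pow_nonneg hb ν),
    ← ENNReal.ofReal_pow (pow_nonneg hb ν), ← pow_mul, mul_comm ν 2, pow_mul, hs]

end Transform

/-! ### Synthesis of functions from integrable transforms, and the inversion formula. -/

section Synthesis

variable {d : ℕ} {Θ : ℝ} [Fact (0 < Θ)]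

/-- The character `exp(2πi(y·ξ + kθ/Θ))`. -/
def chi (p : Tan d × AddCircle Θ) (x : ℤ × Tan d) : ℂ :=
  (Real.fourierChar (inner ℝ x.2 p.1) : ℂ) * fourier x.1 p.2

theorem norm_chi (p : Tan d × AddCircle Θ) (x : ℤ × Tan d) : ‖chi p x‖ = 1 := by
  rw [chi, norm_mul, Circle.norm_coe, fourier_apply, Circle.norm_coe, one_mul]

theorem chi_add (p : Tan d × AddCircle Θ) (x y : ℤ × Tan d) :
    chi p (x + y) = chi p x * chi p y := by
  simp only [chi, Prod.snd_add, Prod.fst_add, inner_add_left, AddChar.map_add_eq_mul, fourier_add,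
    Circle.coe_mul]
  ring

theorem chi_neg (p : Tan d × AddCircle Θ) (x : ℤ × Tan d) :
    chi p (-x) = (starRingEnd ℂ) (chi p x) := by
  simp only [chi, Prod.snd_neg, Prod.fst_neg, inner_neg_left, AddChar.map_neg_eq_inv, fourier_neg,
    Circle.coe_inv_eq_conj, map_mul]

theorem measurable_chi : Measurable fun q : (Tan d × AddCircle Θ) × (ℤ × Tan d) => chi q.1 q.2 := by
  have h0 : Continuous fun q : Tan d × Tan d => (Real.fourierChar (inner ℝ q.1 q.2) : ℂ) :=
    continuous_subtype_val.comp (Real.continuous_fourierChar.comp continuous_inner)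
  have h1 : Measurable fun q : (Tan d × AddCircle Θ) × (ℤ × Tan d) =>
      (Real.fourierChar (inner ℝ q.2.2 q.1.1) : ℂ) :=
    h0.measurable.comp
      (f := fun q : (Tan d × AddCircle Θ) × (ℤ × Tan d) => (q.2.2, q.1.1))
      (measurable_snd.snd.prodMk measurable_fst.fst)
  have h2 : Measurable fun q : ℤ × AddCircle Θ => (fourier q.1 q.2 : ℂ) :=
    measurable_from_prod_countable_right fun k => (fourier k).continuous.measurable
  have h3 : Measurable fun q : (Tan d × AddCircle Θ) × (ℤ × Tan d) => (fourier q.2.1 q.1.2 : ℂ) :=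
    h2.comp (f := fun q : (Tan d × AddCircle Θ) × (ℤ × Tan d) => (q.2.1, q.1.2))
      (measurable_snd.fst.prodMk measurable_fst.snd)
  exact h1.mul h3

theorem measurable_chi_apply (p : Tan d × AddCircle Θ) : Measurable (chi p) :=
  measurable_chi.comp (f := fun x : ℤ × Tan d => (p, x)) measurable_prodMk_left

theorem integrable_chi_mul (p : Tan d × AddCircle Θ) {f : ℤ × Tan d → ℂ}
    (hf : Integrable f (freq d)) : Integrable (fun x => chi p x * f x) (freq d) :=
  hf.bdd_mul (measurable_chi_apply p).aestronglyMeasurable (.of_forall fun x => (norm_chi p x).le)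

/-- The function with Fourier transform `f`. -/
def synth (f : ℤ × Tan d → ℂ) (p : Tan d × AddCircle Θ) : ℂ := ∫ x, chi p x * f x ∂freq d

theorem synth_congr {f g : ℤ × Tan d → ℂ} (h : f =ᵐ[freq d] g) (p : Tan d × AddCircle Θ) :
    synth f p = synth g p := by
  refine integral_congr_ae ?_
  filter_upwards [h] with x hx
  rw [hx]

theorem norm_synth_le (f : ℤ × Tan d → ℂ) (p : Tan d × AddCircle Θ) :
    ‖synth f p‖ ≤ ∫ x, ‖f x‖ ∂freq d := by
  refine (norm_integral_le_integral_norm _).trans_eq ?_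
  simp_rw [norm_mul, norm_chi, one_mul]

theorem stronglyMeasurable_synth {f : ℤ × Tan d → ℂ} (hf : Measurable f) :
    StronglyMeasurable (synth f : Tan d × AddCircle Θ → ℂ) := by
  have h : Measurable fun q : (Tan d × AddCircle Θ) × (ℤ × Tan d) => chi q.1 q.2 * f q.2 :=
    measurable_chi.mul (hf.comp measurable_snd)
  exact h.stronglyMeasurable.integral_prod_right'

theorem conj_synth {f : ℤ × Tan d → ℂ} (hf : ∀ᵐ x ∂freq d, f (-x) = (starRingEnd ℂ) (f x))
    (p : Tan d × AddCircle Θ) : (starRingEnd ℂ) (synth f p) = synth f p := by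
  rw [synth, ← integral_conj, ← integral_neg_eq_self]
  refine integral_congr_ae ?_
  filter_upwards [hf] with x hx
  simp [chi_neg, hx]

theorem integrable_section {f : ℤ × Tan d → ℂ} (hf : Integrable f (freq d)) (k : ℤ) :
    Integrable fun ξ => f (k, ξ) :=
  Measure.ae_count_iff.1 hf.prod_right_ae k

theorem hasSum_integral_freq {f : ℤ × Tan d → ℂ} (hf : Integrable f (freq d)) :
    HasSum (fun k => ∫ ξ, f (k, ξ)) (∫ x, f x ∂freq d) := by
  rw [integral_prod _ hf]
  have h := hf.integral_prod_left
  rw [show (Measure.count : Measure ℤ) = Measure.sum Measure.dirac from rfl] at h ⊢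
  simpa using hasSum_integral_measure h

/-- Fubini, after which orthogonality of the characters of the circle selects the single frequency
`k` and leaves the inverse transform in `ξ`. -/
theorem fourierCoeff_synth {f : ℤ × Tan d → ℂ} (hf : Integrable f (freq d)) (hm : Measurable f)
    (k : ℤ) (y : Tan d) :
    fourierCoeff (fun θ : AddCircle Θ => synth f (y, θ)) k = 𝓕⁻ (fun ξ => f (k, ξ)) y := by
  have hint : Integrable (fun q : AddCircle Θ × (ℤ × Tan d) =>
      fourier (-k) q.1 * (chi (y, q.1) q.2 * f q.2))
      ((AddCircle.haarAddCircle (T := Θ)).prod (freq d)) := by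
    have h0 : Integrable (fun q : AddCircle Θ × (ℤ × Tan d) => f q.2)
        ((AddCircle.haarAddCircle (T := Θ)).prod (freq d)) := hf.comp_snd _
    refine h0.mono ?_ (.of_forall fun q => ?_)
    · have h1 : Measurable fun q : AddCircle Θ × (ℤ × Tan d) => fourier (-k) q.1 :=
        (fourier (-k)).continuous.measurable.comp measurable_fst
      have h2 : Measurable fun q : AddCircle Θ × (ℤ × Tan d) => chi (y, q.1) q.2 :=
        measurable_chi.comp (f := fun q : AddCircle Θ × (ℤ × Tan d) => ((y, q.1), q.2))
          ((measurable_const.prodMk measurable_fst).prodMk measurable_snd)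
      exact (h1.mul (h2.mul (hm.comp measurable_snd))).aestronglyMeasurable
    · rw [norm_mul, norm_mul, norm_chi, fourier_apply, Circle.norm_coe, one_mul, one_mul]
  have e1 : fourierCoeff (fun θ : AddCircle Θ => synth f (y, θ)) k =
      ∫ x, ∫ θ, fourier (-k) θ * (chi (y, θ) x * f x) ∂(AddCircle.haarAddCircle (T := Θ))
        ∂freq d := by
    rw [← integral_integral_swap hint, fourierCoeff]
    refine integral_congr_ae (.of_forall fun θ => ?_)
    simp only [synth, smul_eq_mul]
    rw [← integral_const_mul]
  have e2 : ∀ x : ℤ × Tan d,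
      ∫ θ, fourier (-k) θ * (chi (y, θ) x * f x) ∂(AddCircle.haarAddCircle (T := Θ)) =
      if x.1 = k then (Real.fourierChar (inner ℝ x.2 y) : ℂ) * f x else 0 := by
    intro x
    have h : ∫ θ, fourier (-k) θ * (chi (y, θ) x * f x) ∂(AddCircle.haarAddCircle (T := Θ)) =
        (Real.fourierChar (inner ℝ x.2 y) : ℂ) * f x *
          fourierCoeff (fun θ : AddCircle Θ => fourier x.1 θ) k := by
      rw [fourierCoeff, ← integral_const_mul]
      refine integral_congr_ae (.of_forall fun θ => ?_)
      simp only [chi, smul_eq_mul]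
      ring
    have h2 := fourierCoeff_fourier (T := Θ) x.1
    rw [h, show fourierCoeff (fun θ : AddCircle Θ => fourier x.1 θ) k = _ from congrFun h2 k]
    by_cases hx : x.1 = k
    · subst hx; simp
    · rw [if_neg hx, Pi.single_eq_of_ne (Ne.symm hx), mul_zero]
  have e3 := hint.integral_prod_right
  simp_rw [e2] at e1 e3
  rw [e1]
  refine (hasSum_integral_freq e3).unique ?_
  have h : (fun l => ∫ ξ, if ((l, ξ) : ℤ × Tan d).1 = k then
      (Real.fourierChar (inner ℝ ((l, ξ) : ℤ × Tan d).2 y) : ℂ) * f (l, ξ) else 0) =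
      fun l => if l = k then 𝓕⁻ (fun ξ => f (k, ξ)) y else 0 := by
    ext l
    by_cases hl : l = k
    · subst hl
      simp [Real.fourierInv_eq, Circle.smul_def]
    · simp [hl]
  rw [h]
  exact hasSum_ite_eq k _

theorem lintegral_enorm_sq_freq_lt_top (f : Lp ℂ 2 (freq d)) :
    ∫⁻ x, ‖f x‖ₑ ^ 2 ∂freq d < ∞ := by
  have := (eLpNorm_lt_top_iff_lintegral_rpow_enorm_lt_top (p := 2) (by norm_num) (by norm_num)).1
    (Lp.memLp f).2
  simpa using this

theorem measurable_section {f : ℤ × Tan d → ℂ} (hf : Measurable f) (k : ℤ) :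
    Measurable fun ξ => f (k, ξ) := hf.comp measurable_prodMk_left

theorem memLp_section (f : Lp ℂ 2 (freq d)) (k : ℤ) :
    MemLp (fun ξ => f (k, ξ)) 2 (volume : Measure (Tan d)) := by
  refine ⟨(measurable_section (measurable_coe f) k).aestronglyMeasurable, ?_⟩
  rw [eLpNorm_lt_top_iff_lintegral_rpow_enorm_lt_top (by norm_num) (by norm_num)]
  have h := lintegral_enorm_sq_freq_lt_top f
  rw [lintegral_freq ((measurable_coe f).enorm.pow_const 2)] at h
  simpa using (ENNReal.le_tsum k).trans_lt h

theorem fourierInv_section_ae_eq {f : Lp ℂ 2 (freq d)} (h1 : Integrable f (freq d)) (k : ℤ) :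
    (𝓕⁻ ((memLp_section f k).toLp _) : Lp ℂ 2 (volume : Measure (Tan d))) =ᵐ[volume]
      𝓕⁻ (fun ξ => f (k, ξ)) :=
  fourierInv_toLp_ae_eq (integrable_section h1 k) (memLp_section f k)

theorem lintegral_enorm_sq_fourierInv_section {f : Lp ℂ 2 (freq d)}
    (h1 : Integrable f (freq d)) (k : ℤ) :
    ∫⁻ y, ‖𝓕⁻ (fun ξ => f (k, ξ)) y‖ₑ ^ 2 = ∫⁻ ξ, ‖f (k, ξ)‖ₑ ^ 2 := by
  set g := (memLp_section f k).toLp _ with hg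
  have h2 := lintegral_enorm_sq_fourier (𝓕⁻ g : Lp ℂ 2 (volume : Measure (Tan d)))
  have h3 : 𝓕 (𝓕⁻ g) = g := fourier_fourierInv_eq g
  rw [h3] at h2
  refine Eq.trans (Eq.trans ?_ h2.symm) ?_
  · refine lintegral_congr_ae ?_
    filter_upwards [fourierInv_section_ae_eq h1 k] with y hy
    rw [hy]
  · refine lintegral_congr_ae ?_
    filter_upwards [(memLp_section f k).coeFn_toLp] with y hy
    rw [hy]

theorem lintegral_enorm_sq_synth_lt_top {f : Lp ℂ 2 (freq d)} (h1 : Integrable f (freq d)) :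
    ∫⁻ p : Tan d × AddCircle Θ, ‖synth f p‖ₑ ^ 2 < ∞ := by
  have hs := stronglyMeasurable_synth (Θ := Θ) (measurable_coe f)
  -- Integrability of `f` makes the synthesis bounded, so every slice is square integrable on the
  -- circle and Parseval applies without presupposing the conclusion.
  have hb : ∀ y : Tan d, MemLp (fun θ : AddCircle Θ => synth f (y, θ)) 2
      AddCircle.haarAddCircle := fun y =>
    MemLp.of_bound (hs.comp_measurable measurable_prodMk_left).aestronglyMeasurable _
      (.of_forall fun θ => norm_synth_le _ _)
  refine (mul_tsum_lintegral_fourierCoeff hs (.of_forall hb)).symm.trans_lt ?_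
  simp_rw [fourierCoeff_synth h1 (measurable_coe f), lintegral_enorm_sq_fourierInv_section h1]
  rw [← lintegral_freq ((measurable_coe f).enorm.pow_const 2)]
  exact ENNReal.mul_lt_top ENNReal.ofReal_lt_top (lintegral_enorm_sq_freq_lt_top f)

theorem mode_ae_eq_of_synth {f : Lp ℂ 2 (freq d)} (h1 : Integrable f (freq d)) {u : L2 d Θ}
    (hu : ∀ᵐ p, ((u p : ℝ) : ℂ) = synth f p) (k : ℤ) :
    mode u k =ᵐ[volume] 𝓕⁻ (fun ξ => f (k, ξ)) := by
  filter_upwards [mode_ae_eq u k, modeFun_congr hu k] with y e1 e2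
  rw [e1, e2, fourierCoeff_synth h1 (measurable_coe f)]

theorem tr_eq_of_synth {f : Lp ℂ 2 (freq d)} (h1 : Integrable f (freq d)) {u : L2 d Θ}
    (hu : ∀ᵐ p, ((u p : ℝ) : ℂ) = synth f p) : tr u = f := by
  refine Lp.ext (ae_freq.2 fun k => ?_)
  have h : mode u k = 𝓕⁻ ((memLp_section f k).toLp _) :=
    Lp.ext ((mode_ae_eq_of_synth h1 hu k).trans (fourierInv_section_ae_eq h1 k).symm)
  have h2 : transform u k = (memLp_section f k).toLp _ := by
    rw [transform, h]
    exact fourier_fourierInv_eq _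
  have h3 : (fun ξ => transform u k ξ) =ᵐ[volume] fun ξ => f (k, ξ) := by
    rw [h2]
    exact (memLp_section f k).coeFn_toLp
  exact (tr_section u k).trans h3

variable (Θ) in
/-- Every integrable and square integrable conjugate-symmetric function is a transform. -/
theorem exists_tr_eq {f : Lp ℂ 2 (freq d)} (hf : IsReal f) (h1 : Integrable f (freq d)) :
    ∃ u : L2 d Θ, tr u = f ∧ ∀ᵐ p, ((u p : ℝ) : ℂ) = synth f p := by
  have hs := stronglyMeasurable_synth (Θ := Θ) (measurable_coe f)
  have hre : ∀ p : Tan d × AddCircle Θ, (((synth f p).re : ℝ) : ℂ) = synth f p := fun p =>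
    Complex.conj_eq_iff_re.1 (conj_synth hf p)
  have hm : MemLp (fun p : Tan d × AddCircle Θ => (synth f p).re) 2 volume := by
    refine ⟨(Complex.continuous_re.comp_stronglyMeasurable hs).aestronglyMeasurable, ?_⟩
    rw [eLpNorm_lt_top_iff_lintegral_rpow_enorm_lt_top (by norm_num) (by norm_num)]
    refine lt_of_eq_of_lt (lintegral_congr fun p => ?_) (lintegral_enorm_sq_synth_lt_top h1)
    rw [← hre p, ← ofReal_norm, ← ofReal_norm, Complex.norm_real]
    simp
  have hu : ∀ᵐ p, ((hm.toLp _ p : ℝ) : ℂ) = synth f p := by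
    filter_upwards [hm.coeFn_toLp] with p hp
    rw [hp, hre]
  exact ⟨hm.toLp _, tr_eq_of_synth h1 hu, hu⟩

/-- The inversion formula: the function synthesized from `tr u` has the same transform as `u`, and
the transform is injective. -/
theorem ae_eq_synth {u : L2 d Θ} (h1 : Integrable (tr u) (freq d)) :
    ∀ᵐ p, ((u p : ℝ) : ℂ) = synth (tr u) p := by
  obtain ⟨v, hv, hs⟩ := exists_tr_eq Θ (isReal_tr u) h1
  rwa [tr_injective hv] at hs

theorem mode_ae_eq_fourierInv {u : L2 d Θ} (h1 : Integrable (tr u) (freq d)) (k : ℤ) :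
    mode u k =ᵐ[volume] 𝓕⁻ (fun ξ => tr u (k, ξ)) :=
  mode_ae_eq_of_synth h1 (ae_eq_synth h1) k

/-! ### Products -/

/-- The convolution theorem: characters are multiplicative in the frequency, and Fubini applies
because both transforms are integrable. -/
theorem synth_mul_synth {f g : ℤ × Tan d → ℂ} (hf : Integrable f (freq d))
    (hg : Integrable g (freq d)) (p : Tan d × AddCircle Θ) :
    synth f p * synth g p = synth (pseudo (freq d) (fun _ _ => 1) f g) p := by
  have h : Integrable (Function.uncurry fun x y : ℤ × Tan d =>
      chi p (x - y) * f (x - y) * (chi p y * g y)) ((freq d).prod (freq d)) :=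
    (measurePreserving_sub_prod (freq d) (freq d)).integrable_comp_of_integrable
      ((integrable_chi_mul p hf).mul_prod (integrable_chi_mul p hg))
  have e1 : synth (pseudo (freq d) (fun _ _ => 1) f g) p =
      ∫ x, ∫ y, chi p (x - y) * f (x - y) * (chi p y * g y) ∂freq d ∂freq d := by
    refine integral_congr_ae (.of_forall fun x => ?_)
    simp only [pseudo]
    rw [← integral_const_mul]
    refine integral_congr_ae (.of_forall fun y => ?_)
    have := chi_add p (x - y) y
    rw [sub_add_cancel] at this
    simp only [this]
    ring
  rw [e1, integral_integral_swap h]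
  simp_rw [integral_mul_const]
  have e2 : ∀ y, ∫ x, chi p (x - y) * f (x - y) ∂freq d = synth f p := fun y =>
    integral_sub_right_eq_self (fun x => chi p x * f x) y
  simp_rw [e2]
  rw [integral_const_mul]
  rfl

theorem integrable_kernel_section {K : (ℤ × Tan d) × (ℤ × Tan d) → ℂ}
    (hK : Integrable K ((freq d).prod (freq d))) (k : ℤ) :
    Integrable (fun q : Tan d × (ℤ × Tan d) => K ((k, q.1), q.2))
      ((volume : Measure (Tan d)).prod (freq d)) := by
  have h := ((measurePreserving_prodAssoc (Measure.count : Measure ℤ)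
    (volume : Measure (Tan d)) (freq d)).symm).integrable_comp_of_integrable hK
  exact Measure.ae_count_iff.1 h.prod_right_ae k

theorem fourierInv_comp_sub (f : Tan d → ℂ) (η y : Tan d) :
    ∫ ξ, (Real.fourierChar (inner ℝ ξ y) : ℂ) * f (ξ - η) =
      (Real.fourierChar (inner ℝ η y) : ℂ) * 𝓕⁻ f y := by
  rw [← integral_add_right_eq_self _ η, Real.fourierInv_eq, ← integral_const_mul]
  refine integral_congr_ae (.of_forall fun ξ => ?_)
  simp only [add_sub_cancel_right, inner_add_left, AddChar.map_add_eq_mul, Circle.coe_mul,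
    Circle.smul_def, smul_eq_mul]
  ring

/-- The coefficients of a bilinear Fourier multiplier acting in `θ` only. -/
theorem hasSum_fourierInv_pseudo {n : ℤ → ℤ → ℂ} {f g : ℤ × Tan d → ℂ}
    (hint : Integrable (fun q : (ℤ × Tan d) × (ℤ × Tan d) =>
      n (q.1 - q.2).1 q.2.1 * (f (q.1 - q.2) * g q.2)) ((freq d).prod (freq d)))
    (k : ℤ) (y : Tan d) :
    HasSum (fun l => n (k - l) l * (𝓕⁻ (fun ξ => f (k - l, ξ)) y * 𝓕⁻ (fun ξ => g (l, ξ)) y))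
      (𝓕⁻ (fun ξ => pseudo (freq d) (fun x y => n x.1 y.1) f g (k, ξ)) y) := by
  have h1 : Integrable (Function.uncurry fun (ξ : Tan d) (z : ℤ × Tan d) =>
      (Real.fourierChar (inner ℝ ξ y) : ℂ) *
        (n (k - z.1) z.1 * (f (k - z.1, ξ - z.2) * g z)))
      ((volume : Measure (Tan d)).prod (freq d)) := by
    refine (integrable_kernel_section hint k).bdd_mul (c := 1) ?_ (.of_forall fun q => ?_)
    · have h0 : Continuous fun ξ : Tan d => (Real.fourierChar (inner ℝ ξ y) : ℂ) :=
        continuous_subtype_val.comp (Real.continuous_fourierChar.comp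
          (continuous_id.inner continuous_const))
      exact (h0.measurable.comp measurable_fst).aestronglyMeasurable
    · exact (Circle.norm_coe _).le
  have e1 : 𝓕⁻ (fun ξ => pseudo (freq d) (fun x y => n x.1 y.1) f g (k, ξ)) y =
      ∫ ξ, ∫ z : ℤ × Tan d, (Real.fourierChar (inner ℝ ξ y) : ℂ) *
        (n (k - z.1) z.1 * (f (k - z.1, ξ - z.2) * g z)) ∂freq d := by
    rw [Real.fourierInv_eq]
    refine integral_congr_ae (.of_forall fun ξ => ?_)
    simp only [pseudo, Circle.smul_def, smul_eq_mul]
    rw [← integral_const_mul]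
    rfl
  have e2 : ∀ z : ℤ × Tan d, ∫ ξ, (Real.fourierChar (inner ℝ ξ y) : ℂ) *
        (n (k - z.1) z.1 * (f (k - z.1, ξ - z.2) * g z)) =
      n (k - z.1) z.1 * 𝓕⁻ (fun ξ => f (k - z.1, ξ)) y *
        ((Real.fourierChar (inner ℝ z.2 y) : ℂ) * g z) := by
    intro z
    have := fourierInv_comp_sub (fun ξ => f (k - z.1, ξ)) z.2 y
    calc _ = ∫ ξ, n (k - z.1) z.1 * g z *
          ((Real.fourierChar (inner ℝ ξ y) : ℂ) * f (k - z.1, ξ - z.2)) :=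
          integral_congr_ae (.of_forall fun ξ => by ring)
      _ = _ := by rw [integral_const_mul, this]; ring
  have h2 := h1.integral_prod_right
  rw [e1, integral_integral_swap h1]
  simp only [Function.uncurry_apply_pair] at h2
  simp_rw [e2] at h2 ⊢
  have h3 : ∀ l : ℤ, ∫ ξ : Tan d, n (k - l) l * 𝓕⁻ (fun ξ => f (k - l, ξ)) y *
      ((Real.fourierChar (inner ℝ ξ y) : ℂ) * g (l, ξ)) =
      n (k - l) l * (𝓕⁻ (fun ξ => f (k - l, ξ)) y * 𝓕⁻ (fun ξ => g (l, ξ)) y) := fun l => by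
    rw [integral_const_mul, mul_assoc, Real.fourierInv_eq (fun ξ => g (l, ξ))]
    rfl
  simp_rw [← h3]
  exact hasSum_integral_freq h2

end Synthesis

/-! ### Integrability of the transforms at base regularity. -/

section Lower

variable {G : Type*} [AddCommGroup G] [MeasurableSpace G] {μ : Measure G} {b : Bracket μ} {s : ℕ}
  [MeasurableAdd₂ G] [MeasurableNeg G] [SFinite μ] [μ.IsAddLeftInvariant] [μ.IsNegInvariant]

theorem integrable_pow_smul_lower (b : Bracket μ) {j : ℕ} (hj : j + b.σ ≤ s) (h : Lp ℂ 2 μ) :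
    Integrable (fun x => b x ^ j • lower b s h x) μ := by
  rw [← memLp_one_iff_integrable]
  refine ⟨((b.measurable.pow_const j).smul
    (measurable_lower b s (measurable_coe h))).aestronglyMeasurable, ?_⟩
  exact (eLpNorm_one_pow_lower_le b hj (measurable_coe h)).trans_lt
    (ENNReal.mul_lt_top b.finite (Lp.memLp h).2)

theorem integrable_lower (b : Bracket μ) (hs : b.σ ≤ s) (h : Lp ℂ 2 μ) :
    Integrable (lower b s h) μ := by
  simpa using integrable_pow_smul_lower b (j := 0) (by omega) h

theorem TransportSymbol.coeFn_transL (Ω : TransportSymbol b) (hs : 1 ≤ s) (h : Lp ℂ 2 μ) :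
    Ω.transL s h =ᵐ[μ] fun x => Complex.I * Ω.ω x * lower b s h x := by
  filter_upwards [coeFn_mulL (Ω.isBdd hs) h] with x hx
  refine hx.trans ?_
  rw [lower, Complex.real_smul]
  push_cast
  ring

theorem TransportSymbol.integrable_transL (Ω : TransportSymbol b) (hs : 1 + b.σ ≤ s)
    (h : Lp ℂ 2 μ) : Integrable (Ω.transL s h) μ := by
  have h1 := ((integrable_pow_smul_lower b hs h).norm.const_mul |Ω.c|)
  refine h1.mono' (Lp.aestronglyMeasurable _) ?_
  filter_upwards [Ω.coeFn_transL (s := s) (by omega) h] with x hx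
  rw [hx, norm_mul, norm_mul, Complex.norm_I, one_mul, Complex.norm_real, pow_one, norm_smul,
    Real.norm_eq_abs, Real.norm_of_nonneg (b.nonneg x), ← mul_assoc]
  refine mul_le_mul_of_nonneg_right ((Ω.ω_le x).trans ?_) (norm_nonneg _)
  exact mul_le_mul_of_nonneg_right (le_abs_self _) (b.nonneg x)

/-- The symbol is at most `4 A b(x)^M b(y)`, so the kernel is dominated by a product of two
integrable functions after a shear preserving the measure. It justifies Fubini for the bilinear
terms. -/
theorem BurgersSymbol.integrable_kernel_prod (S : BurgersSymbol b) (hs : S.M + b.σ ≤ s)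
    (h k : Lp ℂ 2 μ) :
    Integrable (fun q : G × G =>
      S.m (q.1 - q.2) q.2 * (lower b s h (q.1 - q.2) * lower b s k q.2)) (μ.prod μ) := by
  have hM := S.one_le_M
  have h1 := (measurePreserving_sub_prod μ μ).integrable_comp_of_integrable
    ((integrable_pow_smul_lower b hs h).norm.mul_prod
      (integrable_pow_smul_lower (s := s) b (j := 1) (by omega) k).norm)
  refine (h1.const_mul (4 * S.A)).mono' ?_ (.of_forall fun q => ?_)
  · have hsub : Measurable fun q : G × G => q.1 - q.2 := measurable_fst.sub measurable_snd
    have e1 : Measurable fun q : G × G => S.m (q.1 - q.2) q.2 :=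
      S.measurable_m.comp (hsub.prodMk measurable_snd)
    have e2 : Measurable fun q : G × G => lower b s h (q.1 - q.2) :=
      (measurable_lower b s (measurable_coe h)).comp hsub
    have e3 : Measurable fun q : G × G => lower b s k q.2 :=
      (measurable_lower b s (measurable_coe k)).comp measurable_snd
    exact (e1.mul (e2.mul e3)).aestronglyMeasurable
  · simp only [Function.comp_apply, norm_smul, norm_mul, norm_pow,
      Real.norm_of_nonneg (b.nonneg _), pow_one]
    have := mul_le_mul_of_nonneg_right (S.norm_le_mul (q.1 - q.2) q.2)
      (mul_nonneg (norm_nonneg (lower b s h (q.1 - q.2))) (norm_nonneg (lower b s k q.2)))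
    linarith

theorem BurgersSymbol.integrable_bilL (S : BurgersSymbol b) (hs : S.M + b.σ ≤ s)
    (h k : Lp ℂ 2 μ) : Integrable (S.bilL hs h k) μ :=
  ((S.integrable_kernel_prod hs h k).integral_prod_left).congr (S.coeFn_bilL hs h k).symm

end Lower

/-! ### The symbols of the terms of the equation. -/

section Terms

variable {d : ℕ} {Θ : ℝ} [Fact (0 < Θ)]

variable (d Θ) in
/-- The symbol of `∂_θ` divided by `i`. -/
def thetaFreq (x : ℤ × Tan d) : ℝ := 2 * Real.pi * x.1 / Θ

theorem measurable_thetaFreq : Measurable (thetaFreq d Θ) := by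
  have h1 : Measurable fun x : ℤ × Tan d => (x.1 : ℝ) :=
    (measurable_from_top (f := fun k : ℤ => (k : ℝ))).comp measurable_fst
  unfold thetaFreq
  fun_prop

theorem abs_thetaFreq_le (x : ℤ × Tan d) : |thetaFreq d Θ x| ≤ sobolevBracket d Θ x :=
  abs_fst_le_japanese x

variable (d Θ) in
def thetaSymbol : TransportSymbol (sobolevBracket d Θ) where
  ω := thetaFreq d Θ
  c := 1
  measurable_ω := measurable_thetaFreq
  ω_neg x := by simp [thetaFreq]; ring
  ω_le x := by rw [one_mul]; exact abs_thetaFreq_le x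

variable (Θ) in
def transportSymbol (w : Tan d) : TransportSymbol (sobolevBracket d Θ) where
  ω x := 2 * Real.pi * inner ℝ w x.2
  c := ‖w‖
  measurable_ω := by
    have : Measurable fun x : ℤ × Tan d => (inner ℝ w x.2 : ℝ) :=
      (continuous_const.inner continuous_id).measurable.comp measurable_snd
    exact this.const_mul _
  ω_neg x := by simp
  ω_le x := by
    have h1 := abs_real_inner_le_norm w x.2
    have h2 : 2 * Real.pi * ‖x.2‖ ≤ sobolevBracket d Θ x := norm_snd_le_japanese x
    rw [abs_mul, abs_of_pos Real.two_pi_pos]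
    nlinarith [norm_nonneg w, Real.two_pi_pos, mul_le_mul_of_nonneg_left h1 Real.two_pi_pos.le,
      mul_le_mul_of_nonneg_left h2 (norm_nonneg w)]

variable (d Θ) in
-- A pure Burgers symbol: the remainder vanishes, and `M = 1` is merely the least admissible
-- exponent.
def productSymbol : BurgersSymbol (sobolevBracket d Θ) where
  m _ y := Complex.I * thetaFreq d Θ y
  κ := thetaFreq d Θ
  A := 1
  M := 1
  measurable_m := measurable_const.mul
    (Complex.measurable_ofReal.comp (measurable_thetaFreq.comp measurable_snd))
  measurable_κ := measurable_thetaFreq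
  κ_add x y := by simp [thetaFreq]; ring
  A_nonneg := zero_le_one
  κ_le x := by rw [one_mul]; exact abs_thetaFreq_le x
  one_le_M := le_rfl
  rem_le x y := by
    have := (sobolevBracket d Θ).nonneg x
    have := (sobolevBracket d Θ).nonneg y
    simp only [sub_self, norm_zero]
    positivity
  m_neg x y := by simp [thetaFreq, Complex.conj_ofNat]; ring

/-- The symbol of `𝔽_per`. -/
def fperMul (δ₁ δ₃ : ℝ) (k l : ℤ) : ℂ :=
  if k * l ≠ 0 then Complex.I / ((k * δ₁ + l * δ₃ : ℝ) : ℂ) else 0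

/-- A bound on the symbol of `𝔽_per(∂_θ·, ∂_θ·)`. -/
structure FperBound (δ₁ δ₃ B : ℝ) (M : ℕ) : Prop where
  nonneg : 0 ≤ B
  one_le : 1 ≤ M
  le : ∀ k l : ℤ, ‖fperMul δ₁ δ₃ k l‖ * (|(k : ℝ)| * |(l : ℝ)|) ≤ B * min |(k : ℝ)| |(l : ℝ)| ^ M

theorem fperMul_neg (δ₁ δ₃ : ℝ) (k l : ℤ) :
    fperMul δ₁ δ₃ (-k) (-l) = (starRingEnd ℂ) (fperMul δ₁ δ₃ k l) := by
  unfold fperMul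
  rw [neg_mul_neg]
  split_ifs
  · rw [map_div₀, Complex.conj_I, Complex.conj_ofReal]
    push_cast
    rw [neg_mul, neg_mul, ← neg_add, div_neg, neg_div]
  · simp

/-- The symbol of `𝔽_per(∂_θ·, ∂_θ·)` in the variables `(k, ξ)`. -/
def fperTheta (d : ℕ) (Θ δ₁ δ₃ : ℝ) (x y : ℤ × Tan d) : ℂ :=
  fperMul δ₁ δ₃ x.1 y.1 * ((Complex.I * thetaFreq d Θ x) * (Complex.I * thetaFreq d Θ y))

theorem measurable_fperTheta (d : ℕ) (Θ δ₁ δ₃ : ℝ) :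
    Measurable (Function.uncurry (fperTheta d Θ δ₁ δ₃)) := by
  have h0 : Measurable fun r : ℤ × ℤ => fperMul δ₁ δ₃ r.1 r.2 := measurable_of_countable _
  have h1 : Measurable fun q : (ℤ × Tan d) × (ℤ × Tan d) => fperMul δ₁ δ₃ q.1.1 q.2.1 :=
    h0.comp (f := fun q : (ℤ × Tan d) × (ℤ × Tan d) => (q.1.1, q.2.1))
      (measurable_fst.fst.prodMk measurable_snd.fst)
  have h2 : Measurable fun x : ℤ × Tan d => Complex.I * (thetaFreq d Θ x : ℂ) :=
    measurable_const.mul (Complex.measurable_ofReal.comp (by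
      have h1 : Measurable fun x : ℤ × Tan d => (x.1 : ℝ) :=
        (measurable_from_top (f := fun k : ℤ => (k : ℝ))).comp measurable_fst
      unfold thetaFreq
      fun_prop))
  exact h1.mul ((h2.comp measurable_fst).mul (h2.comp measurable_snd))

theorem fperTheta_neg (d : ℕ) (Θ δ₁ δ₃ : ℝ) (x y : ℤ × Tan d) :
    fperTheta d Θ δ₁ δ₃ (-x) (-y) = (starRingEnd ℂ) (fperTheta d Θ δ₁ δ₃ x y) := by
  simp only [fperTheta, Prod.fst_neg, fperMul_neg, map_mul, Complex.conj_I, Complex.conj_ofReal,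
    thetaFreq]
  push_cast
  ring

/-- The constant in the bound on `fperTheta`. -/
def fperConst (Θ B : ℝ) (M : ℕ) : ℝ := (2 * Real.pi / Θ) ^ 2 * B * (Θ / (2 * Real.pi)) ^ M

theorem fperConst_nonneg {δ₁ δ₃ B : ℝ} {M : ℕ} (hB : FperBound δ₁ δ₃ B M) :
    0 ≤ fperConst Θ B M := by
  have := period_pos Θ
  have := hB.nonneg
  have := Real.pi_pos
  unfold fperConst
  positivity

theorem norm_fperTheta_le {δ₁ δ₃ B : ℝ} {M : ℕ} (hB : FperBound δ₁ δ₃ B M) (x y : ℤ × Tan d) :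
    ‖fperTheta d Θ δ₁ δ₃ x y‖ ≤
      fperConst Θ B M * min (sobolevBracket d Θ x) (sobolevBracket d Θ y) ^ M := by
  have hΘ := period_pos Θ
  have hπ := Real.two_pi_pos
  have h0 : ∀ z : ℤ × Tan d, |thetaFreq d Θ z| = 2 * Real.pi / Θ * |(z.1 : ℝ)| := by
    intro z
    rw [thetaFreq, mul_div_right_comm, abs_mul, abs_of_pos (by positivity)]
  have h1 : ∀ z : ℤ × Tan d, |(z.1 : ℝ)| ≤ Θ / (2 * Real.pi) * sobolevBracket d Θ z := by
    intro z
    have := abs_thetaFreq_le (Θ := Θ) z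
    rw [h0] at this
    have h2 := mul_le_mul_of_nonneg_left this (show 0 ≤ Θ / (2 * Real.pi) by positivity)
    refine le_trans (le_of_eq ?_) h2
    field_simp
  have e : ‖fperTheta d Θ δ₁ δ₃ x y‖ = (2 * Real.pi / Θ) ^ 2 *
      (‖fperMul δ₁ δ₃ x.1 y.1‖ * (|(x.1 : ℝ)| * |(y.1 : ℝ)|)) := by
    simp only [fperTheta, norm_mul, Complex.norm_I, one_mul, Complex.norm_real, Real.norm_eq_abs,
      h0]
    ring
  have h2 : min |(x.1 : ℝ)| |(y.1 : ℝ)| ≤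
      Θ / (2 * Real.pi) * min (sobolevBracket d Θ x) (sobolevBracket d Θ y) := by
    rw [mul_min_of_nonneg _ _ (by positivity)]
    exact min_le_min (h1 x) (h1 y)
  rw [e, fperConst]
  calc _ ≤ (2 * Real.pi / Θ) ^ 2 * (B * min |(x.1 : ℝ)| |(y.1 : ℝ)| ^ M) := by
        exact mul_le_mul_of_nonneg_left (hB.le _ _) (by positivity)
    _ ≤ (2 * Real.pi / Θ) ^ 2 * (B * (Θ / (2 * Real.pi) *
          min (sobolevBracket d Θ x) (sobolevBracket d Θ y)) ^ M) := by
        have := hB.nonneg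
        gcongr
    _ = _ := by rw [mul_pow]; ring

variable (d Θ) in
-- There is no leading part: by the divisor bound the whole symbol is a remainder, governed by the
-- lower frequency.
def fperSymbol {δ₁ δ₃ B : ℝ} {M : ℕ} (hB : FperBound δ₁ δ₃ B M) :
    BurgersSymbol (sobolevBracket d Θ) where
  m := fperTheta d Θ δ₁ δ₃
  κ _ := 0
  A := fperConst Θ B M
  M := M
  measurable_m := measurable_fperTheta d Θ δ₁ δ₃
  measurable_κ := measurable_const
  κ_add _ _ := by simp
  A_nonneg := fperConst_nonneg hB
  κ_le x := by
    have := fperConst_nonneg (Θ := Θ) hB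
    have := (sobolevBracket d Θ).nonneg x
    rw [abs_zero]
    positivity
  one_le_M := hB.one_le
  rem_le x y := by
    rw [Complex.ofReal_zero, mul_zero, sub_zero]
    exact norm_fperTheta_le hB x y
  m_neg := fperTheta_neg d Θ δ₁ δ₃

variable (d Θ) in
/-- The symbol of `c a ∂_θ a + μ 𝔽_per(∂_θ a, ∂_θ a)`. -/
def equationSymbol {δ₁ δ₃ B : ℝ} {M : ℕ} (hB : FperBound δ₁ δ₃ B M) (c μ : ℝ) :
    BurgersSymbol (sobolevBracket d Θ) where
  m x y := c * (productSymbol d Θ).m x y + μ * fperTheta d Θ δ₁ δ₃ x y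
  κ x := c * thetaFreq d Θ x
  A := |c| + |μ| * fperConst Θ B M
  M := M
  measurable_m := ((productSymbol d Θ).measurable_m.const_mul _).add
    ((measurable_fperTheta d Θ δ₁ δ₃).const_mul _)
  measurable_κ := measurable_thetaFreq.const_mul _
  κ_add x y := by
    rw [← mul_add]
    exact congrArg (c * ·) ((productSymbol d Θ).κ_add x y)
  A_nonneg := by
    have := fperConst_nonneg (Θ := Θ) hB
    positivity
  κ_le x := by
    have := fperConst_nonneg (Θ := Θ) hB
    have := (sobolevBracket d Θ).nonneg x
    rw [abs_mul, add_mul]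
    exact le_add_of_le_of_nonneg
      (mul_le_mul_of_nonneg_left (abs_thetaFreq_le x) (abs_nonneg _)) (by positivity)
  one_le_M := hB.one_le
  rem_le x y := by
    have h := norm_fperTheta_le (Θ := Θ) hB x y
    have := (sobolevBracket d Θ).nonneg x
    have := (sobolevBracket d Θ).nonneg y
    have e : c * (productSymbol d Θ).m x y + μ * fperTheta d Θ δ₁ δ₃ x y -
        Complex.I * ((c * thetaFreq d Θ y : ℝ) : ℂ) = μ * fperTheta d Θ δ₁ δ₃ x y := by
      simp only [productSymbol]; push_cast; ring
    rw [e, norm_mul, Complex.norm_real, Real.norm_eq_abs, add_mul, mul_assoc]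
    exact le_add_of_nonneg_of_le (by positivity) (mul_le_mul_of_nonneg_left h (abs_nonneg _))
  m_neg x y := by
    rw [(productSymbol d Θ).m_neg, fperTheta_neg, map_add, map_mul, map_mul, Complex.conj_ofReal,
      Complex.conj_ofReal]

theorem isThetaDeriv_iff {u v : L2 d Θ} :
    IsThetaDeriv u v ↔ tr v =ᵐ[freq d] fun x => Complex.I * thetaFreq d Θ x * tr u x := by
  have hc : ∀ (k : ℤ) (ξ : Tan d), Complex.I * (thetaFreq d Θ (k, ξ) : ℂ) =
      2 * Real.pi * k / Θ * Complex.I := by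
    intro k ξ
    rw [thetaFreq]; push_cast; ring
  have key : ∀ k : ℤ, mode v k = (2 * Real.pi * k / Θ * Complex.I : ℂ) • mode u k ↔
      ∀ᵐ ξ, tr v (k, ξ) = Complex.I * thetaFreq d Θ (k, ξ) * tr u (k, ξ) := by
    intro k
    have h1 : mode v k = (2 * Real.pi * k / Θ * Complex.I : ℂ) • mode u k ↔
        transform v k = (2 * Real.pi * k / Θ * Complex.I : ℂ) • transform u k := by
      rw [← (Lp.fourierTransformₗᵢ (Tan d) ℂ).injective.eq_iff, map_smul]
      rfl
    rw [h1]
    constructor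
    · intro h
      have h2 : transform v k =ᵐ[volume]
          ((2 * Real.pi * k / Θ * Complex.I : ℂ) • transform u k : Lp ℂ 2 volume) := by rw [h]
      filter_upwards [h2, tr_section u k, tr_section v k,
        Lp.coeFn_smul (2 * Real.pi * k / Θ * Complex.I : ℂ) (transform u k)] with ξ e1 e2 e3 e4
      rw [e3, e1, e4, e2, hc]; rfl
    · intro h
      refine Lp.ext ?_
      filter_upwards [h, tr_section u k, tr_section v k,
        Lp.coeFn_smul (2 * Real.pi * k / Θ * Complex.I : ℂ) (transform u k)] with ξ e1 e2 e3 e4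
      rw [← e3, e1, e4, e2, hc]; rfl
  exact (forall_congr' key).trans (ae_freq (p := fun x =>
    tr v x = Complex.I * thetaFreq d Θ x * tr u x)).symm

theorem isTransport_iff {w : Tan d} {u v : L2 d Θ} :
    IsTransport w u v ↔
      tr v =ᵐ[freq d] fun x => Complex.I * (transportSymbol Θ w).ω x * tr u x := by
  refine (forall_congr' fun k => ?_).trans (ae_freq (p := fun x =>
    tr v x = Complex.I * (transportSymbol Θ w).ω x * tr u x)).symm
  constructor
  · intro h
    filter_upwards [h, tr_section u k, tr_section v k] with ξ e1 e2 e3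
    rw [e3, e1, e2, transportSymbol]; push_cast; ring
  · intro h
    filter_upwards [h, tr_section u k, tr_section v k] with ξ e1 e2 e3
    rw [← e3, e1, e2, transportSymbol]; push_cast; ring

end Terms

/-! ### The terms of the equation identified on the Fourier side. -/

section Characterization

variable {d : ℕ} {Θ : ℝ} [Fact (0 < Θ)] {s : ℕ} {h k : Lp ℂ 2 (freq d)}
  {u v uθ vθ p q F : L2 d Θ}

theorem tr_ae_eq_lower (hu : lowerL (sobolevBracket d Θ) s h = tr u) :
    tr u =ᵐ[freq d] lower (sobolevBracket d Θ) s h := by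
  rw [← hu]
  exact coeFn_lowerL _ s h

theorem integrable_tr (hs : (sobolevBracket d Θ).σ ≤ s)
    (hu : lowerL (sobolevBracket d Θ) s h = tr u) : Integrable (tr u) (freq d) :=
  (integrable_lower _ hs h).congr (tr_ae_eq_lower hu).symm

theorem isThetaDeriv_iff_tr_eq (hs : 1 ≤ s) (hu : lowerL (sobolevBracket d Θ) s h = tr u) :
    IsThetaDeriv u uθ ↔ tr uθ = (thetaSymbol d Θ).transL s h := by
  rw [isThetaDeriv_iff]
  constructor
  · intro e
    refine Lp.ext ?_
    filter_upwards [e, tr_ae_eq_lower hu, (thetaSymbol d Θ).coeFn_transL hs h] with x h1 h2 h3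
    rw [h1, h2, h3]; rfl
  · intro e
    rw [e]
    filter_upwards [tr_ae_eq_lower hu, (thetaSymbol d Θ).coeFn_transL hs h] with x h2 h3
    rw [h2, h3]; rfl

theorem isTransport_iff_tr_eq {w : Tan d} (hs : 1 ≤ s)
    (hu : lowerL (sobolevBracket d Θ) s h = tr u) :
    IsTransport w u p ↔ tr p = (transportSymbol Θ w).transL s h := by
  rw [isTransport_iff]
  constructor
  · intro e
    refine Lp.ext ?_
    filter_upwards [e, tr_ae_eq_lower hu, (transportSymbol Θ w).coeFn_transL hs h] with x h1 h2 h3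
    rw [h1, h2, h3]
  · intro e
    rw [e]
    filter_upwards [tr_ae_eq_lower hu, (transportSymbol Θ w).coeFn_transL hs h] with x h2 h3
    rw [h2, h3]

theorem exists_tr_eq_transL (Ω : TransportSymbol (sobolevBracket d Θ))
    (hs : 1 + (sobolevBracket d Θ).σ ≤ s) (hh : IsReal h) :
    ∃ u : L2 d Θ, tr u = Ω.transL s h :=
  (exists_tr_eq Θ (Ω.isReal_transL (by omega) hh) (Ω.integrable_transL hs h)).imp fun _ => And.left

theorem exists_tr_eq_bilL (S : BurgersSymbol (sobolevBracket d Θ))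
    (hs : S.M + (sobolevBracket d Θ).σ ≤ s) (hh : IsReal h) (hk : IsReal k) :
    ∃ u : L2 d Θ, tr u = S.bilL hs h k :=
  (exists_tr_eq Θ (S.isReal_bilL hs hh hk) (S.integrable_bilL hs h k)).imp fun _ => And.left

theorem IsThetaDeriv.tr_ae_eq (hv : lowerL (sobolevBracket d Θ) s k = tr v)
    (hθ : IsThetaDeriv v vθ) : tr vθ =ᵐ[freq d]
      fun x => Complex.I * thetaFreq d Θ x * lower (sobolevBracket d Θ) s k x := by
  filter_upwards [isThetaDeriv_iff.1 hθ, tr_ae_eq_lower hv] with x h1 h2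
  rw [h1, h2]

theorem IsThetaDeriv.integrable_tr (hs : 1 + (sobolevBracket d Θ).σ ≤ s)
    (hv : lowerL (sobolevBracket d Θ) s k = tr v) (hθ : IsThetaDeriv v vθ) :
    Integrable (tr vθ) (freq d) := by
  rw [(isThetaDeriv_iff_tr_eq (by omega) hv).1 hθ]
  exact TransportSymbol.integrable_transL _ hs k

/-- All three transforms are integrable, so the inversion formula holds almost everywhere for each
function, and the claim reduces to the convolution theorem. -/
theorem isProduct_of_tr_eq (hs : (productSymbol d Θ).M + (sobolevBracket d Θ).σ ≤ s)
    (hu : lowerL (sobolevBracket d Θ) s h = tr u) (hv : lowerL (sobolevBracket d Θ) s k = tr v)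
    (hθ : IsThetaDeriv v vθ) (hq : tr q = (productSymbol d Θ).bilL hs h k) :
    IsProduct u vθ q := by
  have hs' : 1 + (sobolevBracket d Θ).σ ≤ s := hs
  have i1 := integrable_tr (by omega) hu
  have i2 := hθ.integrable_tr hs' hv
  have i3 : Integrable (tr q) (freq d) := by
    rw [hq]; exact (productSymbol d Θ).integrable_bilL hs h k
  have e : pseudo (freq d) (fun _ _ => 1) (tr u) (tr vθ) =ᵐ[freq d] tr q := by
    rw [pseudo_congr (tr_ae_eq_lower hu) (hθ.tr_ae_eq hv), hq]
    filter_upwards [(productSymbol d Θ).coeFn_bilL hs h k] with x hx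
    rw [hx]
    refine integral_congr_ae (.of_forall fun y => ?_)
    simp only [productSymbol]
    ring
  filter_upwards [ae_eq_synth i1, ae_eq_synth i2, ae_eq_synth i3] with x h1 h2 h3
  rw [← Complex.ofReal_inj, h3, Complex.ofReal_mul, h1, h2, synth_mul_synth i1 i2,
    synth_congr e]

/-- The relation determines `q` in `L²`. The converse therefore follows once some function with the
required transform is known to exist. -/
theorem isProduct_iff_tr_eq (hs : (productSymbol d Θ).M + (sobolevBracket d Θ).σ ≤ s)
    (hh : IsReal h) (hk : IsReal k)
    (hu : lowerL (sobolevBracket d Θ) s h = tr u) (hv : lowerL (sobolevBracket d Θ) s k = tr v)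
    (hθ : IsThetaDeriv v vθ) :
    IsProduct u vθ q ↔ tr q = (productSymbol d Θ).bilL hs h k := by
  refine ⟨fun h1 => ?_, isProduct_of_tr_eq hs hu hv hθ⟩
  obtain ⟨q', hq'⟩ := exists_tr_eq_bilL (productSymbol d Θ) hs hh hk
  have h2 : q = q' := Lp.ext (h1.trans (isProduct_of_tr_eq hs hu hv hθ hq').symm)
  rw [h2, hq']

variable {δ₁ δ₃ B : ℝ} {M : ℕ} (hB : FperBound δ₁ δ₃ B M)

theorem isFper_of_tr_eq (hs : (fperSymbol d Θ hB).M + (sobolevBracket d Θ).σ ≤ s)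
    (hu : lowerL (sobolevBracket d Θ) s h = tr u) (hv : lowerL (sobolevBracket d Θ) s k = tr v)
    (hu' : IsThetaDeriv u uθ) (hv' : IsThetaDeriv v vθ)
    (hF : tr F = (fperSymbol d Θ hB).bilL hs h k) : IsFper δ₁ δ₃ uθ vθ F := by
  intro j
  have hM := (fperSymbol d Θ hB).one_le_M
  have hs' : 1 + (sobolevBracket d Θ).σ ≤ s := by omega
  have i1 := hu'.integrable_tr hs' hu
  have i2 := hv'.integrable_tr hs' hv
  have i3 : Integrable (tr F) (freq d) := by
    rw [hF]; exact (fperSymbol d Θ hB).integrable_bilL hs h k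
  set f : ℤ × Tan d → ℂ :=
    fun x => Complex.I * thetaFreq d Θ x * lower (sobolevBracket d Θ) s h x with hf
  set g : ℤ × Tan d → ℂ :=
    fun x => Complex.I * thetaFreq d Θ x * lower (sobolevBracket d Θ) s k x with hg
  have ef := hu'.tr_ae_eq hu
  have eg := hv'.tr_ae_eq hv
  have hK : Integrable (fun q : (ℤ × Tan d) × (ℤ × Tan d) =>
      fperMul δ₁ δ₃ (q.1 - q.2).1 q.2.1 * (f (q.1 - q.2) * g q.2)) ((freq d).prod (freq d)) := by
    refine ((fperSymbol d Θ hB).integrable_kernel_prod hs h k).congr (.of_forall fun q => ?_)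
    simp only [fperSymbol, fperTheta, hf, hg]
    ring
  have eF : tr F =ᵐ[freq d] pseudo (freq d) (fun x y => fperMul δ₁ δ₃ x.1 y.1) f g := by
    rw [hF]
    filter_upwards [(fperSymbol d Θ hB).coeFn_bilL hs h k] with x hx
    rw [hx]
    refine integral_congr_ae (.of_forall fun y => ?_)
    simp only [fperSymbol, fperTheta, hf, hg]
    ring
  have congr : ∀ {a c : ℤ × Tan d → ℂ}, a =ᵐ[freq d] c → ∀ (l : ℤ) (y : Tan d),
      𝓕⁻ (fun ξ => a (l, ξ)) y = 𝓕⁻ (fun ξ => c (l, ξ)) y := by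
    intro a c hac l y
    rw [Real.fourierInv_eq, Real.fourierInv_eq]
    refine integral_congr_ae ?_
    filter_upwards [ae_freq.1 hac l] with ξ hξ
    rw [hξ]
  filter_upwards [ae_all_iff.2 (mode_ae_eq_fourierInv i1), ae_all_iff.2 (mode_ae_eq_fourierInv i2),
    mode_ae_eq_fourierInv i3 j] with y h1 h2 h3
  rw [h3, congr eF]
  have h4 := hasSum_fourierInv_pseudo hK j y
  -- The convolution is summed over the frequency of the second factor, the definition over that of
  -- the first; `l ↦ j - l` exchanges them.
  have h5 := (Equiv.subLeft j).hasSum_iff.2 h4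
  refine Eq.mp (congrArg (HasSum · _) (funext fun l => ?_)) h5
  simp only [Function.comp_apply, Equiv.subLeft_apply, sub_sub_cancel]
  rw [h1, h2, ← congr ef, ← congr eg, fperMul]
  split_ifs
  · ring
  · rw [zero_mul]

/-- As for the product: the sums determine every mode, and a function with the required transform
exists. -/
theorem isFper_iff_tr_eq (hs : (fperSymbol d Θ hB).M + (sobolevBracket d Θ).σ ≤ s)
    (hh : IsReal h) (hk : IsReal k)
    (hu : lowerL (sobolevBracket d Θ) s h = tr u) (hv : lowerL (sobolevBracket d Θ) s k = tr v)
    (hu' : IsThetaDeriv u uθ) (hv' : IsThetaDeriv v vθ) :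
    IsFper δ₁ δ₃ uθ vθ F ↔ tr F = (fperSymbol d Θ hB).bilL hs h k := by
  refine ⟨fun h1 => ?_, isFper_of_tr_eq hB hs hu hv hu' hv'⟩
  obtain ⟨F', hF'⟩ := exists_tr_eq_bilL (fperSymbol d Θ hB) hs hh hk
  have h2 := isFper_of_tr_eq hB hs hu hv hu' hv' hF'
  rw [← hF', tr_eq_iff]
  intro j
  refine Lp.ext ?_
  filter_upwards [h1 j, h2 j] with y e1 e2
  exact e1.unique e2

theorem bilL_equationSymbol (c μ : ℝ) (hs : M + (sobolevBracket d Θ).σ ≤ s)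
    (h k : Lp ℂ 2 (freq d)) :
    (equationSymbol d Θ hB c μ).bilL hs h k =
      c • (productSymbol d Θ).bilL (le_trans (Nat.add_le_add_right hB.one_le _) hs) h k +
        μ • (fperSymbol d Θ hB).bilL hs h k := by
  refine Lp.ext ?_
  set P := (productSymbol d Θ).bilL (le_trans (Nat.add_le_add_right hB.one_le _) hs) h k with hP
  set Q := (fperSymbol d Θ hB).bilL hs h k with hQ
  filter_upwards [(equationSymbol d Θ hB c μ).coeFn_bilL hs h k,
    (productSymbol d Θ).coeFn_bilL (le_trans (Nat.add_le_add_right hB.one_le _) hs) h k,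
    (fperSymbol d Θ hB).coeFn_bilL hs h k, Lp.coeFn_add (c • P) (μ • Q), Lp.coeFn_smul c P,
    Lp.coeFn_smul μ Q] with x h1 h2 h3 h4 h5 h6
  rw [h1, h4, Pi.add_apply, h5, h6, Pi.smul_apply, Pi.smul_apply, hP, hQ, h2, h3,
    Complex.real_smul, Complex.real_smul]
  simp only [pseudo]
  rw [← integral_const_mul, ← integral_const_mul, ← integral_add]
  · refine integral_congr_ae (.of_forall fun y => ?_)
    simp only [equationSymbol, fperSymbol]
    ring
  · exact ((productSymbol d Θ).integrable_kernel_lower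
      (le_trans (Nat.add_le_add_right hB.one_le _) hs) h k x).const_mul _
  · exact ((fperSymbol d Θ hB).integrable_kernel_lower hs h k x).const_mul _

end Characterization

/-! ### Sobolev spaces as weighted `L²` spaces, and the tame estimate. -/

section Lift

variable {d : ℕ} {Θ : ℝ} [Fact (0 < Θ)] {s : ℕ} {u v : L2 d Θ}

theorem ofReal_sqrt_ne_zero : ENNReal.ofReal √Θ ≠ 0 := by
  simpa using Real.sqrt_pos.2 (period_pos Θ)

theorem eLpNorm_pow_smul_tr_lt_top (hu : MemH s u) :
    eLpNorm (fun x => sobolevBracket d Θ x ^ s • tr u x) 2 (freq d) < ∞ := by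
  rw [MemH, sobolevNorm_eq] at hu
  exact (ENNReal.mul_lt_top_iff.1 hu).elim (·.2)
    (·.elim (absurd · ofReal_sqrt_ne_zero) (by simp +contextual))

theorem memH_iff : MemH s u ↔
    eLpNorm (fun x => sobolevBracket d Θ x ^ s • tr u x) 2 (freq d) < ∞ := by
  refine ⟨eLpNorm_pow_smul_tr_lt_top, fun h => ?_⟩
  rw [MemH, sobolevNorm_eq]
  exact ENNReal.mul_lt_top ENNReal.ofReal_lt_top h

theorem memLp_pow_smul_tr (hu : MemH s u) :
    MemLp (fun x => sobolevBracket d Θ x ^ s • tr u x) 2 (freq d) :=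
  ⟨(((sobolevBracket d Θ).measurable.pow_const s).smul (measurable_coe (tr u))).aestronglyMeasurable,
    eLpNorm_pow_smul_tr_lt_top hu⟩

/-- The function `h = b^s û`, whose `L²` norm is the `H^s` norm up to `√Θ`, is the unknown used in
the analysis on the Fourier side. -/
theorem exists_lowerL_eq (hu : MemH s u) :
    ∃ h : Lp ℂ 2 (freq d), IsReal h ∧ lowerL (sobolevBracket d Θ) s h = tr u := by
  refine ⟨(memLp_pow_smul_tr hu).toLp _, ?_, ?_⟩
  · have e := (memLp_pow_smul_tr hu).coeFn_toLp
    unfold IsReal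
    filter_upwards [e, ae_neg e, isReal_tr u] with x h1 h2 h3
    rw [h1, h2, h3, (sobolevBracket d Θ).map_neg, Complex.real_smul, Complex.real_smul, map_mul,
      Complex.conj_ofReal]
  · refine Lp.ext ?_
    filter_upwards [coeFn_lowerL (sobolevBracket d Θ) s ((memLp_pow_smul_tr hu).toLp _),
      (memLp_pow_smul_tr hu).coeFn_toLp] with x h1 h2
    rw [h1, lower, h2, smul_smul, inv_mul_cancel₀ (pow_pos ((sobolevBracket d Θ).pos x) s).ne', one_smul]

theorem sobolevNorm_eq_enorm {h : Lp ℂ 2 (freq d)}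
    (hu : lowerL (sobolevBracket d Θ) s h = tr u) :
    sobolevNorm s u = ENNReal.ofReal √Θ * ‖h‖ₑ := by
  rw [sobolevNorm_eq, Lp.enorm_def]
  congr 1
  refine eLpNorm_congr_ae ?_
  filter_upwards [tr_ae_eq_lower hu] with x hx
  rw [hx, pow_smul_lower]

theorem sobolevNorm_mono {ν ν' : ℕ} (hν : ν ≤ ν') (u : L2 d Θ) :
    sobolevNorm ν u ≤ sobolevNorm ν' u := by
  rw [sobolevNorm_eq, sobolevNorm_eq]
  refine mul_le_mul_right (eLpNorm_mono fun x => ?_) _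
  have h := (sobolevBracket d Θ).one_le x
  rw [norm_smul, norm_smul, Real.norm_of_nonneg (by positivity),
    Real.norm_of_nonneg (by positivity)]
  gcongr

theorem MemH.mono {ν ν' : ℕ} (hν : ν ≤ ν') (hu : MemH ν' u) : MemH ν u :=
  (sobolevNorm_mono hν u).trans_lt hu

theorem eLpNorm_one_pow_smul_tr_le {j : ℕ} (hj : j + (sobolevBracket d Θ).σ ≤ s) (u : L2 d Θ) :
    eLpNorm (fun x => sobolevBracket d Θ x ^ j • tr u x) 1 (freq d) ≤
      (sobolevBracket d Θ).embConst *
        eLpNorm (fun x => sobolevBracket d Θ x ^ s • tr u x) 2 (freq d) :=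
  eLpNorm_one_pow_le _ hj (measurable_coe _)

/-- The tame estimate. -/
theorem tameEstimate {δ₁ δ₃ B : ℝ} {M : ℕ} (hB : FperBound δ₁ δ₃ B M)
    (hs : M + (sobolevBracket d Θ).σ ≤ s) : TameEstimate d Θ δ₁ δ₃ s := by
  intro ν hν
  set b := sobolevBracket d Θ with hb
  set n2 : ℕ → L2 d Θ → ℝ≥0∞ := fun j u => eLpNorm (fun x => b x ^ j • tr u x) 2 (freq d) with hn2
  have hsn : ∀ j u, sobolevNorm j u = ENNReal.ofReal √Θ * n2 j u := sobolevNorm_eq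
  set C : ℝ := fperConst Θ B M * 2 ^ ν with hC
  -- Each Sobolev norm carries a factor `√Θ`, with two such factors on the right and one on the
  -- left, hence the inverse. The `2^ν` in `C` comes from distributing the weight over the two
  -- factors.
  refine ⟨((ENNReal.ofReal √Θ)⁻¹ * ENNReal.ofReal C * b.embConst).toNNReal,
    fun u v hu hv => ?_⟩
  have hcne : (ENNReal.ofReal √Θ)⁻¹ * ENNReal.ofReal C * b.embConst ≠ ∞ :=
    ENNReal.mul_ne_top (ENNReal.mul_ne_top (ENNReal.inv_ne_top.2 ofReal_sqrt_ne_zero)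
      ENNReal.ofReal_ne_top) b.finite.ne
  rw [ENNReal.coe_toNNReal hcne]
  obtain ⟨h, hh, hhu⟩ := exists_lowerL_eq (hu.mono hν)
  obtain ⟨k, hk, hkv⟩ := exists_lowerL_eq (hv.mono hν)
  have h1 := hB.one_le
  have hs1 : 1 + (sobolevBracket d Θ).σ ≤ s := le_trans (Nat.add_le_add_right h1 _) hs
  obtain ⟨uθ, huθ⟩ := exists_tr_eq_transL (thetaSymbol d Θ) hs1 hh
  obtain ⟨vθ, hvθ⟩ := exists_tr_eq_transL (thetaSymbol d Θ) hs1 hk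
  obtain ⟨F, hF⟩ := exists_tr_eq_bilL (fperSymbol d Θ hB) hs hh hk
  have e1 := (isThetaDeriv_iff_tr_eq (by omega) hhu).2 huθ
  have e2 := (isThetaDeriv_iff_tr_eq (by omega) hkv).2 hvθ
  refine ⟨uθ, vθ, F, e1, e2, isFper_of_tr_eq hB hs hhu hkv e1 e2 hF, ?_⟩
  have eF : n2 ν F = eLpNorm (fun x => b x ^ ν •
      pseudo (freq d) (fperTheta d Θ δ₁ δ₃) (tr u) (tr v) x) 2 (freq d) := by
    refine eLpNorm_congr_ae ?_
    rw [hF, pseudo_congr (tr_ae_eq_lower hhu) (tr_ae_eq_lower hkv)]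
    filter_upwards [(fperSymbol d Θ hB).coeFn_bilL hs h k] with x hx
    rw [hx]; rfl
  have hC0 := fperConst_nonneg (Θ := Θ) hB
  have key := eLpNorm_smul_pseudo_le (μ := freq d) (m := fperTheta d Θ δ₁ δ₃)
    (W := fun x => b x ^ ν) (W₁ := fun x => b x ^ ν) (W₂ := fun x => b x ^ M)
    (W₃ := fun x => b x ^ M) (W₄ := fun x => b x ^ ν) (C := C)
    (measurable_coe (tr u)) (measurable_coe (tr v)) (b.measurable.pow_const _)
    (b.measurable.pow_const _) (b.measurable.pow_const _) (b.measurable.pow_const _) (by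
      intro x y
      have a1 := norm_fperTheta_le (Θ := Θ) hB x y
      have a2 := (isWeight_pow ν).mul_min_pow_le b M x y
      have := b.nonneg x
      have := b.nonneg y
      have := b.nonneg (x + y)
      rw [abs_of_nonneg (by positivity), abs_of_nonneg (by positivity),
        abs_of_nonneg (by positivity), abs_of_nonneg (by positivity), abs_of_nonneg (by positivity)]
      calc b (x + y) ^ ν * ‖fperTheta d Θ δ₁ δ₃ x y‖
          ≤ b (x + y) ^ ν * (fperConst Θ B M * min (b x) (b y) ^ M) := by gcongr
        _ = fperConst Θ B M * (b (x + y) ^ ν * min (b x) (b y) ^ M) := by ring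
        _ ≤ fperConst Θ B M * (2 ^ ν * (b x ^ ν * b y ^ M + b x ^ M * b y ^ ν)) := by gcongr
        _ = _ := by rw [hC]; ring)
  rw [← eF] at key
  have k1 := eLpNorm_one_pow_smul_tr_le hs u
  have k2 := eLpNorm_one_pow_smul_tr_le hs v
  have key2 : n2 ν F ≤ ENNReal.ofReal C * (n2 ν u * (b.embConst * n2 s v) +
      (b.embConst * n2 s u) * n2 ν v) :=
    key.trans (by gcongr)
  simp only [hsn]
  set r := ENNReal.ofReal √Θ
  have hr : r⁻¹ * r = 1 := ENNReal.inv_mul_cancel ofReal_sqrt_ne_zero ENNReal.ofReal_ne_top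
  calc r * n2 ν F ≤ r * (ENNReal.ofReal C * (n2 ν u * (b.embConst * n2 s v) +
      (b.embConst * n2 s u) * n2 ν v)) := by gcongr
    _ = (r⁻¹ * r) * r * (ENNReal.ofReal C * (n2 ν u * (b.embConst * n2 s v) +
      (b.embConst * n2 s u) * n2 ν v)) := by rw [hr, one_mul]
    _ = _ := by ring

end Lift

/-! ### Splitting of weighted norms into low and high frequencies. -/

section HighLow

variable {G : Type*} [AddCommGroup G] [MeasurableSpace G] {μ : Measure G}

/-- For `β ≤ ρ` the first term suffices; for `β ≥ ρ` the minimum equals `1` and the bound on `z` is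
used. -/
theorem pow_mul_norm_sub_le {β ρ x y z : ℝ} {ν : ℕ} (hβ : 1 ≤ β) (hρ : 0 < ρ) (hz0 : 0 ≤ z)
    (hx : 0 ≤ x) (hy : 0 ≤ y) (hz : z ≤ x + y) :
    β ^ ν * z ≤ ρ ^ ν * z + (β ^ ν * min 1 (β / ρ) * x + β ^ ν * min 1 (β / ρ) * y) := by
  have hβ0 : 0 ≤ β := zero_le_one.trans hβ
  rcases le_total β ρ with hle | hle
  · exact le_add_of_le_of_nonneg (by gcongr) (by positivity)
  · rw [min_eq_left ((one_le_div₀ hρ).2 hle), mul_one, ← mul_add]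
    exact le_add_of_nonneg_of_le (by positivity) (by gcongr)

/-- Splitting a weighted norm of a difference into low and high frequencies. -/
theorem eLpNorm_pow_smul_sub_le (b : Bracket μ) (ν : ℕ) {ρ : ℝ} (hρ : 0 < ρ) (f g : Lp ℂ 2 μ) :
    eLpNorm (fun x => b x ^ ν • (f - g) x) 2 μ ≤ ENNReal.ofReal (ρ ^ ν) * ‖f - g‖ₑ +
      (eLpNorm (fun x => (b x ^ ν * min 1 (b x / ρ)) • f x) 2 μ +
        eLpNorm (fun x => (b x ^ ν * min 1 (b x / ρ)) • g x) 2 μ) := by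
  have mφ : Measurable fun x => b x ^ ν * min 1 (b x / ρ) :=
    (b.measurable.pow_const ν).mul (measurable_const.min (b.measurable.div_const _))
  obtain ⟨z, hz⟩ : ∃ z, z = f - g := ⟨_, rfl⟩
  have hzx : ∀ᵐ x ∂μ, ‖z x‖ ≤ ‖f x‖ + ‖g x‖ := by
    rw [hz]
    filter_upwards [Lp.coeFn_sub f g] with x hx
    rw [hx]; exact norm_sub_le _ _
  rw [← hz]
  have m1 : AEStronglyMeasurable (fun x => ‖ρ ^ ν • z x‖) μ :=
    ((Lp.aestronglyMeasurable z).const_smul (ρ ^ ν)).norm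
  have m2 : ∀ e : Lp ℂ 2 μ,
      AEStronglyMeasurable (fun x => ‖(b x ^ ν * min 1 (b x / ρ)) • e x‖) μ := fun e =>
    (mφ.aestronglyMeasurable.smul (Lp.aestronglyMeasurable e)).norm
  have s1 : eLpNorm (fun x => b x ^ ν • z x) 2 μ ≤
      eLpNorm ((fun x => ‖ρ ^ ν • z x‖) + ((fun x => ‖(b x ^ ν * min 1 (b x / ρ)) • f x‖) +
        fun x => ‖(b x ^ ν * min 1 (b x / ρ)) • g x‖)) 2 μ := by
    refine eLpNorm_mono_ae_real ?_
    filter_upwards [hzx] with x h1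
    have hb0 := b.nonneg x
    have h2 : 0 ≤ b x ^ ν * min 1 (b x / ρ) := by positivity
    simp only [Pi.add_apply, norm_smul]
    rw [Real.norm_of_nonneg (pow_nonneg hb0 ν), Real.norm_of_nonneg (pow_nonneg hρ.le ν),
      Real.norm_of_nonneg h2]
    exact pow_mul_norm_sub_le (b.one_le x) hρ (norm_nonneg _) (norm_nonneg _) (norm_nonneg _) h1
  have s2 : eLpNorm (fun x => ‖ρ ^ ν • z x‖) 2 μ = ENNReal.ofReal (ρ ^ ν) * ‖z‖ₑ := by
    rw [eLpNorm_norm, Lp.enorm_def]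
    refine (eLpNorm_const_smul (ρ ^ ν) (z : G → ℂ) 2 μ).trans ?_
    rw [Real.enorm_of_nonneg (pow_nonneg hρ.le ν)]
  refine s1.trans ((eLpNorm_add_le m1 ((m2 f).add (m2 g)) one_le_two).trans ?_)
  rw [s2]
  refine add_le_add_right ((eLpNorm_add_le (m2 f) (m2 g) one_le_two).trans (le_of_eq ?_)) _
  rw [eLpNorm_norm, eLpNorm_norm]

end HighLow

/-! ### The Cauchy problem in physical space. -/

section Evolution

variable {d : ℕ} {Θ : ℝ} [Fact (0 < Θ)] {s : ℕ}

/-- The transform is linear and isometric up to `√Θ`, so difference quotients have the same size on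
both sides. Surjectivity is not needed, since the candidate derivative is already a transform. -/
theorem hasDerivWithinAt_tr {a : ℝ → L2 d Θ} {D : L2 d Θ} {S : Set ℝ} {t : ℝ} :
    HasDerivWithinAt (fun t => tr (a t)) (tr D) S t ↔ HasDerivWithinAt a D S t := by
  constructor
  · intro h
    rw [hasDerivWithinAt_iff_isLittleO] at h ⊢
    have e : ∀ x, ‖a x - a t - (x - t) • D‖ =
        ‖√Θ * ‖tr (a x) - tr (a t) - (x - t) • tr D‖‖ := by
      intro x
      rw [norm_mul, norm_norm, Real.norm_of_nonneg (Real.sqrt_nonneg _), ← tr_smul, ← tr_sub,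
        ← tr_sub, norm_tr]
    refine Asymptotics.IsLittleO.of_norm_left ?_
    simp_rw [e]
    exact (h.norm_left.const_mul_left _).norm_left
  · intro h
    exact (trL d Θ).hasFDerivAt.comp_hasDerivWithinAt t h

variable {δ₁ δ₃ B : ℝ} {M : ℕ} (hB : FperBound δ₁ δ₃ B M) {w : Tan d} {c μ T : ℝ} {a₀ : L2 d Θ}
  {a : ℝ → L2 d Θ} {h : ℝ → Lp ℂ 2 (freq d)}

theorem Solves.hasDerivWithinAt_lowerL (ha : Solves δ₁ δ₃ w c μ T a₀ a)
    (hs : M + (sobolevBracket d Θ).σ ≤ s)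
    (hh : ∀ t ∈ Icc 0 T, IsReal (h t) ∧ lowerL (sobolevBracket d Θ) s (h t) = tr (a t)) :
    ∀ t ∈ Icc 0 T, HasDerivWithinAt (fun t => lowerL (sobolevBracket d Θ) s (h t))
      (-((transportSymbol Θ w).transL s (h t)) -
        (equationSymbol d Θ hB c μ).bilL hs (h t) (h t)) (Icc 0 T) t := by
  intro t ht
  have h1 := hB.one_le
  have hs0 : 1 + (sobolevBracket d Θ).σ ≤ s := le_trans (Nat.add_le_add_right h1 _) hs
  obtain ⟨aθ, p, q, F, e1, e2, e3, e4, e5⟩ := ha.2 t ht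
  obtain ⟨hr, hl⟩ := hh t ht
  have f2 := (isTransport_iff_tr_eq (by omega) hl).1 e2
  have f3 := (isProduct_iff_tr_eq hs0 hr hr hl hl e1).1 e3
  have f4 := (isFper_iff_tr_eq hB hs hr hr hl hl e1 e1).1 e4
  have e6 := hasDerivWithinAt_tr.2 e5
  rw [tr_neg, tr_add, tr_add, tr_smul, tr_smul, f2, f3, f4, add_assoc, neg_add',
    ← bilL_equationSymbol hB c μ hs] at e6
  exact e6.congr (fun x hx => (hh x hx).2) (hh t ht).2

theorem solves_of_hasDerivWithinAt (h0 : a 0 = a₀) (hs : M + (sobolevBracket d Θ).σ ≤ s)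
    (hh : ∀ t ∈ Icc 0 T, IsReal (h t) ∧ lowerL (sobolevBracket d Θ) s (h t) = tr (a t))
    (hd : ∀ t ∈ Icc 0 T, HasDerivWithinAt (fun t => lowerL (sobolevBracket d Θ) s (h t))
      (-((transportSymbol Θ w).transL s (h t)) -
        (equationSymbol d Θ hB c μ).bilL hs (h t) (h t)) (Icc 0 T) t) :
    Solves δ₁ δ₃ w c μ T a₀ a := by
  refine ⟨h0, fun t ht => ?_⟩
  have h1 := hB.one_le
  have hs0 : 1 + (sobolevBracket d Θ).σ ≤ s := le_trans (Nat.add_le_add_right h1 _) hs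
  obtain ⟨hr, hl⟩ := hh t ht
  obtain ⟨aθ, f1⟩ := exists_tr_eq_transL (thetaSymbol d Θ) hs0 hr
  obtain ⟨p, f2⟩ := exists_tr_eq_transL (transportSymbol Θ w) hs0 hr
  obtain ⟨q, f3⟩ := exists_tr_eq_bilL (productSymbol d Θ) hs0 hr hr
  obtain ⟨F, f4⟩ := exists_tr_eq_bilL (fperSymbol d Θ hB) hs hr hr
  have e1 := (isThetaDeriv_iff_tr_eq (by omega) hl).2 f1
  refine ⟨aθ, p, q, F, e1, (isTransport_iff_tr_eq (by omega) hl).2 f2,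
    isProduct_of_tr_eq hs0 hl hl e1 f3, isFper_of_tr_eq hB hs hl hl e1 e1 f4, ?_⟩
  rw [← hasDerivWithinAt_tr, tr_neg, tr_add, tr_add, tr_smul, tr_smul, f2, f3, f4, add_assoc,
    neg_add', ← bilL_equationSymbol hB c μ hs]
  exact (hd t ht).congr (fun x hx => (hh x hx).2.symm) (hh t ht).2.symm

theorem ContinuousInH.mono {ν ν' : ℕ} (hν : ν ≤ ν') (ha : ContinuousInH ν' T a) :
    ContinuousInH ν T a :=
  ⟨fun t ht => (ha.1 t ht).mono hν, fun t ht =>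
    tendsto_of_tendsto_of_tendsto_of_le_of_le tendsto_const_nhds (ha.2 t ht)
      (fun _ => zero_le) fun _ => sobolevNorm_mono hν _⟩

/-- The `L²` distance of the lifted functions is, up to `√Θ`, the `H^s` distance of the originals.
-/
theorem ContinuousInH.continuousOn (ha : ContinuousInH s T a)
    (hh : ∀ t ∈ Icc 0 T, lowerL (sobolevBracket d Θ) s (h t) = tr (a t)) :
    ContinuousOn h (Icc 0 T) := by
  intro t₀ ht₀
  have h1 := ENNReal.Tendsto.const_mul (a := (ENNReal.ofReal √Θ)⁻¹) (ha.2 t₀ ht₀)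
    (Or.inr (ENNReal.inv_ne_top.2 ofReal_sqrt_ne_zero))
  rw [mul_zero] at h1
  rw [ContinuousWithinAt, tendsto_iff_edist_tendsto_0]
  refine h1.congr' ?_
  filter_upwards [self_mem_nhdsWithin] with t ht
  have e : lowerL (sobolevBracket d Θ) s (h t - h t₀) = tr (a t - a t₀) := by
    rw [map_sub, tr_sub, hh t ht, hh t₀ ht₀]
  rw [sobolevNorm_eq_enorm e, ← mul_assoc, ENNReal.inv_mul_cancel ofReal_sqrt_ne_zero
    ENNReal.ofReal_ne_top, one_mul, edist_eq_enorm_sub]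

/-- Uniqueness for the Cauchy problem. -/
theorem eqOn_of_solves (hB : FperBound δ₁ δ₃ B M) (hs : M + (sobolevBracket d Θ).σ ≤ s) {a' : ℝ → L2 d Θ}
    (ha : Solves δ₁ δ₃ w c μ T a₀ a) (ha' : Solves δ₁ δ₃ w c μ T a₀ a')
    (hc : ContinuousInH s T a) (hc' : ContinuousInH s T a') : EqOn a' a (Icc 0 T) := by
  have key : ∀ {e : ℝ → L2 d Θ}, ContinuousInH s T e → ∃ h : ℝ → Lp ℂ 2 (freq d),
      (∀ t ∈ Icc 0 T, IsReal (h t) ∧ lowerL (sobolevBracket d Θ) s (h t) = tr (e t)) ∧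
      ∃ K, ∀ t ∈ Icc 0 T, ‖h t‖ ≤ K := by
    intro e he
    have : ∀ t, ∃ x : Lp ℂ 2 (freq d), t ∈ Icc 0 T →
        IsReal x ∧ lowerL (sobolevBracket d Θ) s x = tr (e t) := by
      intro t
      by_cases ht : t ∈ Icc 0 T
      · obtain ⟨x, hx⟩ := exists_lowerL_eq (he.1 t ht)
        exact ⟨x, fun _ => hx⟩
      · exact ⟨0, fun h => absurd h ht⟩
    choose x hx using this
    -- Continuity in `H^s` on a compact interval supplies the uniform bound that the stability
    -- estimate needs; no bound is part of the notion of solution.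
    exact ⟨x, hx, isCompact_Icc.exists_bound_of_continuousOn
      (he.continuousOn fun t ht => (hx t ht).2)⟩
  obtain ⟨h, hh, K, hK⟩ := key hc
  obtain ⟨h', hh', K', hK'⟩ := key hc'
  have d1 := ha.hasDerivWithinAt_lowerL hB hs hh
  have d2 := ha'.hasDerivWithinAt_lowerL hB hs hh'
  intro t ht
  have h0 : (0 : ℝ) ∈ Icc 0 T := left_mem_Icc.2 (ht.1.trans ht.2)
  have := fourier_solution_unique (equationSymbol d Θ hB c μ) (transportSymbol Θ w) hs
    (K := max K K') (fun t ht => ⟨(hh t ht).1, (hK t ht).trans (le_max_left _ _), d1 t ht⟩)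
    (fun t ht => ⟨(hK' t ht).trans (le_max_right _ _), d2 t ht⟩)
    (by rw [(hh 0 h0).2, (hh' 0 h0).2, ha.1, ha'.1]) t ht
  rw [(hh t ht).2, (hh' t ht).2] at this
  exact (tr_injective this).symm

/-- Continuity in `H^ν` follows from continuity in `L²` and uniform bounds in all weighted norms. -/
theorem continuousInH_of_wnorm_le {ν : ℕ} (ha : ContinuousOn a (Icc 0 T))
    (hh : ∀ t ∈ Icc 0 T, lowerL (sobolevBracket d Θ) s (h t) = tr (a t)) (h0 : a 0 = a₀)
    (hT : 0 ≤ T) (hw : ∀ p, ∃ C : ℝ≥0∞, C ≠ ∞ ∧ ∀ φ, IsWeight p φ → ∀ t ∈ Icc 0 T,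
      wnorm (sobolevBracket d Θ) s φ (h t) ≤ C * wnorm (sobolevBracket d Θ) s φ (h 0))
    (hm : MemH ν a₀) : ContinuousInH ν T a := by
  set b := sobolevBracket d Θ with hb
  have hwn : ∀ φ, ∀ t ∈ Icc 0 T, wnorm b s φ (h t) =
      eLpNorm (fun x => φ (b x) • tr (a t) x) 2 (freq d) := by
    intro φ t ht
    refine eLpNorm_congr_ae ?_
    filter_upwards [tr_ae_eq_lower (hh t ht)] with x hx
    rw [hx]
  have h0T : (0 : ℝ) ∈ Icc 0 T := left_mem_Icc.2 hT
  refine ⟨fun t ht => ?_, fun t₀ ht₀ => ?_⟩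
  · obtain ⟨C, hC, hCw⟩ := hw ν
    have := hCw _ (isWeight_pow ν) t ht
    rw [hwn _ t ht, hwn _ 0 h0T, h0] at this
    exact memH_iff.2 (this.trans_lt (ENNReal.mul_lt_top hC.lt_top (memH_iff.1 hm)))
  -- All the truncated weights below have growth exponent `ν + 1`, so one constant controls the
  -- tails at every cutoff and every time by those of the data.
  obtain ⟨C, hC, hCw⟩ := hw (ν + 1)
  simp_rw [sobolevNorm_eq]
  rw [← mul_zero (ENNReal.ofReal √Θ)]
  refine ENNReal.Tendsto.const_mul ?_ (Or.inr ENNReal.ofReal_ne_top)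
  set φ : ℕ → ℝ → ℝ := fun r q => q ^ ν * min 1 (q / ((r : ℝ) + 1)) with hφ
  have hφw : ∀ r, IsWeight (ν + 1) (φ r) := fun r => isWeight_pow_mul_min ν (by positivity)
  have hφ0 : ∀ r x, 0 ≤ φ r (b x) := fun r x => (hφw r).nonneg _ (b.one_le x)
  have hlim : Tendsto (fun r : ℕ => 2 * (C * wnorm b s (φ r) (h 0))) atTop (𝓝 0) := by
    have h1 := tendsto_eLpNorm_min (b := b) (memLp_pow_smul_tr hm)
    have h2 : (fun r : ℕ => wnorm b s (φ r) (h 0)) = fun r : ℕ =>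
        eLpNorm (fun x => min 1 (b x / ((r : ℝ) + 1)) • (b x ^ ν • tr a₀ x)) 2 (freq d) := by
      funext r
      rw [hwn _ 0 h0T, h0]
      refine congrArg (eLpNorm · 2 (freq d)) (funext fun x => ?_)
      rw [smul_smul, mul_comm]
    rw [← h2] at h1
    have h3 := ENNReal.Tendsto.const_mul (a := C) h1 (Or.inr hC)
    have h4 := ENNReal.Tendsto.const_mul (a := 2) h3 (Or.inr ENNReal.ofNat_ne_top)
    simpa using h4
  have hbound : ∀ (r : ℕ), ∀ t ∈ Icc 0 T,
      eLpNorm (fun x => b x ^ ν • tr (a t - a t₀) x) 2 (freq d) ≤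
        ENNReal.ofReal (((r : ℝ) + 1) ^ ν) * ‖tr (a t - a t₀)‖ₑ +
          2 * (C * wnorm b s (φ r) (h 0)) := by
    intro r t ht
    have h1 := eLpNorm_pow_smul_sub_le b ν (ρ := (r : ℝ) + 1) (by positivity) (tr (a t)) (tr (a t₀))
    rw [← tr_sub] at h1
    have h2 := hCw _ (hφw r) t ht
    have h3 := hCw _ (hφw r) t₀ ht₀
    rw [hwn _ t ht] at h2
    rw [hwn _ t₀ ht₀] at h3
    rw [two_mul]
    exact h1.trans (add_le_add_right (add_le_add h2 h3) _)
  rw [ENNReal.tendsto_nhds_zero]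
  intro ε hε
  have hε2 : 0 < ε / 2 := ENNReal.half_pos hε.ne'
  obtain ⟨r, hr⟩ := ((ENNReal.tendsto_nhds_zero.1 hlim) (ε / 2) hε2).exists
  have hcont : Tendsto (fun t => ENNReal.ofReal (((r : ℝ) + 1) ^ ν) * ‖tr (a t - a t₀)‖ₑ)
      (𝓝[Icc 0 T] t₀) (𝓝 0) := by
    have h1 : Tendsto (fun t => tr (a t - a t₀)) (𝓝[Icc 0 T] t₀) (𝓝 0) := by
      have h2 : Tendsto (fun t => a t - a t₀) (𝓝[Icc 0 T] t₀) (𝓝 0) := by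
        simpa using (ha t₀ ht₀).tendsto.sub_const (a t₀)
      have h3 := ((trL d Θ).continuous.tendsto 0).comp h2
      rw [map_zero] at h3
      exact h3
    have h4 := ENNReal.Tendsto.const_mul (a := ENNReal.ofReal (((r : ℝ) + 1) ^ ν)) h1.enorm
      (Or.inr ENNReal.ofReal_ne_top)
    simpa using h4
  filter_upwards [(ENNReal.tendsto_nhds_zero.1 hcont) (ε / 2) hε2, self_mem_nhdsWithin]
    with t h1 ht
  exact (hbound r t ht).trans ((add_le_add h1 hr).trans_eq (ENNReal.add_halves ε))

variable (w c μ) in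
/-- Local existence for the Cauchy problem, with propagation of regularity. -/
theorem exists_solves (hB : FperBound δ₁ δ₃ B M) (hs : M + (sobolevBracket d Θ).σ + 1 ≤ s) {R : ℝ} (hR : 0 < R) :
    ∃ T > 0, ∀ a₀ : L2 d Θ, sobolevNorm s a₀ ≤ ENNReal.ofReal R → ∃ a : ℝ → L2 d Θ,
      Solves δ₁ δ₃ w c μ T a₀ a ∧ ∀ ν, MemH ν a₀ → ContinuousInH ν T a := by
  have hΘ : 0 < √Θ := Real.sqrt_pos.2 (period_pos Θ)
  have hs' := Nat.le_of_succ_le hs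
  -- The radius is divided by `√Θ` to pass from the Sobolev norm to the `L²` norm of `h₀`.
  obtain ⟨T, hT, hex⟩ := exists_fourier_solution (equationSymbol d Θ hB c μ)
    (transportSymbol Θ w) hs (R := R / √Θ) (by positivity)
  refine ⟨T, hT, fun a₀ ha₀ => ?_⟩
  obtain ⟨h₀, hr₀, hl₀⟩ := exists_lowerL_eq (s := s) (u := a₀)
    (ha₀.trans_lt ENNReal.ofReal_lt_top)
  have hn : ‖h₀‖ ≤ R / √Θ := by
    rw [sobolevNorm_eq_enorm hl₀, ← ofReal_norm, ← ENNReal.ofReal_mul hΘ.le,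
      ENNReal.ofReal_le_ofReal_iff hR.le] at ha₀
    rwa [le_div_iff₀' hΘ]
  obtain ⟨h, hh0, hhc, hhr, hhd, hhw⟩ := hex h₀ hr₀ hn
  have : ∀ t, ∃ u : L2 d Θ, t ∈ Icc 0 T → lowerL (sobolevBracket d Θ) s (h t) = tr u := by
    intro t
    by_cases ht : t ∈ Icc 0 T
    -- Synthesis requires an integrable transform, which `s ≥ σ` guarantees.
    · have hi : Integrable (lowerL (sobolevBracket d Θ) s (h t)) (freq d) :=
        (integrable_lower _ (by omega) (h t)).congr (coeFn_lowerL _ s (h t)).symm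
      obtain ⟨u, hu, -⟩ := exists_tr_eq Θ ((hhr t ht).lowerL _ s) hi
      exact ⟨u, fun _ => hu.symm⟩
    · exact ⟨0, fun h => absurd h ht⟩
  choose a ha using this
  have h0T : (0 : ℝ) ∈ Icc 0 T := left_mem_Icc.2 hT.le
  have ha0 : a 0 = a₀ := tr_injective (by rw [← ha 0 h0T, hh0, hl₀])
  have hsol : Solves δ₁ δ₃ w c μ T a₀ a :=
    solves_of_hasDerivWithinAt hB ha0 hs' (fun t ht => ⟨hhr t ht, ha t ht⟩) hhd
  have hac : ContinuousOn a (Icc 0 T) := fun t ht => by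
    obtain ⟨_, _, _, _, _, _, _, _, hd⟩ := hsol.2 t ht
    exact hd.continuousWithinAt
  refine ⟨a, hsol, fun ν hν => continuousInH_of_wnorm_le hac ha ha0 hT.le ?_ hν⟩
  rw [hh0]
  exact hhw

end Evolution

/-! ### Small divisors. -/

section SmallDivisors

/-- A homogeneous binary cubic form with three distinct roots factors. -/
theorem cubic_eq_of_roots {a c₀ c₁ c₂ x y z : ℝ} (hxy : x ≠ y) (hyz : y ≠ z) (hxz : x ≠ z)
    (hx : c₀ + x * c₁ + x ^ 2 * c₂ + x ^ 3 * a = 0) (hy : c₀ + y * c₁ + y ^ 2 * c₂ + y ^ 3 * a = 0)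
    (hz : c₀ + z * c₁ + z ^ 2 * c₂ + z ^ 3 * a = 0) (s ζ : ℝ) :
    s ^ 3 * c₀ + s ^ 2 * ζ * c₁ + s * ζ ^ 2 * c₂ + ζ ^ 3 * a =
      a * ((ζ - s * x) * (ζ - s * y) * (ζ - s * z)) := by
  -- Divided differences of the cubic at its roots yield Vieta's formulas.
  have h1 : c₁ + (x + y) * c₂ + (x ^ 2 + x * y + y ^ 2) * a = 0 :=
    mul_left_cancel₀ (sub_ne_zero.2 hxy) (by linear_combination hx - hy)
  have h2 : c₁ + (y + z) * c₂ + (y ^ 2 + y * z + z ^ 2) * a = 0 :=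
    mul_left_cancel₀ (sub_ne_zero.2 hyz) (by linear_combination hy - hz)
  have h3 : c₂ + (x + y + z) * a = 0 :=
    mul_left_cancel₀ (sub_ne_zero.2 hxz) (by linear_combination h1 - h2)
  have e2 : c₂ = -((x + y + z) * a) := by linarith
  have e1 : c₁ = (x * y + y * z + x * z) * a := by
    linear_combination h1 - (x + y) * h3
  have e0 : c₀ = -(x * y * z * a) := by
    linear_combination hx - x * h1 + x * y * h3
  rw [e0, e1, e2]
  ring

/-- The determinant of a pencil of `3 × 3` matrices is a binary cubic form; the mixed coefficients
are the traces of `adj(N) A` and of `adj(A) N`. -/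
theorem det_smul_add_smul (N A : Matrix (Fin 3) (Fin 3) ℝ) :
    ∃ c₁ c₂ : ℝ, ∀ s ζ : ℝ, (s • N + ζ • A).det =
      s ^ 3 * N.det + s ^ 2 * ζ * c₁ + s * ζ ^ 2 * c₂ + ζ ^ 3 * A.det := by
  refine ⟨A 0 0 * (N 1 1 * N 2 2 - N 1 2 * N 2 1) + A 0 1 * (N 1 2 * N 2 0 - N 1 0 * N 2 2) +
    A 0 2 * (N 1 0 * N 2 1 - N 1 1 * N 2 0) + A 1 0 * (N 0 2 * N 2 1 - N 0 1 * N 2 2) +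
    A 1 1 * (N 0 0 * N 2 2 - N 0 2 * N 2 0) + A 1 2 * (N 0 1 * N 2 0 - N 0 0 * N 2 1) +
    A 2 0 * (N 0 1 * N 1 2 - N 0 2 * N 1 1) + A 2 1 * (N 0 2 * N 1 0 - N 0 0 * N 1 2) +
    A 2 2 * (N 0 0 * N 1 1 - N 0 1 * N 1 0),
    N 0 0 * (A 1 1 * A 2 2 - A 1 2 * A 2 1) + N 0 1 * (A 1 2 * A 2 0 - A 1 0 * A 2 2) +
    N 0 2 * (A 1 0 * A 2 1 - A 1 1 * A 2 0) + N 1 0 * (A 0 2 * A 2 1 - A 0 1 * A 2 2) +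
    N 1 1 * (A 0 0 * A 2 2 - A 0 2 * A 2 0) + N 1 2 * (A 0 1 * A 2 0 - A 0 0 * A 2 1) +
    N 2 0 * (A 0 1 * A 1 2 - A 0 2 * A 1 1) + N 2 1 * (A 0 2 * A 1 0 - A 0 0 * A 1 2) +
    N 2 2 * (A 0 0 * A 1 1 - A 0 1 * A 1 0), fun s ζ => ?_⟩
  simp only [Matrix.det_fin_three, Matrix.add_apply, Matrix.smul_apply, smul_eq_mul]
  ring

variable {d : ℕ} {A : Fin (d - 1) → Matrix (Fin 3) (Fin 3) ℝ} {Ad : Matrix (Fin 3) (Fin 3) ℝ}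
  {τ : ℝ} {η : Fin (d - 1) → ℝ} {ω : Fin 3 → ℝ}

theorem symbol_eq (s ζ : ℝ) : symbol A Ad (s * τ) (fun j => s * η j) ζ =
    s • (τ • (1 : Matrix (Fin 3) (Fin 3) ℝ) + ∑ j, η j • A j) + ζ • Ad := by
  simp only [symbol, smul_add, Finset.smul_sum, smul_smul]

/-- The determinant of the symbol at the sum of two phases. -/
theorem det_symbol_eq (hω : Function.Injective ω) (hroot : ∀ m, (symbol A Ad τ η (ω m)).det = 0)
    (k l : ℝ) : (symbol A Ad ((k + l) * τ) (fun j => (k + l) * η j) (k * ω 0 + l * ω 2)).det =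
      -(Ad.det * (ω 2 - ω 0) ^ 3) * (k * l * (k * delta₁ ω + l * delta₃ ω)) := by
  obtain ⟨c₁, c₂, hc⟩ :=
    det_smul_add_smul (τ • (1 : Matrix (Fin 3) (Fin 3) ℝ) + ∑ j, η j • A j) Ad
  have hr : ∀ m, (τ • (1 : Matrix (Fin 3) (Fin 3) ℝ) + ∑ j, η j • A j).det +
      ω m * c₁ + ω m ^ 2 * c₂ + ω m ^ 3 * Ad.det = 0 := by
    intro m
    have h1 := hroot m
    have h2 := symbol_eq (A := A) (Ad := Ad) (τ := τ) (η := η) 1 (ω m)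
    simp only [one_mul] at h2
    rw [h2, hc] at h1
    linarith
  -- At `s = k + l` and `ζ = k ω₀ + l ω₂` (indices from `0`) the three linear factors are `l (ω₂ -
  -- ω₀)`, `(ω₂ - ω₀)(k δ₁ + l δ₃)` and `-k (ω₂ - ω₀)`.
  rw [symbol_eq, hc, cubic_eq_of_roots (hω.ne (by decide)) (hω.ne (by decide))
    (hω.ne (by decide)) (hr 0) (hr 1) (hr 2)]
  have h20 : ω 2 - ω 0 ≠ 0 := sub_ne_zero.2 (hω.ne (by decide))
  simp only [delta₁, delta₃]
  field_simp
  ring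

/-- The divisor `D` is compared with `x`, meant to be the smaller index. If `p x ≤ q y / 2` then `D
≥ q y / 2`, which cancels `y` and leaves a multiple of `x`. Otherwise `y ≤ (2p/q) x`, and the lower
bound on `D` costs `(x y)² (x + y)^N`, a multiple of `x^(N+4)`. -/
theorem mul_le_of_divisor_bound {x y p q D K : ℝ} {N : ℕ} (hx : 1 ≤ x) (hy : 0 < y)
    (hp : 0 ≤ p) (hq : 0 < q) (hK : 0 ≤ K) (hD0 : 0 ≤ D) (hD : q * y - p * x ≤ D)
    (h : 1 ≤ K * (x * y * (x + y) ^ N * D)) :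
    x * y ≤ (2 / q + K * (2 * p / q) ^ 2 * (1 + 2 * p / q) ^ N) * x ^ (N + 4) * D := by
  have hx0 : 0 < x := zero_lt_one.trans_le hx
  rcases le_or_gt (p * x) (q * y / 2) with hc | hc
  · have h1 : x * y ≤ 2 / q * x * D := by
      have : q * y / 2 ≤ D := by linarith
      calc x * y = 2 / q * x * (q * y / 2) := by field_simp
        _ ≤ _ := by gcongr
    have h2 : x ≤ x ^ (N + 4) := le_self_pow₀ hx (by omega)
    calc x * y ≤ 2 / q * x * D := h1
      _ ≤ (2 / q + K * (2 * p / q) ^ 2 * (1 + 2 * p / q) ^ N) * x ^ (N + 4) * D := by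
        gcongr
        exact le_add_of_nonneg_right (by positivity)
  · set Q := 2 * p / q with hQ
    have hQ0 : 0 ≤ Q := by positivity
    have hyQ : y ≤ Q * x := by
      rw [hQ, div_mul_eq_mul_div, le_div_iff₀ hq]
      linarith
    calc x * y = x * y * 1 := (mul_one _).symm
      _ ≤ x * y * (K * (x * y * (x + y) ^ N * D)) := by gcongr
      _ ≤ x * (Q * x) * (K * (x * (Q * x) * (x + Q * x) ^ N * D)) := by gcongr
      _ = (K * Q ^ 2 * (1 + Q) ^ N) * x ^ (N + 4) * D := by
        have : x + Q * x = (1 + Q) * x := by ring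
        rw [this, mul_pow]
        ring
      _ ≤ _ := by
        gcongr
        exact le_add_of_nonneg_left (by positivity)

/-- The small divisor condition bounds the symbol of `𝔽_per(∂_θ·, ∂_θ·)`. -/
theorem exists_fperBound (hAd : Ad.det ≠ 0) (hω : Function.Injective ω)
    (hroot : ∀ m, (symbol A Ad τ η (ω m)).det = 0) (hsd : SmallDivisor A Ad τ η ω) :
    ∃ (B : ℝ) (M : ℕ), FperBound (delta₁ ω) (delta₃ ω) B M := by
  obtain ⟨c, hc, γ, hγ⟩ := hsd
  -- The exponent may be increased to a natural number because `|(k, l)| ≥ 1`; a negative `γ` needs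
  -- no separate treatment.
  obtain ⟨N, hN⟩ := exists_nat_ge γ
  have h20 : ω 2 - ω 0 ≠ 0 := sub_ne_zero.2 (hω.ne (by decide))
  have hp : 0 < |delta₁ ω| :=
    abs_pos.2 (div_ne_zero (sub_ne_zero.2 (hω.ne (by decide))) h20)
  have hq : 0 < |delta₃ ω| :=
    abs_pos.2 (div_ne_zero (sub_ne_zero.2 (hω.ne (by decide))) h20)
  set p := |delta₁ ω| with hpd
  set q := |delta₃ ω| with hqd
  set K := |Ad.det * (ω 2 - ω 0) ^ 3| / c with hK
  have hK0 : 0 ≤ K := by positivity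
  set B₁ := 2 / q + K * (2 * p / q) ^ 2 * (1 + 2 * p / q) ^ N with hB₁
  set B₂ := 2 / p + K * (2 * q / p) ^ 2 * (1 + 2 * q / p) ^ N with hB₂
  refine ⟨max B₁ B₂, N + 4, le_max_of_le_left (by positivity), by omega, fun k l => ?_⟩
  unfold fperMul
  split_ifs with hkl
  swap
  · rw [norm_zero, zero_mul]
    have : 0 ≤ max B₁ B₂ := le_max_of_le_left (by positivity)
    positivity
  have hk : k ≠ 0 := fun h => hkl (by rw [h, zero_mul])
  have hl : l ≠ 0 := fun h => hkl (by rw [h, mul_zero])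
  have hx : (1 : ℝ) ≤ |(k : ℝ)| := by exact_mod_cast Int.one_le_abs hk
  have hy : (1 : ℝ) ≤ |(l : ℝ)| := by exact_mod_cast Int.one_le_abs hl
  set D := |(k : ℝ) * delta₁ ω + l * delta₃ ω| with hD
  have h1 := hγ k l hk hl
  rw [det_symbol_eq hω hroot] at h1
  have habs : |-(Ad.det * (ω 2 - ω 0) ^ 3) * (k * l * (k * delta₁ ω + l * delta₃ ω))| =
      |Ad.det * (ω 2 - ω 0) ^ 3| * (|(k : ℝ)| * |(l : ℝ)| * D) := by
    rw [abs_mul, abs_neg, abs_mul (k * l : ℝ), abs_mul (k : ℝ) l]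
  rw [habs] at h1
  set r := √((k : ℝ) ^ 2 + (l : ℝ) ^ 2) with hr
  have hr1 : 1 ≤ r := by
    rw [hr, Real.one_le_sqrt]
    have := one_le_pow₀ hx (n := 2)
    rw [sq_abs] at this
    nlinarith [sq_nonneg (l : ℝ)]
  have hrl : r ≤ |(k : ℝ)| + |(l : ℝ)| := by
    refine Real.sqrt_le_iff.2 ⟨by positivity, ?_⟩
    have e1 := sq_abs (k : ℝ)
    have e2 := sq_abs (l : ℝ)
    nlinarith [abs_nonneg (k : ℝ), abs_nonneg (l : ℝ)]
  have hrN : r ^ γ ≤ (|(k : ℝ)| + |(l : ℝ)|) ^ N := by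
    calc r ^ γ ≤ r ^ (N : ℝ) := Real.rpow_le_rpow_of_exponent_le hr1 hN
      _ = r ^ N := Real.rpow_natCast _ _
      _ ≤ _ := by gcongr
  have hdiv : 1 ≤ K * (|(k : ℝ)| * |(l : ℝ)| * (|(k : ℝ)| + |(l : ℝ)|) ^ N * D) := by
    have hrpos : 0 < r ^ γ := Real.rpow_pos_of_pos (by linarith) _
    rw [Real.rpow_neg (by linarith), ← div_eq_mul_inv, div_le_iff₀ hrpos] at h1
    have h2 : c ≤ |Ad.det * (ω 2 - ω 0) ^ 3| * (|(k : ℝ)| * |(l : ℝ)| * D) *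
        (|(k : ℝ)| + |(l : ℝ)|) ^ N := h1.trans (by gcongr)
    rw [hK, div_mul_eq_mul_div, one_le_div hc]
    refine h2.trans (le_of_eq (by ring))
  -- The small divisor condition excludes resonances, so the quotient defining the multiplier is
  -- never a division by zero.
  have hD0 : 0 < D := by
    rcases (abs_nonneg ((k : ℝ) * delta₁ ω + l * delta₃ ω)).lt_or_eq with h | h
    · exact h
    · rw [← hD] at h
      rw [← h] at hdiv
      norm_num at hdiv
  have hd1 : q * |(l : ℝ)| - p * |(k : ℝ)| ≤ D := by
    have := abs_sub_abs_le_abs_sub ((l : ℝ) * delta₃ ω) (-(k * delta₁ ω))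
    rw [abs_neg, abs_mul, abs_mul, sub_neg_eq_add, add_comm ((l : ℝ) * delta₃ ω)] at this
    linarith
  have hd2 : p * |(k : ℝ)| - q * |(l : ℝ)| ≤ D := by
    have := abs_sub_abs_le_abs_sub ((k : ℝ) * delta₁ ω) (-(l * delta₃ ω))
    rw [abs_neg, abs_mul, abs_mul, sub_neg_eq_add] at this
    linarith
  have hnorm : ‖Complex.I / (((k : ℝ) * delta₁ ω + l * delta₃ ω : ℝ) : ℂ)‖ = D⁻¹ := by
    rw [norm_div, Complex.norm_I, Complex.norm_real, Real.norm_eq_abs, one_div]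
  rw [hnorm, inv_mul_le_iff₀ hD0]
  rcases le_total |(k : ℝ)| |(l : ℝ)| with hle | hle
  · rw [min_eq_left hle]
    have := mul_le_of_divisor_bound hx (by linarith) hp.le hq hK0 hD0.le hd1 hdiv
    refine this.trans ?_
    rw [mul_comm D]
    gcongr
    exact le_max_left _ _
  · rw [min_eq_right hle]
    have hdiv' : 1 ≤ K * (|(l : ℝ)| * |(k : ℝ)| * (|(l : ℝ)| + |(k : ℝ)|) ^ N * D) := by
      rwa [mul_comm |(l : ℝ)|, add_comm |(l : ℝ)|]
    have := mul_le_of_divisor_bound hy (by linarith) hq.le hp hK0 hD0.le hd2 hdiv'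
    rw [mul_comm |(k : ℝ)|]
    refine this.trans ?_
    rw [mul_comm D]
    gcongr
    exact le_max_right _ _

end SmallDivisors

end MachStem

end

/-! ### The main theorem. -/

theorem mainTheorem3 (d : ℕ) (hd : 1 ≤ d) (Θ : ℝ) [Fact (0 < Θ)]
    (A : Fin (d - 1) → Matrix (Fin 3) (Fin 3) ℝ) (Ad : Matrix (Fin 3) (Fin 3) ℝ)
    (hAd : Ad.det ≠ 0)
    (τ : ℝ) (η : Fin (d - 1) → ℝ) (ω : Fin 3 → ℝ) (hω : Function.Injective ω)
    (hroot : ∀ m, (symbol A Ad τ η (ω m)).det = 0)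
    (hsd : SmallDivisor A Ad τ η ω) :
    ∃ ν₀ : ℕ, 1 + (d : ℝ) / 2 < ν₀ ∧
      TameEstimate d Θ (delta₁ ω) (delta₃ ω) ν₀ ∧
      ∀ (w : Tan d) (c μ : ℝ), ∀ R > (0 : ℝ), ∃ T > (0 : ℝ),
        (∀ ν ≥ ν₀, ∀ a₀ : L2 d Θ, MemH ν a₀ → sobolevNorm ν₀ a₀ ≤ ENNReal.ofReal R →
          ∃ a : ℝ → L2 d Θ, IsSolution ν (delta₁ ω) (delta₃ ω) w c μ T a₀ a ∧
            ∀ b : ℝ → L2 d Θ, IsSolution ν (delta₁ ω) (delta₃ ω) w c μ T a₀ b →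
              Set.EqOn b a (Set.Icc 0 T)) ∧
        (∀ a₀ : L2 d Θ, (∀ ν, MemH ν a₀) → sobolevNorm ν₀ a₀ ≤ ENNReal.ofReal R →
          ∃ a : ℝ → L2 d Θ, (∀ ν, ContinuousInH ν T a) ∧
            Solves (delta₁ ω) (delta₃ ω) w c μ T a₀ a ∧
            ∀ ν ≥ ν₀, ∀ b : ℝ → L2 d Θ, IsSolution ν (delta₁ ω) (delta₃ ω) w c μ T a₀ b →
              Set.EqOn b a (Set.Icc 0 T)) := by
  obtain ⟨B, M, hB⟩ := exists_fperBound hAd hω hroot hsd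
  have hσ : (sobolevBracket d Θ).σ = d + 2 := rfl
  have hs : M + (sobolevBracket d Θ).σ + 1 ≤ M + (d + 2) + 1 := by rw [hσ]
  have hs' := Nat.le_of_succ_le hs
  -- The base index is the sum of `M`, the derivatives lost on the low frequency factor, of `σ = d +
  -- 2`, which makes transforms integrable, and of `1`, which makes the truncation errors of the
  -- Galerkin scheme vanish.
  refine ⟨M + (d + 2) + 1, ?_, tameEstimate hB hs', fun w c μ R hR => ?_⟩
  · push_cast
    have h1 : (0 : ℝ) ≤ M := M.cast_nonneg
    have h2 : (0 : ℝ) ≤ d := d.cast_nonneg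
    linarith
  -- The time is obtained before `ν` and `a₀` are introduced, hence depends on the data only through
  -- `R`.
  obtain ⟨T, hT, hex⟩ := exists_solves w c μ hB hs hR
  refine ⟨T, hT, fun ν hν a₀ hm hn => ?_, fun a₀ hm hn => ?_⟩
  · obtain ⟨a, ha, hc⟩ := hex a₀ hn
    -- Uniqueness is taken from the class of base regularity, which contains that of index `ν`.
    exact ⟨a, ⟨hc ν hm, ha⟩, fun b hb =>
      eqOn_of_solves hB hs' ha hb.2 ((hc ν hm).mono hν) (hb.1.mono hν)⟩
  · obtain ⟨a, ha, hc⟩ := hex a₀ hn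
    exact ⟨a, fun ν => hc ν (hm ν), ha, fun ν hν b hb =>
      eqOn_of_solves hB hs' ha hb.2 (hc _ (hm _)) (hb.1.mono hν)⟩
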